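/- **Conventions.** Let $R$ be a principal ideal domain (for instance $\mathbb Z$ or a field); all (co)homology is taken with coefficients in $R$. A simplicial complex on a finite ordered set $V$ is a set of subsets of $V$ closed under taking subsets; the void complex $\{\,\}$, the complex $\{\emptyset\}$ and ghost vertices are allowed. For disjoint $\sigma,\omega\subset V$ put $K_{\sigma,\omega}=\{\tau\subset\omega\mid\sigma\cup\tau\in K\}$. Let $\mathscr X_V=\{(\sigma,\omega)\mid\sigma,\omega\subset V,\ \sigma\cap\omega=\emptyset\}$, $\mathscr R_V=\{(\emptyset,\omega)\mid\omega\subset V\}$; write $\mathscr X_m=\mathscr X_{[m]}$, $\mathscr R_m=\mathscr R_{[m]}$, and $\mathscr X=\mathscr X_1$, $\mathscr R=\mathscr R_1$. Let $T$ be the complex with basis $\alpha,\beta,\gamma,\eta$, $|\beta|=1$, $|\alpha|=|\gamma|=|\eta|=0$, $d\beta=\gamma$, $d\alpha=d\gamma=d\eta=0$; $\alpha$ has index $(\{1\},\emptyset)$, $\beta,\gamma$ have index $(\emptyset,\{1\})$, $\eta$ has index $(\emptyset,\emptyset)$. The total chain complex $T_*^{\mathscr X_V}(K)\subset T^{\otimes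 V}$ is spanned by the words in $\alpha,\beta,\gamma,\eta$ whose letters $\alpha,\beta$ occupy the positions of a simplex of $K$. It is the direct sum of the subcomplexes $T_*^{\sigma,\omega}(K)$ spanned by the words with $\alpha$ exactly at the positions in $\sigma$ and $\beta$ or $\gamma$ exactly at those in $\omega$. For $\mathscr S\subset\mathscr X_V$ let $H_*^{\mathscr S}(K)$ and $H^*_{\mathscr S}(K)$ be the homology of $T_*^{\mathscr S}(K)=\bigoplus_{(\sigma,\omega)\in\mathscr S}T_*^{\sigma,\omega}(K)$ and the cohomology of its dual $\mathrm{Hom}(-,R)$ (the total (co)homology group for $\mathscr S=\mathscr X_V$, the right total (co)homology group for $\mathscr S=\mathscr R_V$); $H_*^{\sigma,\omega}(K)$, $H^*_{\sigma,\omega}(K)$ denote those for $\mathscr S=\{(\sigma,\omega)\}$. Let $K$ be a simplicial complex on $[m]$ and, for $k=1,\dots,m$, let $A_k\subset X_k$ be simplicial complexes on $[n_k]$. Let $[n]$ be the disjoint union of the $[n_k]$ in this order, and for $\sigma\subset[n]$ put $\sigma_k=\sigma\cap[n_k]$. The polyhedral join complex is $$\mathcal S(K;\underline X,\underline A)=\{\sigma\subset[n]\mid\exists\,\tau\in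 K:\ \sigma_k\in X_k\text{ for }k\in\tau,\ \sigma_k\in A_k\text{ for }k\notin\tau\}.$$ For $(\sigma_k,\omega_k)\in\mathscr X_{[n_k]}$ let $\iota_{\sigma_k,\omega_k}\colon\widetilde H_*((A_k)_{\sigma_k,\omega_k})\to\widetilde H_*((X_k)_{\sigma_k,\omega_k})$ and $\iota^\circ_{\sigma_k,\omega_k}\colon\widetilde H^*((X_k)_{\sigma_k,\omega_k})\to\widetilde H^*((A_k)_{\sigma_k,\omega_k})$ be the maps of reduced simplicial (co)homology induced by inclusion. The join is *total homology split* if the kernel, cokernel and image of $\iota_{\sigma_k,\omega_k}$ are free for all $k$ and all $(\sigma_k,\omega_k)\in\mathscr X_{[n_k]}$. With $\Sigma$ the suspension (raising degrees by one), let $H_*^{s;\sigma_k,\omega_k}(X_k,A_k)$ be $\Sigma\,\mathrm{coker}\,\iota_{\sigma_k,\omega_k}$, $\Sigma\ker\iota_{\sigma_k,\omega_k}$, $\Sigma\,\mathrm{im}\,\iota_{\sigma_k,\omega_k}$, and let $H^*_{s;\sigma_k,\omega_k}(X_k,A_k)$ be $\Sigma\ker\iota^\circ_{\sigma_k,\omega_k}$,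 $\Sigma\,\mathrm{coker}\,\iota^\circ_{\sigma_k,\omega_k}$, $\Sigma\,\mathrm{im}\,\iota^\circ_{\sigma_k,\omega_k}$, for $s=(\{1\},\emptyset)$, $(\emptyset,\{1\})$, $(\emptyset,\emptyset)$ respectively. For $(\hat\sigma,\hat\omega)\in\mathscr X_m$ let $s_k=(\{1\},\emptyset)$ if $k\in\hat\sigma$, $s_k=(\emptyset,\{1\})$ if $k\in\hat\omega$, $s_k=(\emptyset,\emptyset)$ otherwise; identify $(\hat\sigma,\hat\omega)$ with $(s_1,\dots,s_m)$ and put $$H_*^{\hat\sigma,\hat\omega;\sigma,\omega}(\underline X,\underline A)=\bigotimes_k H_*^{s_k;\sigma_k,\omega_k}(X_k,A_k),\qquad H^*_{\hat\sigma,\hat\omega;\sigma,\omega}(\underline X,\underline A)=\bigotimes_k H^*_{s_k;\sigma_k,\omega_k}(X_k,A_k).$$ For each $k$ let $\mathscr S_{n_k}\subset\mathscr X_{[n_k]}$ be any subset (in particular $\mathscr X_{[n_k]}$, $\mathscr R_{[n_k]}$, different choices for different $k$ being allowed, or a single index), and let $\mathscr S_n=\{(\sigma,\omega)\mid(\sigma_k,\omega_k)\in\mathscr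 S_{n_k}\text{ for all }k\}=\mathscr S_{n_1}\times\cdots\times\mathscr S_{n_m}$. Sums over indices are denoted by index sets, e.g. $H_*^{\mathscr X;\mathscr S_{n_k}}(X_k,A_k)=\bigoplus_{s\in\mathscr X,\,(\sigma_k,\omega_k)\in\mathscr S_{n_k}}H_*^{s;\sigma_k,\omega_k}(X_k,A_k)$, and $P^\Lambda\,\widehat\otimes\,Q^\Lambda=\bigoplus_{a\in\Lambda}P^a\otimes Q^a$ (graded tensor products over $R$). **Theorem 3.11.** Suppose that $\mathcal S(K;\underline X,\underline A)$ is total homology split, or that $R$ is a field. Then there are isomorphisms of graded $R$-modules $$H_*^{\mathscr S_n}(\mathcal S(K;\underline X,\underline A))\cong H_*^{\mathscr X_m}(K)\,\widehat\otimes\,H_*^{\mathscr X_m;\mathscr S_n}(\underline X,\underline A)\cong H_*^{\mathscr X_m}(K)\,\widehat\otimes\,\Big(\bigotimes_{k=1}^m H_*^{\mathscr X;\mathscr S_{n_k}}(X_k,A_k)\Big),$$ $$H^*_{\mathscr S_n}(\mathcal S(K;\underline X,\underline A))\cong H^*_{\mathscr X_m}(K)\,\widehat\otimes\,H^*_{\mathscr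 X_m;\mathscr S_n}(\underline X,\underline A)\cong H^*_{\mathscr X_m}(K)\,\widehat\otimes\,\Big(\bigotimes_{k=1}^m H^*_{\mathscr X;\mathscr S_{n_k}}(X_k,A_k)\Big).$$ If moreover $\iota_{\sigma_k,\omega_k}$ is an epimorphism for all $k$ and all $(\sigma_k,\omega_k)\in\mathscr S_{n_k}$, then the same holds with $\mathscr X_m$, $\mathscr X$ replaced by $\mathscr R_m$, $\mathscr R$, and $H_*^{\mathscr R;\mathscr S_{n_k}}(X_k,A_k)\cong H_*^{\mathscr S_{n_k}}(A_k)$, $H^*_{\mathscr R;\mathscr S_{n_k}}(X_k,A_k)\cong H^*_{\mathscr S_{n_k}}(A_k)$ as graded $R$-modules for every $k$. -/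

import Mathlib

open scoped DirectSum TensorProduct

universe u

section Complexes

variable {V : Type*}

/-- A (possibly void) abstract simplicial complex on the vertex set `V`: a set of finite subsets
of `V` closed under passing to subsets.  The empty simplex is a simplex of every non-void complex,
the void complex `⊥` has no simplex at all, and ghost vertices (`{v}` not a simplex) are allowed. -/
abbrev SComplex (V : Type*) := LowerSet (Finset V)

/-- `K_{σ,ω} = {τ ⊆ ω | σ ∪ τ ∈ K}`: the link of `σ` restricted to `ω` (for disjoint `σ, ω`). -/
def SComplex.link [DecidableEq V] (K : SComplex V) (σ ω : Finset V) : SComplex V where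
  carrier := {τ | τ ⊆ ω ∧ σ ∪ τ ∈ K}
  lower' := fun _ _ hba ha =>
    ⟨hba.trans ha.1, K.lower (Finset.union_subset_union_right hba) ha.2⟩

theorem SComplex.link_mono [DecidableEq V] {K L : SComplex V} (h : K ≤ L) (σ ω : Finset V) :
    K.link σ ω ≤ L.link σ ω :=
  fun _ hτ => ⟨hτ.1, h hτ.2⟩

/-- The index set `𝒳` of `V`: all pairs `(σ, ω)` of disjoint subsets. -/
def totalIndex (V : Type*) : Set (Finset V × Finset V) := {p | Disjoint p.1 p.2}

/-- The index set `ℛ` of `V`: all pairs `(∅, ω)`. -/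
def rightIndex (V : Type*) : Set (Finset V × Finset V) := {p | p.1 = ∅}

end Complexes

section Algebra

variable (R : Type u) [CommRing R]

/-- The quotient `Z / B` of two submodules `B ≤ Z` of a module (`Z / (Z ∩ B)` in general). -/
def Subquotient {R : Type u} [CommRing R] {M : Type*} [AddCommGroup M] [Module R M]
    (Z B : Submodule R M) : Type _ :=
  Z ⧸ B.submoduleOf Z

instance Subquotient.addCommGroup {R : Type u} [CommRing R] {M : Type*} [AddCommGroup M] [Module R M]
    (Z B : Submodule R M) : AddCommGroup (Subquotient Z B) :=
  inferInstanceAs (AddCommGroup (Z ⧸ B.submoduleOf Z))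

instance Subquotient.module {R : Type u} [CommRing R] {M : Type*} [AddCommGroup M] [Module R M]
    (Z B : Submodule R M) : Module R (Subquotient Z B) :=
  inferInstanceAs (Module R (Z ⧸ B.submoduleOf Z))

/-- The map of subquotients induced by a linear map. -/
def Subquotient.map {R : Type u} [CommRing R] {M N : Type*} [AddCommGroup M] [Module R M]
    [AddCommGroup N] [Module R N] {Z B : Submodule R M} {Z' B' : Submodule R N} (f : M →ₗ[R] N)
    (hZ : ∀ x ∈ Z, f x ∈ Z') (hB : ∀ x ∈ B, f x ∈ B') : Subquotient Z B →ₗ[R] Subquotient Z' B' :=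
  Submodule.mapQ (B.submoduleOf Z) (B'.submoduleOf Z') (f.restrict hZ) (fun x hx => hB x.1 hx)

/-- A graded subcomplex of a module `M` with respect to an endomorphism `d` of `M` lowering
degrees by one: the module of `n`-chains is `C n`. -/
structure Subcomplex {R : Type u} [CommRing R] {M : Type*} [AddCommGroup M] [Module R M]
    (d : M →ₗ[R] M) where
  C : ℤ → Submodule R M
  d_mem : ∀ i j : ℤ, j + 1 = i → ∀ x ∈ C i, d x ∈ C j
  d_d : ∀ i : ℤ, ∀ x ∈ C i, d (d x) = 0

namespace Subcomplex

variable {R} {M : Type*} [AddCommGroup M] [Module R M] {d : M →ₗ[R] M}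

/-- The differential `C i → C j`, where `i = j + 1`. -/
def diff (E : Subcomplex d) (i j : ℤ) (h : j + 1 = i) : E.C i →ₗ[R] E.C j :=
  d.restrict (E.d_mem i j h)

def cycles (E : Subcomplex d) (n : ℤ) : Submodule R (E.C n) :=
  LinearMap.ker (E.diff n (n - 1) (by omega))

def boundaries (E : Subcomplex d) (n : ℤ) : Submodule R (E.C n) :=
  LinearMap.range (E.diff (n + 1) n rfl)

/-- `H_n` of the complex: cycles modulo boundaries. -/
abbrev homology (E : Subcomplex d) (n : ℤ) : Type _ :=
  Subquotient (E.cycles n) (E.boundaries n)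

/-- Cocycles of the dual cochain complex `Hom(C n, R)`, with coboundary `f ↦ f ∘ d`. -/
def cocycles (E : Subcomplex d) (n : ℤ) : Submodule R (E.C n →ₗ[R] R) :=
  LinearMap.ker (LinearMap.lcomp R R (E.diff (n + 1) n rfl))

/-- Coboundaries of the dual cochain complex `Hom(C n, R)`. -/
def coboundaries (E : Subcomplex d) (n : ℤ) : Submodule R (E.C n →ₗ[R] R) :=
  LinearMap.range (LinearMap.lcomp R R (E.diff n (n - 1) (by omega)))

/-- `H^n` of the dual cochain complex: cocycles modulo coboundaries. -/
abbrev cohomology (E : Subcomplex d) (n : ℤ) : Type _ :=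
  Subquotient (E.cocycles n) (E.coboundaries n)

variable {E F : Subcomplex d}

/-- The map on homology induced by an inclusion of complexes. -/
def homologyMap (h : ∀ n, E.C n ≤ F.C n) (n : ℤ) : E.homology n →ₗ[R] F.homology n :=
  Subquotient.map (Submodule.inclusion (h n))
    (fun x hx => by
      have hx' : d x.1 = 0 := congrArg (fun z : E.C (n - 1) => (z : M)) (LinearMap.mem_ker.1 hx)
      exact LinearMap.mem_ker.2 (Subtype.ext hx'))
    (by
      rintro x ⟨y, hy⟩
      refine ⟨Submodule.inclusion (h (n + 1)) y, Subtype.ext ?_⟩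
      exact congrArg (fun z : E.C n => (z : M)) hy)

/-- The map on cohomology induced by an inclusion of complexes (restriction of cochains), dual to
`homologyMap`. -/
def cohomologyMap (h : ∀ n, E.C n ≤ F.C n) (n : ℤ) : F.cohomology n →ₗ[R] E.cohomology n :=
  Subquotient.map (LinearMap.lcomp R R (Submodule.inclusion (h n)))
    (fun f hf => by
      refine LinearMap.mem_ker.2 (LinearMap.ext fun x => ?_)
      exact LinearMap.congr_fun (LinearMap.mem_ker.1 hf) (Submodule.inclusion (h (n + 1)) x))
    (by
      rintro f ⟨g, hg⟩
      refine ⟨g ∘ₗ Submodule.inclusion (h (n - 1)), LinearMap.ext fun x => ?_⟩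
      exact LinearMap.congr_fun hg (Submodule.inclusion (h n) x))

end Subcomplex

/-- The boundary with alternating signs on the free module with basis `B`: each `b` has a finite
ordered set `P b` of removable positions, and `rm b v` is `b` with the position `v` removed; `b` is
sent to `∑ (-1)^i rm b vᵢ`, where `v₀ < v₁ < ⋯` are the elements of `P b`. -/
noncomputable def altBoundary {B V : Type*} [LinearOrder V] (P : B → Finset V) (rm : B → V → B) :
    (B →₀ R) →ₗ[R] (B →₀ R) :=
  Finsupp.linearCombination R (fun b =>
    ∑ v ∈ P b, Finsupp.single (rm b v) ((-1 : R) ^ ((P b).filter (· < v)).card))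

theorem altBoundary_altBoundary {B V : Type*} [LinearOrder V] (P : B → Finset V)
    (rm : B → V → B) (hP : ∀ b, ∀ v ∈ P b, P (rm b v) = (P b).erase v)
    (hrm : ∀ b u v, rm (rm b u) v = rm (rm b v) u) (x : B →₀ R) :
    altBoundary R P rm (altBoundary R P rm x) = 0 := by
  induction x using Finsupp.induction_linear with
  | zero => simp
  | add x y hx hy => rw [map_add, map_add, hx, hy, add_zero]
  | single b r =>
    have h1 : ∀ c : B, altBoundary R P rm (Finsupp.single c 1) =
        ∑ v ∈ P c, Finsupp.single (rm c v) ((-1 : R) ^ ((P c).filter (· < v)).card) := by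
      intro c
      rw [altBoundary, Finsupp.linearCombination_single, one_smul]
    have h2 : ∀ (c : B) (a : R), altBoundary R P rm (Finsupp.single c a) =
        a • altBoundary R P rm (Finsupp.single c 1) := by
      intro c a
      rw [← map_smul, Finsupp.smul_single, smul_eq_mul, mul_one]
    rw [h2, map_smul, h1, map_sum]
    have h3 : ∀ v ∈ P b, altBoundary R P rm
          (Finsupp.single (rm b v) ((-1 : R) ^ ((P b).filter (· < v)).card)) =
        ∑ u ∈ (P b).erase v, Finsupp.single (rm (rm b v) u)
          ((-1 : R) ^ ((P b).filter (· < v)).card *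
            (-1 : R) ^ (((P b).erase v).filter (· < u)).card) := by
      intro v hv
      rw [h2, h1, hP b v hv, Finset.smul_sum]
      simp only [Finsupp.smul_single, smul_eq_mul]
    rw [Finset.sum_congr rfl h3, Finset.sum_sigma']
    rw [Finset.sum_involution (fun p _ => ⟨p.2, p.1⟩), smul_zero]
    · rintro ⟨v, u⟩ hp
      simp only [Finset.mem_sigma, Finset.mem_erase] at hp
      obtain ⟨hv, huv, hu⟩ := hp
      dsimp only
      rw [hrm b u v, ← Finsupp.single_add]
      have key : ∀ x y : V, x ∈ P b → x < y →
          ((P b).filter (· < y)).card = (((P b).erase x).filter (· < y)).card + 1 ∧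
          ((P b).filter (· < x)).card = (((P b).erase y).filter (· < x)).card := by
        intro x y hx hxy
        constructor
        · rw [Finset.filter_erase, Finset.card_erase_add_one]
          simp [hx, hxy]
        · rw [Finset.filter_erase, Finset.erase_eq_of_notMem]
          simp [hxy.le]
      rcases lt_or_gt_of_ne huv with hlt | hlt
      · obtain ⟨e1, e2⟩ := key u v hu hlt
        rw [e1, e2, pow_succ]
        simp [mul_comm]
      · obtain ⟨e1, e2⟩ := key v u hv hlt
        rw [e1, e2, pow_succ]
        simp [mul_comm]
    · rintro ⟨v, u⟩ hp _ heq
      simp only [Finset.mem_sigma, Finset.mem_erase] at hp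
      exact hp.2.1 (congrArg Sigma.fst heq)
    · rintro ⟨v, u⟩ hp
      simp only [Finset.mem_sigma, Finset.mem_erase] at hp ⊢
      exact ⟨hp.2.2, fun e => hp.2.1 e.symm, hp.1⟩
    · rintro ⟨v, u⟩ _
      rfl

theorem altBoundary_mem {B V : Type*} [LinearOrder V] (P : B → Finset V) (rm : B → V → B)
    (s t : Set B) (h : ∀ b ∈ s, ∀ v ∈ P b, rm b v ∈ t) (x : B →₀ R)
    (hx : x ∈ Finsupp.supported R R s) : altBoundary R P rm x ∈ Finsupp.supported R R t := by
  rw [altBoundary, Finsupp.linearCombination_apply]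
  refine Submodule.sum_mem _ fun b hb => Submodule.smul_mem _ _ (Submodule.sum_mem _ fun v hv => ?_)
  exact Finsupp.single_mem_supported R _ (h b (hx hb) v hv)

/-- The simplicial boundary `∂[v₀, …, vₙ] = ∑ (-1)^i [v₀, …, v̂ᵢ, …, vₙ]`; it is augmented, i.e.
`∂[v₀] = [∅]`. -/
noncomputable def simplicialBoundary (V : Type*) [LinearOrder V] :
    (Finset V →₀ R) →ₗ[R] (Finset V →₀ R) :=
  altBoundary R (fun s => s) (fun s v => s.erase v)

/-- The reduced (augmented) simplicial chain complex of `L`: the `n`-chains are freely generated by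
the simplices with `n + 1` vertices, the empty simplex having degree `-1`. -/
noncomputable def reducedComplex {V : Type*} [LinearOrder V] (L : SComplex V) :
    Subcomplex (simplicialBoundary R V) where
  C n := Finsupp.supported R R {s : Finset V | s ∈ L ∧ (s.card : ℤ) = n + 1}
  d_mem i j hij x hx := by
    refine altBoundary_mem R _ _ _ _ ?_ x hx
    rintro s ⟨hs, hc⟩ v hv
    refine ⟨L.lower (Finset.erase_subset v s) hs, ?_⟩
    have := Finset.card_erase_add_one hv
    omega
  d_d _ x _ := altBoundary_altBoundary R _ _ (fun _ _ _ => rfl)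
    (fun _ _ _ => Finset.erase_right_comm) x

theorem reducedComplex_mono {V : Type*} [LinearOrder V] {L L' : SComplex V} (h : L ≤ L') (n : ℤ) :
    (reducedComplex R L).C n ≤ (reducedComplex R L').C n :=
  Finsupp.supported_mono fun _ hs => ⟨h hs.1, hs.2⟩

/-- The basis `α, β, γ, η` of the complex `T` with `dβ = γ`, `|β| = 1`, `|α| = |γ| = |η| = 0`; the
index of `α` is `({1}, ∅)`, that of `β` and `γ` is `(∅, {1})` and that of `η` is `(∅, ∅)`. -/
inductive Letter
  | α
  | β
  | γ
  | η
  deriving DecidableEq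

section Words

variable {V : Type*} [Fintype V] [LinearOrder V]

/-- The positions of the letter `β` in a word; their number is the degree of the word. -/
def betaSet (w : V → Letter) : Finset V := Finset.univ.filter (fun k => w k = .β)

/-- The positions of the letters `α` and `β` in a word (the letters in `T` but not in the subcomplex
`S` spanned by `γ` and `η`). -/
def faceSet (w : V → Letter) : Finset V := Finset.univ.filter (fun k => w k = .α ∨ w k = .β)

/-- The index `(σ, ω)` of a word: `α` stands at the positions in `σ`, `β` or `γ` at those in `ω`,
and `η` at all others. -/
def wordIndex (w : V → Letter) : Finset V × Finset V :=
  (Finset.univ.filter (fun k => w k = .α), Finset.univ.filter (fun k => w k = .β ∨ w k = .γ))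

theorem betaSet_update (w : V → Letter) (v : V) :
    betaSet (Function.update w v .γ) = (betaSet w).erase v := by
  ext k
  rcases eq_or_ne k v with rfl | hk <;> simp [betaSet, *]

theorem faceSet_update_subset (w : V → Letter) (v : V) :
    faceSet (Function.update w v .γ) ⊆ faceSet w := by
  intro k
  rcases eq_or_ne k v with rfl | hk <;> simp [faceSet, *]

theorem wordIndex_update (w : V → Letter) {v : V} (hv : v ∈ betaSet w) :
    wordIndex (Function.update w v .γ) = wordIndex w := by
  have hv' : w v = .β := by simpa [betaSet] using hv
  refine Prod.ext (Finset.ext fun k => ?_) (Finset.ext fun k => ?_) <;>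
    rcases eq_or_ne k v with rfl | hk <;> simp [wordIndex, *]

/-- The differential of the tensor product `T ⊗ ⋯ ⊗ T` (one factor for each element of `V`, in
order), written in the basis of words `w = w₁ ⊗ ⋯ ⊗ wₘ` in the letters `α, β, γ, η`:
`d w = ∑ (-1)^{|w₁| + ⋯ + |w_{k-1}|} w₁ ⊗ ⋯ ⊗ d wₖ ⊗ ⋯ ⊗ wₘ`. -/
noncomputable def wordBoundary (V : Type*) [Fintype V] [LinearOrder V] :
    ((V → Letter) →₀ R) →ₗ[R] ((V → Letter) →₀ R) :=
  altBoundary R betaSet (fun w k => Function.update w k .γ)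

/-- The total chain complex `T^S(K) = ⊕_{(σ,ω) ∈ S} T^{σ,ω}(K)` of `K`, for a set `S` of indices.
It is the sum over `τ ∈ K` of the tensor products with factor `T` at the positions in `τ` and `S` at
the other ones, so it is spanned by the words whose letters `α` and `β` are at the positions of a
simplex of `K`. For `S = totalIndex V` it is the total complex, for `S = rightIndex V` the right
total complex, and for `S = {(σ, ω)}` the summand of index `(σ, ω)`. -/
noncomputable def totalComplex (K : SComplex V) (S : Set (Finset V × Finset V)) :
    Subcomplex (wordBoundary R V) where
  C n := Finsupp.supported R R
    {w : V → Letter | faceSet w ∈ K ∧ wordIndex w ∈ S ∧ ((betaSet w).card : ℤ) = n}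
  d_mem i j hij x hx := by
    refine altBoundary_mem R _ _ _ _ ?_ x hx
    rintro w ⟨hK, hS, hc⟩ v hv
    refine ⟨K.lower (faceSet_update_subset w v) hK, ?_, ?_⟩
    · rw [wordIndex_update w hv]
      exact hS
    · have := Finset.card_erase_add_one hv
      rw [betaSet_update]
      omega
  d_d _ x _ := altBoundary_altBoundary R _ _ (fun w v _ => betaSet_update w v)
    (fun w u v => by
      rcases eq_or_ne u v with rfl | huv
      · rfl
      · exact Function.update_comm huv _ _ _) x

end Words

end Algebra

section Pairs

/-- The one-point index set `𝒳 = {(∅,∅), (∅,{1}), ({1},∅)}`: the three values say that the point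
lies in neither of `σ, ω`, that it lies in `ω`, or that it lies in `σ`. -/
inductive PointIndex
  | neither
  | inOmega
  | inSigma

/-- The subset `ℛ = {(∅,∅), (∅,{1})}` of the one-point index set. -/
def rightPointIndex : Set PointIndex := {.neither, .inOmega}

/-- The `k`-th component of `(σ, ω)`. -/
def pointIndex {V : Type*} [DecidableEq V] (a : Finset V × Finset V) (k : V) : PointIndex :=
  if k ∈ a.1 then .inSigma else if k ∈ a.2 then .inOmega else .neither

variable (R : Type u) [CommRing R]

/-- The character groups of `θ : U → W`: `coker θ`, `ker θ` and `im θ` at the indices `({1},∅)`,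
`(∅,{1})` and `(∅,∅)`. -/
def charGroup {R : Type u} [CommRing R] {U W : Type u} [AddCommGroup U] [Module R U]
    [AddCommGroup W] [Module R W] (θ : U →ₗ[R] W) : PointIndex → Type u
  | .inSigma => W ⧸ LinearMap.range θ
  | .inOmega => LinearMap.ker θ
  | .neither => LinearMap.range θ

/-- The dual character groups of `θ° : W* → U*`: `ker θ°`, `coker θ°` and `im θ°` at the indices
`({1},∅)`, `(∅,{1})` and `(∅,∅)`. -/
def cocharGroup {R : Type u} [CommRing R] {U W : Type u} [AddCommGroup U] [Module R U]
    [AddCommGroup W] [Module R W] (θ : W →ₗ[R] U) : PointIndex → Type u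
  | .inSigma => LinearMap.ker θ
  | .inOmega => U ⧸ LinearMap.range θ
  | .neither => LinearMap.range θ

section Instances

variable {R} {U W : Type u} [AddCommGroup U] [Module R U] [AddCommGroup W] [Module R W]

instance charGroup.addCommGroup (θ : U →ₗ[R] W) : (s : PointIndex) → AddCommGroup (charGroup θ s)
  | .inSigma => inferInstanceAs (AddCommGroup (W ⧸ LinearMap.range θ))
  | .inOmega => inferInstanceAs (AddCommGroup (LinearMap.ker θ))
  | .neither => inferInstanceAs (AddCommGroup (LinearMap.range θ))

instance charGroup.module (θ : U →ₗ[R] W) : (s : PointIndex) → Module R (charGroup θ s)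
  | .inSigma => inferInstanceAs (Module R (W ⧸ LinearMap.range θ))
  | .inOmega => inferInstanceAs (Module R (LinearMap.ker θ))
  | .neither => inferInstanceAs (Module R (LinearMap.range θ))

instance cocharGroup.addCommGroup (θ : W →ₗ[R] U) : (s : PointIndex) → AddCommGroup (cocharGroup θ s)
  | .inSigma => inferInstanceAs (AddCommGroup (LinearMap.ker θ))
  | .inOmega => inferInstanceAs (AddCommGroup (U ⧸ LinearMap.range θ))
  | .neither => inferInstanceAs (AddCommGroup (LinearMap.range θ))

instance cocharGroup.module (θ : W →ₗ[R] U) : (s : PointIndex) → Module R (cocharGroup θ s)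
  | .inSigma => inferInstanceAs (Module R (LinearMap.ker θ))
  | .inOmega => inferInstanceAs (Module R (U ⧸ LinearMap.range θ))
  | .neither => inferInstanceAs (Module R (LinearMap.range θ))

end Instances

section OnePair

variable {V : Type} [LinearOrder V] {X A : SComplex V}

/-- `ι_{σ,ω} : H̃_d(A_{σ,ω}) → H̃_d(X_{σ,ω})`, induced by inclusion. -/
noncomputable def linkMap (h : A ≤ X) (p : Finset V × Finset V) (d : ℤ) :
    (reducedComplex R (A.link p.1 p.2)).homology d →ₗ[R]
      (reducedComplex R (X.link p.1 p.2)).homology d :=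
  Subcomplex.homologyMap (reducedComplex_mono R (SComplex.link_mono h p.1 p.2)) d

/-- `ι°_{σ,ω} : H̃^d(X_{σ,ω}) → H̃^d(A_{σ,ω})`, induced by inclusion. -/
noncomputable def colinkMap (h : A ≤ X) (p : Finset V × Finset V) (d : ℤ) :
    (reducedComplex R (X.link p.1 p.2)).cohomology d →ₗ[R]
      (reducedComplex R (A.link p.1 p.2)).cohomology d :=
  Subcomplex.cohomologyMap (reducedComplex_mono R (SComplex.link_mono h p.1 p.2)) d

/-- `H_j^{s;σ,ω}(X, A)`: the degree `j` part of the suspension of `coker`, `ker` or `im` of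
`ι_{σ,ω}`. -/
abbrev pairHomology (h : A ≤ X) (s : PointIndex) (p : Finset V × Finset V) (j : ℤ) : Type u :=
  charGroup (linkMap R h p (j - 1)) s

/-- `H^j_{s;σ,ω}(X, A)`: the degree `j` part of the suspension of `ker`, `coker` or `im` of
`ι°_{σ,ω}`. -/
abbrev pairCohomology (h : A ≤ X) (s : PointIndex) (p : Finset V × Finset V) (j : ℤ) : Type u :=
  cocharGroup (colinkMap R h p (j - 1)) s

end OnePair

/-- A homomorphism is split if its kernel, cokernel and image are free. -/
structure IsSplitHom {R : Type u} [CommRing R] {U W : Type*} [AddCommGroup U] [Module R U]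
    [AddCommGroup W] [Module R W] (θ : U →ₗ[R] W) : Prop where
  free_ker : Module.Free R (LinearMap.ker θ)
  free_coker : Module.Free R (W ⧸ LinearMap.range θ)
  free_range : Module.Free R (LinearMap.range θ)

variable {m : ℕ} {n : Fin m → ℕ}

/-- All the maps `H̃_*((A_k)_{σ,ω}) → H̃_*((X_k)_{σ,ω})` are split. -/
def TotalHomologySplit {X A : (k : Fin m) → SComplex (Fin (n k))} (h : ∀ k, A k ≤ X k) : Prop :=
  ∀ k, ∀ p ∈ totalIndex (Fin (n k)), ∀ d : ℤ, IsSplitHom (linkMap R (h k) p d)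

/-- The vertex set `[n]`, `n = n₁ + ⋯ + nₘ`: the blocks `[n₁], …, [nₘ]` one after the other. -/
abbrev JoinVertex (n : Fin m → ℕ) := Σₗ k : Fin m, Fin (n k)

/-- `σ_k = σ ∩ [n_k]`. -/
def blockPart (σ : Finset (JoinVertex n)) (k : Fin m) : Finset (Fin (n k)) :=
  Finset.univ.filter (fun i => toLex (⟨k, i⟩ : Σ k : Fin m, Fin (n k)) ∈ σ)

theorem blockPart_mono {σ τ : Finset (JoinVertex n)} (h : σ ⊆ τ) (k : Fin m) :
    blockPart σ k ⊆ blockPart τ k :=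
  Finset.monotone_filter_right _ (fun _ _ hi => h hi)

/-- `(σ_k, ω_k)`. -/
def indexPart (q : Finset (JoinVertex n) × Finset (JoinVertex n)) (k : Fin m) :
    Finset (Fin (n k)) × Finset (Fin (n k)) :=
  (blockPart q.1 k, blockPart q.2 k)

/-- `S₁ × ⋯ × Sₘ` as a set of pairs `(σ, ω)` of subsets of `[n]`, through
`(σ, ω) ↔ (σ₁, ω₁, …, σₘ, ωₘ)`. -/
def joinIndex (S : (k : Fin m) → Set (Finset (Fin (n k)) × Finset (Fin (n k)))) :
    Set (Finset (JoinVertex n) × Finset (JoinVertex n)) :=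
  {q | ∀ k, indexPart q k ∈ S k}

/-- The polyhedral join complex `𝒮(K; X, A) = ⋃_{τ ∈ K} Y₁ * ⋯ * Yₘ`, where `Y_k = X_k` for `k ∈ τ`
and `Y_k = A_k` for `k ∉ τ`. -/
def polyhedralJoin (K : SComplex (Fin m)) (X A : (k : Fin m) → SComplex (Fin (n k))) :
    SComplex (JoinVertex n) where
  carrier := {σ | ∃ τ ∈ K, ∀ k, blockPart σ k ∈ (if k ∈ τ then X k else A k)}
  lower' := fun _ _ hba ⟨τ, hτ, h⟩ =>
    ⟨τ, hτ, fun k => (if k ∈ τ then X k else A k).lower (blockPart_mono hba k) (h k)⟩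

/-- The degree `l` part of the tensor product of graded modules `G₁ ⊗ ⋯ ⊗ Gₘ`. -/
abbrev gradedTensor (G : Fin m → ℤ → Type u) [∀ k j, AddCommGroup (G k j)]
    [∀ k j, Module R (G k j)] (l : ℤ) : Type u :=
  ⨁ j : {j : Fin m → ℤ // ∑ k, j k = l}, ⨂[R] k, G k (j.1 k)

/-- The degree `d` part of the diagonal tensor product `⊕_{a ∈ J} P^a ⊗ Q^a` of two graded modules
`P, Q` indexed by the set `J`. -/
abbrev diagonalTensor {I : Type} (J : Set I) (P Q : I → ℤ → Type u)
    [∀ a i, AddCommGroup (P a i)] [∀ a i, Module R (P a i)]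
    [∀ a i, AddCommGroup (Q a i)] [∀ a i, Module R (Q a i)] (d : ℤ) : Type u :=
  ⨁ a : J, ⨁ p : {p : ℤ × ℤ // p.1 + p.2 = d}, P a.1 p.1.1 ⊗[R] Q a.1 p.1.2

section ManyPairs

variable {X A : (k : Fin m) → SComplex (Fin (n k))} (h : ∀ k, A k ≤ X k)
  (S : (k : Fin m) → Set (Finset (Fin (n k)) × Finset (Fin (n k))))

/-- The degree `l` part of `⊕_{(σ,ω) ∈ S₁ × ⋯ × Sₘ} H_*^{a;σ,ω}(X, A)`, where
`H_*^{a;σ,ω}(X, A) = ⊗_k H_*^{a_k;σ_k,ω_k}(X_k, A_k)`. -/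
abbrev jointHomology (a : Finset (Fin m) × Finset (Fin m)) (l : ℤ) : Type u :=
  ⨁ q : joinIndex S,
    gradedTensor R (fun k j => pairHomology R (h k) (pointIndex a k) (indexPart q.1 k) j) l

/-- The degree `l` part of `⊗_k H_*^{a_k;S_k}(X_k, A_k)`, the summand of index `a` of
`⊗_k H_*^{𝒳;S_k}(X_k, A_k)`. -/
abbrev factorHomology (a : Finset (Fin m) × Finset (Fin m)) (l : ℤ) : Type u :=
  gradedTensor R (fun k j => ⨁ p : S k, pairHomology R (h k) (pointIndex a k) p.1 j) l

/-- The cohomological version of `jointHomology`. -/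
abbrev jointCohomology (a : Finset (Fin m) × Finset (Fin m)) (l : ℤ) : Type u :=
  ⨁ q : joinIndex S,
    gradedTensor R (fun k j => pairCohomology R (h k) (pointIndex a k) (indexPart q.1 k) j) l

/-- The cohomological version of `factorHomology`. -/
abbrev factorCohomology (a : Finset (Fin m) × Finset (Fin m)) (l : ℤ) : Type u :=
  gradedTensor R (fun k j => ⨁ p : S k, pairCohomology R (h k) (pointIndex a k) p.1 j) l

end ManyPairs

end Pairs

/-! The theorem is a Künneth formula proved at chain level, compatibly with the inclusions of `A k`
in `X k`.

A word of index `(σ, ω)` whose letters `β` stand at `τ` is the same thing as a simplex `τ` of the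
link at `(σ, ω)`, in degree `|τ|`. Hence the total complex of the polyhedral join is the union over
`τ ∈ K` of tensor products `Y₁ ⊗ ⋯ ⊗ Yₘ`, where `Y_k` is the sum over `S k` of the suspended
augmented chain complexes of the links of `X k` if `k ∈ τ`, and of `A k` otherwise
(`joinWordsRetract`).

Each factor is brought to a normal form. Because kernel, cokernel and image of `ι` are free, the
pair of chain complexes of a link has a homogeneous basis, adapted to the subcomplex, consisting of
acyclic pairs `top ↦ bot` inside the subcomplex, acyclic pairs `top' ↦ bot'` outside it, and
surviving vectors: cycles of the subcomplex representing `im ι`, cycles representing `coker ι`, and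
pairs `u ↦ z` with `z` a cycle of the subcomplex representing `ker ι` and `u` outside
(`exists_normalFamily`). Contracting the acyclic pairs is a deformation retraction respecting the
subcomplex (`NormalFamily.retract`). What remains is one shifted copy of `η`, of `α` or of `β ↦ γ`
for each generator of image, cokernel or kernel; the subcomplex keeps `η` and `γ`. So the complex
`T` itself is the local model.

Such retractions can be tensored (`BasedRetract.tensor_homotopy`), and since every map involved
preserves the subcomplexes factor by factor, the result restricts to the union over `K`. Fixing one
generator `c k` in every factor, the remaining choices of letters span the summand of the total
complex of `K` whose index is given by the kinds of the `c k`, shifted by the sum of their degrees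
(`normalPair.wordsRetract`). The homology of the join is therefore the product over all `c` of
shifted groups of `K` (`polyhedralJoin_equiv_pi`). The families `c` of kind `a` and total degree `l`
also index a basis of the degree `l` part of the groups attached to `a`, in either description
(`exists_joint_basis`, `exists_factor_basis`), so the diagonal tensor product is the same product
(`diagonalTensor_equiv_pi`).

For cohomology the retractions are dualized, and the dual character groups have the same ranks as
the character groups because evaluation on homology is an isomorphism when the homology is free
(`pairCohomology_equiv_dual`). If the `ι` are onto there are no generators of kind `({1}, ∅)`, so
only indices of `ℛ` occur, and the groups of `A k` split into image and kernel. Over a field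
everything is free. -/

/-! ### Classes in subquotients -/

section SubquotientAPI

variable {R : Type u} [CommRing R] {M N : Type*} [AddCommGroup M] [Module R M]
  [AddCommGroup N] [Module R N]

/-- The class of an element of `Z` in the subquotient `Z / B`. -/
def Subquotient.mk (Z B : Submodule R M) : Z →ₗ[R] Subquotient Z B :=
  (B.submoduleOf Z).mkQ

theorem Subquotient.mk_surjective (Z B : Submodule R M) :
    Function.Surjective (Subquotient.mk Z B) :=
  Submodule.mkQ_surjective _

theorem Subquotient.mk_eq_zero {Z B : Submodule R M} {z : Z} :
    Subquotient.mk Z B z = 0 ↔ (z : M) ∈ B :=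
  Submodule.Quotient.mk_eq_zero _

theorem Subquotient.map_mk {Z B : Submodule R M} {Z' B' : Submodule R N} (f : M →ₗ[R] N)
    (hZ : ∀ x ∈ Z, f x ∈ Z') (hB : ∀ x ∈ B, f x ∈ B') (z : Z) :
    Subquotient.map f hZ hB (Subquotient.mk Z B z) = Subquotient.mk Z' B' ⟨f z, hZ z z.2⟩ :=
  rfl

end SubquotientAPI

/-! ### Homology and dual cohomology at the middle of a three-term diagram -/

section ThreeTerm

variable {R : Type u} [CommRing R]
  {M₁ M₂ M₃ N₁ N₂ N₃ : Type*} [AddCommGroup M₁] [Module R M₁] [AddCommGroup M₂] [Module R M₂]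
  [AddCommGroup M₃] [Module R M₃] [AddCommGroup N₁] [Module R N₁] [AddCommGroup N₂] [Module R N₂]
  [AddCommGroup N₃] [Module R N₃]

/-- The homology of `M₁ → M₂ → M₃` at `M₂`. -/
abbrev midHomology (f : M₁ →ₗ[R] M₂) (g : M₂ →ₗ[R] M₃) : Type _ :=
  Subquotient (LinearMap.ker g) (LinearMap.range f)

/-- A deformation retraction induces inverse isomorphisms on homology; only the part of it around
the middle term matters. The vanishing of `g ∘ f` is not required, since the subquotient divides by
what lies in both kernel and range. -/
theorem midHomology_equiv_of_retract {f : M₁ →ₗ[R] M₂} {g : M₂ →ₗ[R] M₃} {f' : N₁ →ₗ[R] N₂}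
    {g' : N₂ →ₗ[R] N₃} (r₁ : M₁ →ₗ[R] N₁) (r₂ : M₂ →ₗ[R] N₂) (r₃ : M₃ →ₗ[R] N₃)
    (s₁ : N₁ →ₗ[R] M₁) (s₂ : N₂ →ₗ[R] M₂) (s₃ : N₃ →ₗ[R] M₃)
    (h₁ : M₂ →ₗ[R] M₁) (h₂ : M₃ →ₗ[R] M₂)
    (hrf : r₂ ∘ₗ f = f' ∘ₗ r₁) (hrg : r₃ ∘ₗ g = g' ∘ₗ r₂)
    (hsf : s₂ ∘ₗ f' = f ∘ₗ s₁) (hsg : s₃ ∘ₗ g' = g ∘ₗ s₂)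
    (hrs : r₂ ∘ₗ s₂ = LinearMap.id)
    (hsr : s₂ ∘ₗ r₂ + f ∘ₗ h₁ + h₂ ∘ₗ g = LinearMap.id) :
    Nonempty (midHomology f g ≃ₗ[R] midHomology f' g') := by
  have e1 : ∀ x ∈ LinearMap.ker g, r₂ x ∈ LinearMap.ker g' := fun x hx => by
    have := LinearMap.congr_fun hrg x
    simp only [LinearMap.comp_apply, LinearMap.mem_ker.1 hx, map_zero] at this
    exact this.symm
  have e2 : ∀ x ∈ LinearMap.range f, r₂ x ∈ LinearMap.range f' := by
    rintro _ ⟨x, rfl⟩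
    exact ⟨r₁ x, (LinearMap.congr_fun hrf x).symm⟩
  have e3 : ∀ x ∈ LinearMap.ker g', s₂ x ∈ LinearMap.ker g := fun x hx => by
    have := LinearMap.congr_fun hsg x
    simp only [LinearMap.comp_apply, LinearMap.mem_ker.1 hx, map_zero] at this
    exact this.symm
  have e4 : ∀ x ∈ LinearMap.range f', s₂ x ∈ LinearMap.range f := by
    rintro _ ⟨x, rfl⟩
    exact ⟨s₁ x, (LinearMap.congr_fun hsf x).symm⟩
  refine ⟨LinearEquiv.ofLinearMap (Subquotient.map r₂ e1 e2) (Subquotient.map s₂ e3 e4) ?_ ?_⟩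
  · refine LinearMap.ext fun x => ?_
    obtain ⟨z, rfl⟩ := Subquotient.mk_surjective _ _ x
    rw [LinearMap.comp_apply, Subquotient.map_mk, Subquotient.map_mk]
    exact congrArg _ (Subtype.ext (LinearMap.congr_fun hrs z.1))
  · refine LinearMap.ext fun x => ?_
    obtain ⟨z, rfl⟩ := Subquotient.mk_surjective _ _ x
    rw [LinearMap.comp_apply, Subquotient.map_mk, Subquotient.map_mk, LinearMap.id_apply,
      ← sub_eq_zero, ← map_sub, Subquotient.mk_eq_zero]
    have h := LinearMap.congr_fun hsr z.1
    simp only [LinearMap.add_apply, LinearMap.comp_apply, LinearMap.mem_ker.1 z.2, map_zero,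
      add_zero, LinearMap.id_apply] at h
    -- On a cycle the homotopy identity reads `s₂ r₂ z + f (h₁ z) = z`, so `s₂ r₂ z - z = f (-h₁
    -- z)`.
    refine ⟨- h₁ z.1, ?_⟩
    rw [map_neg]
    simp only [Submodule.coe_sub]
    nth_rw 3 [← h]
    abel

theorem midHomology_equiv_pi {ι : Type*} {A B C : ι → Type*}
    [∀ c, AddCommGroup (A c)] [∀ c, Module R (A c)] [∀ c, AddCommGroup (B c)]
    [∀ c, Module R (B c)] [∀ c, AddCommGroup (C c)] [∀ c, Module R (C c)]
    (f : ∀ c, A c →ₗ[R] B c) (g : ∀ c, B c →ₗ[R] C c) :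
    Nonempty (midHomology (LinearMap.pi fun c => f c ∘ₗ LinearMap.proj c)
      (LinearMap.pi fun c => g c ∘ₗ LinearMap.proj c) ≃ₗ[R] ∀ c, midHomology (f c) (g c)) := by
  have e1 : ∀ c, ∀ x ∈ LinearMap.ker (LinearMap.pi fun c => g c ∘ₗ LinearMap.proj c),
      (LinearMap.proj c : (∀ c, B c) →ₗ[R] B c) x ∈ LinearMap.ker (g c) := fun c x hx =>
    congrFun (LinearMap.mem_ker.1 hx) c
  have e2 : ∀ c, ∀ x ∈ LinearMap.range (LinearMap.pi fun c => f c ∘ₗ LinearMap.proj c),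
      (LinearMap.proj c : (∀ c, B c) →ₗ[R] B c) x ∈ LinearMap.range (f c) := by
    rintro c _ ⟨y, rfl⟩
    exact ⟨y c, rfl⟩
  refine ⟨LinearEquiv.ofBijective
    (LinearMap.pi fun c => Subquotient.map (LinearMap.proj c) (e1 c) (e2 c)) ⟨?_, ?_⟩⟩
  · rw [injective_iff_map_eq_zero]
    intro x hx
    obtain ⟨z, rfl⟩ := Subquotient.mk_surjective _ _ x
    have h : ∀ c, z.1 c ∈ LinearMap.range (f c) := fun c =>
      Subquotient.mk_eq_zero.1 (congrFun hx c)
    choose y hy using h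
    exact Subquotient.mk_eq_zero.2 ⟨y, funext hy⟩
  · intro y
    choose z hz using fun c => Subquotient.mk_surjective _ _ (y c)
    refine ⟨Subquotient.mk _ _ ⟨fun c => (z c).1, ?_⟩, funext fun c => hz c⟩
    exact LinearMap.mem_ker.2 (funext fun c => (z c).2)

/-- The cohomology of the dual of `M₁ → M₂ → M₃` at the dual of `M₂`. -/
abbrev midCohomology (f : M₁ →ₗ[R] M₂) (g : M₂ →ₗ[R] M₃) : Type _ :=
  midHomology (LinearMap.lcomp R R g) (LinearMap.lcomp R R f)

/-- The dual of a deformation retraction is again one: transposing exchanges the retraction with the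
section and the two homotopies with each other. -/
theorem midCohomology_equiv_of_retract {f : M₁ →ₗ[R] M₂} {g : M₂ →ₗ[R] M₃} {f' : N₁ →ₗ[R] N₂}
    {g' : N₂ →ₗ[R] N₃} (r₁ : M₁ →ₗ[R] N₁) (r₂ : M₂ →ₗ[R] N₂) (r₃ : M₃ →ₗ[R] N₃)
    (s₁ : N₁ →ₗ[R] M₁) (s₂ : N₂ →ₗ[R] M₂) (s₃ : N₃ →ₗ[R] M₃)
    (h₁ : M₂ →ₗ[R] M₁) (h₂ : M₃ →ₗ[R] M₂)
    (hrf : r₂ ∘ₗ f = f' ∘ₗ r₁) (hrg : r₃ ∘ₗ g = g' ∘ₗ r₂)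
    (hsf : s₂ ∘ₗ f' = f ∘ₗ s₁) (hsg : s₃ ∘ₗ g' = g ∘ₗ s₂)
    (hrs : r₂ ∘ₗ s₂ = LinearMap.id)
    (hsr : s₂ ∘ₗ r₂ + f ∘ₗ h₁ + h₂ ∘ₗ g = LinearMap.id) :
    Nonempty (midCohomology f g ≃ₗ[R] midCohomology f' g') := by
  refine midHomology_equiv_of_retract (LinearMap.lcomp R R s₃) (LinearMap.lcomp R R s₂)
    (LinearMap.lcomp R R s₁) (LinearMap.lcomp R R r₃) (LinearMap.lcomp R R r₂)
    (LinearMap.lcomp R R r₁) (LinearMap.lcomp R R h₂) (LinearMap.lcomp R R h₁) ?_ ?_ ?_ ?_ ?_ ?_ <;>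
    refine LinearMap.ext fun φ => LinearMap.ext fun x => ?_
  · exact congrArg φ (LinearMap.congr_fun hsg x).symm
  · exact congrArg φ (LinearMap.congr_fun hsf x).symm
  · exact congrArg φ (LinearMap.congr_fun hrg x).symm
  · exact congrArg φ (LinearMap.congr_fun hrf x).symm
  · exact congrArg φ (LinearMap.congr_fun hrs x)
  · have := congrArg φ (LinearMap.congr_fun hsr x)
    simp only [LinearMap.add_apply, LinearMap.comp_apply, map_add, LinearMap.id_apply] at this
    simp only [LinearMap.add_apply, LinearMap.comp_apply, LinearMap.lcomp_apply,
      LinearMap.id_apply]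
    rw [← this]
    abel

/-- Naturality of the identification of the dual of a finite product with the product of the duals.
-/
theorem lsum_comp_pi_lcomp {ι : Type*} [Fintype ι] [DecidableEq ι] {A B : ι → Type*}
    [∀ c, AddCommGroup (A c)] [∀ c, Module R (A c)]
    [∀ c, AddCommGroup (B c)] [∀ c, Module R (B c)] (f : ∀ c, A c →ₗ[R] B c) :
    (LinearMap.lsum R A R).toLinearMap ∘ₗ
        (LinearMap.pi fun c => LinearMap.lcomp R R (f c) ∘ₗ LinearMap.proj c) =
      LinearMap.lcomp R R (LinearMap.pi fun c => f c ∘ₗ LinearMap.proj c) ∘ₗ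
        (LinearMap.lsum R B R).toLinearMap := by
  refine LinearMap.ext fun φ => LinearMap.ext fun x => ?_
  simp [LinearMap.lsum_apply]

theorem lsum_symm_comp_lcomp_pi {ι : Type*} [Fintype ι] [DecidableEq ι] {A B : ι → Type*}
    [∀ c, AddCommGroup (A c)] [∀ c, Module R (A c)]
    [∀ c, AddCommGroup (B c)] [∀ c, Module R (B c)] (f : ∀ c, A c →ₗ[R] B c) :
    (LinearMap.lsum R A R).symm.toLinearMap ∘ₗ
        LinearMap.lcomp R R (LinearMap.pi fun c => f c ∘ₗ LinearMap.proj c) =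
      (LinearMap.pi fun c => LinearMap.lcomp R R (f c) ∘ₗ LinearMap.proj c) ∘ₗ
        (LinearMap.lsum R B R).symm.toLinearMap := by
  refine LinearMap.ext fun φ => ?_
  refine (LinearMap.lsum R A R).injective ?_
  have := LinearMap.congr_fun (lsum_comp_pi_lcomp f) ((LinearMap.lsum R B R).symm φ)
  simp only [LinearMap.comp_apply, LinearEquiv.coe_coe, LinearEquiv.apply_symm_apply] at this ⊢
  exact this.symm

/-- The index type must be finite: otherwise the dual of a product is not the product of the duals.
-/
theorem midCohomology_equiv_pi {ι : Type*} [Finite ι] {A B C : ι → Type*}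
    [∀ c, AddCommGroup (A c)] [∀ c, Module R (A c)] [∀ c, AddCommGroup (B c)]
    [∀ c, Module R (B c)] [∀ c, AddCommGroup (C c)] [∀ c, Module R (C c)]
    (f : ∀ c, A c →ₗ[R] B c) (g : ∀ c, B c →ₗ[R] C c) :
    Nonempty (midCohomology (LinearMap.pi fun c => f c ∘ₗ LinearMap.proj c)
      (LinearMap.pi fun c => g c ∘ₗ LinearMap.proj c) ≃ₗ[R] ∀ c, midCohomology (f c) (g c)) := by
  classical
  have := Fintype.ofFinite ι
  obtain ⟨e⟩ := midHomology_equiv_pi (fun c => LinearMap.lcomp R R (g c))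
    (fun c => LinearMap.lcomp R R (f c))
  obtain ⟨e'⟩ := midHomology_equiv_of_retract
    (f := LinearMap.lcomp R R (LinearMap.pi fun c => g c ∘ₗ LinearMap.proj c))
    (g := LinearMap.lcomp R R (LinearMap.pi fun c => f c ∘ₗ LinearMap.proj c))
    (f' := LinearMap.pi fun c => LinearMap.lcomp R R (g c) ∘ₗ LinearMap.proj c)
    (g' := LinearMap.pi fun c => LinearMap.lcomp R R (f c) ∘ₗ LinearMap.proj c)
    (LinearMap.lsum R C R).symm.toLinearMap (LinearMap.lsum R B R).symm.toLinearMap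
    (LinearMap.lsum R A R).symm.toLinearMap (LinearMap.lsum R C R).toLinearMap
    (LinearMap.lsum R B R).toLinearMap (LinearMap.lsum R A R).toLinearMap 0 0
    (lsum_symm_comp_lcomp_pi g) (lsum_symm_comp_lcomp_pi f) (lsum_comp_pi_lcomp g)
    (lsum_comp_pi_lcomp f)
    (LinearMap.ext fun x => (LinearMap.lsum R B R).symm_apply_apply x)
    (by
      rw [LinearMap.comp_zero, LinearMap.zero_comp, add_zero, add_zero]
      exact LinearMap.ext fun x => (LinearMap.lsum R B R).apply_symm_apply x)
  exact ⟨e'.trans e⟩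

end ThreeTerm

/-! ### Graded diagrams and their deformation retractions -/

section Graded

variable {R : Type u} [CommRing R]

/-- A family of linear maps `C i → C j`, `i = j + 1`. -/
abbrev GradedDiff (R : Type u) [CommRing R] (C : ℤ → Type*) [∀ n, AddCommGroup (C n)]
    [∀ n, Module R (C n)] :=
  ∀ i j : ℤ, j + 1 = i → C i →ₗ[R] C j

variable {C C' C'' : ℤ → Type*} [∀ n, AddCommGroup (C n)] [∀ n, Module R (C n)]
  [∀ n, AddCommGroup (C' n)] [∀ n, Module R (C' n)]
  [∀ n, AddCommGroup (C'' n)] [∀ n, Module R (C'' n)]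

namespace GradedDiff

/-- `H_n`: cycles modulo boundaries. -/
abbrev homology (δ : GradedDiff R C) (n : ℤ) : Type _ :=
  midHomology (δ (n + 1) n rfl) (δ n (n - 1) (by omega))

/-- `H^n` of the dual complex: cocycles modulo coboundaries. -/
abbrev cohomology (δ : GradedDiff R C) (n : ℤ) : Type _ :=
  midCohomology (δ (n + 1) n rfl) (δ n (n - 1) (by omega))

/-- Absorbs degrees that are equal only propositionally, such as `n + 1 - e` and `n - e + 1`, which
arise from shifts. -/
theorem homology_equiv_mid (δ : GradedDiff R C) {i j k n : ℤ} (hij : j + 1 = i) (hjk : k + 1 = j)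
    (hn : j = n) : Nonempty (midHomology (δ i j hij) (δ j k hjk) ≃ₗ[R] δ.homology n) := by
  subst hn hij
  obtain rfl : k = j - 1 := by omega
  exact ⟨LinearEquiv.refl _ _⟩

theorem cohomology_equiv_mid (δ : GradedDiff R C) {i j k n : ℤ} (hij : j + 1 = i)
    (hjk : k + 1 = j) (hn : j = n) :
    Nonempty (midCohomology (δ i j hij) (δ j k hjk) ≃ₗ[R] δ.cohomology n) := by
  subst hn hij
  obtain rfl : k = j - 1 := by omega
  exact ⟨LinearEquiv.refl _ _⟩

/-- The product of the shifts by `e c` of a family of graded diagrams. -/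
def piShift {ι : Type*} {D : ι → ℤ → Type*} [∀ c n, AddCommGroup (D c n)]
    [∀ c n, Module R (D c n)] (δ : ∀ c, GradedDiff R (D c)) (e : ι → ℤ) :
    GradedDiff R (fun n => ∀ c, D c (n - e c)) := fun i j hij =>
  LinearMap.pi fun c => δ c (i - e c) (j - e c) (by omega) ∘ₗ LinearMap.proj c

section

variable {ι : Type*} {D : ι → ℤ → Type*} [∀ c n, AddCommGroup (D c n)]
    [∀ c n, Module R (D c n)] (δ : ∀ c, GradedDiff R (D c)) (e : ι → ℤ)

theorem homology_piShift (n : ℤ) :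
    Nonempty ((piShift δ e).homology n ≃ₗ[R] ∀ c, (δ c).homology (n - e c)) := by
  obtain ⟨f⟩ := midHomology_equiv_pi
    (fun c => δ c (n + 1 - e c) (n - e c) (by omega))
    (fun c => δ c (n - e c) (n - 1 - e c) (by omega))
  have g := fun c => Classical.choice <| (δ c).homology_equiv_mid (i := n + 1 - e c) (j := n - e c)
    (k := n - 1 - e c) (by omega) (by omega) rfl
  exact ⟨f.trans (LinearEquiv.piCongrRight g)⟩

theorem cohomology_piShift [Finite ι] (n : ℤ) :
    Nonempty ((piShift δ e).cohomology n ≃ₗ[R] ∀ c, (δ c).cohomology (n - e c)) := by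
  obtain ⟨f⟩ := midCohomology_equiv_pi
    (fun c => δ c (n + 1 - e c) (n - e c) (by omega))
    (fun c => δ c (n - e c) (n - 1 - e c) (by omega))
  have g := fun c => Classical.choice <| (δ c).cohomology_equiv_mid (i := n + 1 - e c) (j := n - e c)
    (k := n - 1 - e c) (by omega) (by omega) rfl
  exact ⟨f.trans (LinearEquiv.piCongrRight g)⟩

end

end GradedDiff

/-- A deformation retraction of graded diagrams. -/
structure GradedRetract (δ : GradedDiff R C) (δ' : GradedDiff R C') where
  r : ∀ n, C n →ₗ[R] C' n
  s : ∀ n, C' n →ₗ[R] C n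
  h : ∀ i j : ℤ, j + 1 = i → C j →ₗ[R] C i
  r_comm : ∀ i j hij, r j ∘ₗ δ i j hij = δ' i j hij ∘ₗ r i
  s_comm : ∀ i j hij, s j ∘ₗ δ' i j hij = δ i j hij ∘ₗ s i
  r_s : ∀ n, r n ∘ₗ s n = LinearMap.id
  s_r : ∀ i j k hij hjk,
    s j ∘ₗ r j + δ i j hij ∘ₗ h i j hij + h j k hjk ∘ₗ δ j k hjk = LinearMap.id

namespace GradedRetract

variable {δ : GradedDiff R C} {δ' : GradedDiff R C'}

theorem homology_equiv (E : GradedRetract δ δ') (n : ℤ) :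
    Nonempty (δ.homology n ≃ₗ[R] δ'.homology n) :=
  midHomology_equiv_of_retract (E.r _) (E.r _) (E.r _) (E.s _) (E.s _) (E.s _) (E.h _ _ _)
    (E.h _ _ _) (E.r_comm _ _ _) (E.r_comm _ _ _) (E.s_comm _ _ _) (E.s_comm _ _ _) (E.r_s _)
    (E.s_r _ _ _ _ _)

theorem cohomology_equiv (E : GradedRetract δ δ') (n : ℤ) :
    Nonempty (δ.cohomology n ≃ₗ[R] δ'.cohomology n) :=
  midCohomology_equiv_of_retract (E.r _) (E.r _) (E.r _) (E.s _) (E.s _) (E.s _) (E.h _ _ _)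
    (E.h _ _ _) (E.r_comm _ _ _) (E.r_comm _ _ _) (E.s_comm _ _ _) (E.s_comm _ _ _) (E.r_s _)
    (E.s_r _ _ _ _ _)

end GradedRetract

/-! ### Retractions cut out of maps of the ambient modules -/

section Restrict

variable {M N : Type*} [AddCommGroup M] [Module R M] [AddCommGroup N] [Module R N]

/-- The maps between the submodules of a graded family induced by an endomorphism. -/
def restrictDiff (d : M →ₗ[R] M) (P : ℤ → Submodule R M)
    (hd : ∀ i j : ℤ, j + 1 = i → ∀ x ∈ P i, d x ∈ P j) : GradedDiff R (fun n => P n) :=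
  fun i j hij => d.restrict (hd i j hij)

/-- A deformation retraction between graded families of submodules, from linear maps of the
ambient modules. -/
def GradedRetract.ofRestrict {d : M →ₗ[R] M} {P : ℤ → Submodule R M}
    {hd : ∀ i j : ℤ, j + 1 = i → ∀ x ∈ P i, d x ∈ P j} {d' : N →ₗ[R] N} {Q : ℤ → Submodule R N}
    {hd' : ∀ i j : ℤ, j + 1 = i → ∀ x ∈ Q i, d' x ∈ Q j}
    (r : M →ₗ[R] N) (s : N →ₗ[R] M) (h : M →ₗ[R] M)
    (hr : ∀ n, ∀ x ∈ P n, r x ∈ Q n) (hs : ∀ n, ∀ x ∈ Q n, s x ∈ P n)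
    (hh : ∀ i j : ℤ, j + 1 = i → ∀ x ∈ P j, h x ∈ P i)
    (hrd : ∀ n, ∀ x ∈ P n, r (d x) = d' (r x)) (hsd : ∀ n, ∀ x ∈ Q n, s (d' x) = d (s x))
    (hrs : ∀ n, ∀ x ∈ Q n, r (s x) = x)
    (hsr : ∀ n, ∀ x ∈ P n, s (r x) + d (h x) + h (d x) = x) :
    GradedRetract (restrictDiff d P hd) (restrictDiff d' Q hd') where
  r n := r.restrict (hr n)
  s n := s.restrict (hs n)
  h i j hij := h.restrict (hh i j hij)
  r_comm i _ _ := LinearMap.ext fun x => Subtype.ext (hrd i x x.2)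
  s_comm i _ _ := LinearMap.ext fun x => Subtype.ext (hsd i x x.2)
  r_s n := LinearMap.ext fun x => Subtype.ext (hrs n x x.2)
  s_r _ j _ _ _ := LinearMap.ext fun x => Subtype.ext (hsr j x x.2)

end Restrict

end Graded

/-! ### Kronecker products of matrices -/

section Kron

variable {R : Type u} [CommRing R] {m : ℕ}

/-- The Kronecker product of a family of matrices. -/
def kron {B B' : Fin m → Type} (M : ∀ k, Matrix (B' k) (B k) R) :
    Matrix (∀ k, B' k) (∀ k, B k) R :=
  Matrix.of fun b' b => ∏ k, M k (b' k) (b k)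

theorem kron_apply {B B' : Fin m → Type} (M : ∀ k, Matrix (B' k) (B k) R) (b' b) :
    kron M b' b = ∏ k, M k (b' k) (b k) := rfl

/-- The mixed product rule: a product of sums is the sum over all choice functions, which are the
intermediate basis elements. -/
theorem kron_mul {B B' B'' : Fin m → Type} [∀ k, Fintype (B' k)]
    (M : ∀ k, Matrix (B'' k) (B' k) R) (N : ∀ k, Matrix (B' k) (B k) R) :
    kron M * kron N = kron fun k => M k * N k := by
  ext b'' b
  simp only [Matrix.mul_apply, kron_apply, ← Finset.prod_mul_distrib]
  rw [Finset.prod_univ_sum, Fintype.piFinset_univ]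

theorem kron_one {B : Fin m → Type} [∀ k, DecidableEq (B k)] :
    kron (fun k => (1 : Matrix (B k) (B k) R)) = 1 := by
  ext b' b
  rw [kron_apply]
  by_cases h : b' = b
  · subst h
    simp
  · rw [Matrix.one_apply_ne h]
    obtain ⟨k, hk⟩ := Function.ne_iff.1 h
    exact Finset.prod_eq_zero (Finset.mem_univ k) (Matrix.one_apply_ne hk)

/-- A sign in a single factor comes out. This is how the cross terms of the tensor homotopy cancel.
-/
theorem kron_eq_neg {B B' : Fin m → Type} (M N : ∀ k, Matrix (B' k) (B k) R) (k : Fin m)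
    (hk : M k = - N k) (h : ∀ j, j ≠ k → M j = N j) : kron M = - kron N := by
  ext b' b
  rw [Matrix.neg_apply, kron_apply, kron_apply, ← Finset.mul_prod_erase _ _ (Finset.mem_univ k),
    ← Finset.mul_prod_erase _ (fun j => N j (b' j) (b j)) (Finset.mem_univ k), hk,
    Matrix.neg_apply, neg_mul]
  congr 2
  refine Finset.prod_congr rfl fun j hj => ?_
  rw [h j (Finset.ne_of_mem_erase hj)]

theorem ne_zero_of_kron_ne_zero {B B' : Fin m → Type} {M : ∀ k, Matrix (B' k) (B k) R} {b' b}
    (h : kron M b' b ≠ 0) (k : Fin m) : M k (b' k) (b k) ≠ 0 := fun h0 =>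
  h (Finset.prod_eq_zero (Finset.mem_univ k) h0)

/-- The Kronecker product with factors `b k` at the position `k`, `a j` at the positions `j < k`
and `c j` at the positions `j > k`. -/
def slotKron {B B' : Fin m → Type} (a b c : ∀ k, Matrix (B' k) (B k) R) (k : Fin m) :
    Matrix (∀ k, B' k) (∀ k, B k) R :=
  kron fun j => if j < k then a j else if j = k then b j else c j

theorem slotKron_add {B B' : Fin m → Type} (a b b' c : ∀ k, Matrix (B' k) (B k) R) (k : Fin m) :
    slotKron a b c k + slotKron a b' c k = slotKron a (b + b') c k := by
  ext x y
  simp only [slotKron, Matrix.add_apply, kron_apply]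
  rw [← Finset.mul_prod_erase _ _ (Finset.mem_univ k),
    ← Finset.mul_prod_erase _ (fun j => (if j < k then a j else if j = k then b' j else c j)
      (x j) (y j)) (Finset.mem_univ k),
    ← Finset.mul_prod_erase _ (fun j => (if j < k then a j else if j = k then (b + b') j else c j)
      (x j) (y j)) (Finset.mem_univ k)]
  simp only [lt_self_iff_false, if_false, if_true, Pi.add_apply, Matrix.add_apply, add_mul]
  congr 1
  all_goals
    congr 1
    refine Finset.prod_congr rfl fun j hj => ?_
    simp [Finset.ne_of_mem_erase hj]

theorem prod_slot (a x o : Fin m → R) (k : Fin m) :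
    ∏ j, (if j < k then a j else if j = k then x j else o j) =
      x k * (∏ j with j < k, a j) * ∏ j with k < j, o j := by
  rw [Finset.prod_ite, mul_comm (x k), mul_assoc]
  congr 1
  rw [Finset.prod_ite]
  congr 1
  · rw [Finset.filter_filter, Finset.prod_eq_single k]
    · intro b hb hbk
      exact absurd (Finset.mem_filter.1 hb).2.2 hbk
    · intro h
      exact absurd (Finset.mem_filter.2 ⟨Finset.mem_univ k, by simp⟩) h
  · rw [Finset.filter_filter]
    refine Finset.prod_congr (Finset.filter_congr fun j _ => ?_) fun _ _ => rfl
    constructor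
    · rintro ⟨h1, h2⟩
      exact lt_of_le_of_ne (not_lt.1 h1) (Ne.symm h2)
    · intro h
      exact ⟨not_lt.2 h.le, h.ne'⟩

/-- Replacing the identities by `p` one position at a time, from the left, writes `1 - p ⊗ ⋯ ⊗ p` as
the sum of the terms `p ⊗ ⋯ ⊗ p ⊗ (1 - p) ⊗ 1 ⊗ ⋯ ⊗ 1`. -/
theorem sum_slotKron_telescope {B : Fin m → Type} [∀ k, DecidableEq (B k)]
    (p : ∀ k, Matrix (B k) (B k) R) :
    kron p + ∑ k, slotKron p (1 - p) 1 k = 1 := by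
  rw [← kron_one]
  ext x y
  simp only [Matrix.add_apply, Matrix.sum_apply, slotKron, kron_apply]
  -- Expansion of the product of the entries of `p = 1 + (p - 1)`, ordered by the position at which
  -- `p - 1` is chosen.
  have h := Finset.prod_add_ordered Finset.univ
    (fun k => (1 : Matrix (B k) (B k) R) (x k) (y k))
    (fun k => (p k - 1) (x k) (y k))
  simp only [Matrix.sub_apply, add_sub_cancel] at h
  rw [h, add_assoc]
  nth_rw 2 [← add_zero (∏ k, (1 : Matrix (B k) (B k) R) (x k) (y k))]
  congr 1
  rw [← Finset.sum_add_distrib]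
  refine Finset.sum_eq_zero fun k _ => ?_
  have e : ∀ j, (if j < k then p j else if j = k then (1 - p) j
      else (1 : ∀ k, Matrix (B k) (B k) R) j) (x j) (y j) =
      if j < k then p j (x j) (y j) else if j = k then (1 - p) j (x j) (y j)
        else (1 : Matrix (B j) (B j) R) (x j) (y j) := by
    intro j
    split_ifs <;> rfl
  rw [Finset.prod_congr rfl fun j _ => e j, prod_slot]
  simp only [Pi.sub_apply, Matrix.sub_apply, Pi.one_apply]
  ring

end Kron

/-! ### Functions with prescribed support -/

section SupportedOn

variable {R : Type u} [CommRing R] {β β' : Type*}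

/-- The functions vanishing outside `s`. -/
def supportedOn (R : Type u) [CommRing R] (s : Set β) : Submodule R (β → R) where
  carrier := {x | ∀ b, x b ≠ 0 → b ∈ s}
  add_mem' {x y} hx hy b hb := by
    by_cases h : x b = 0
    · exact hy b fun h' => hb (by rw [Pi.add_apply, h, h', add_zero])
    · exact hx b h
  zero_mem' b hb := absurd rfl hb
  smul_mem' r x hx b hb := hx b fun h => hb (by rw [Pi.smul_apply, h, smul_zero])

theorem mulVec_mem_supportedOn [Fintype β] {s : Set β} {t : Set β'} {M : Matrix β' β R}
    (h : ∀ b ∈ s, ∀ b', M b' b ≠ 0 → b' ∈ t) {x : β → R} (hx : x ∈ supportedOn R s) :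
    M.mulVec x ∈ supportedOn R t := by
  intro b' hb'
  rw [Matrix.mulVec, dotProduct] at hb'
  obtain ⟨b, -, hb⟩ := Finset.exists_ne_zero_of_sum_ne_zero hb'
  exact h b (hx b (right_ne_zero_of_mul hb)) b' (left_ne_zero_of_mul hb)

end SupportedOn

/-! ### Signs -/

section Sign

/-- The sign `(-1)^n` in `R`. -/
def intSign (R : Type u) [CommRing R] (n : ℤ) : R := ((n.negOnePow : ℤ) : R)

variable {R : Type u} [CommRing R]

theorem intSign_add (a b : ℤ) : intSign R (a + b) = intSign R a * intSign R b := by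
  simp [intSign, Int.negOnePow_add]

theorem intSign_zero : intSign R 0 = 1 := by simp [intSign]

theorem intSign_one : intSign R 1 = -1 := by simp [intSign]

theorem intSign_mul_self (a : ℤ) : intSign R a * intSign R a = 1 := by
  rw [← intSign_add, intSign, Int.negOnePow_even _ ⟨a, rfl⟩]
  simp

theorem intSign_natCast (a : ℕ) : intSign R a = (-1) ^ a := by
  induction a with
  | zero => simp [intSign_zero]
  | succ n ih => rw [Nat.cast_succ, intSign_add, ih, intSign_one, pow_succ]

theorem intSign_sum {ι : Type*} (s : Finset ι) (f : ι → ℤ) :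
    intSign R (∑ i ∈ s, f i) = ∏ i ∈ s, intSign R (f i) := by
  classical
  induction s using Finset.induction_on with
  | empty => simp [intSign_zero]
  | insert a s ha ih => rw [Finset.sum_insert ha, Finset.prod_insert ha, intSign_add, ih]

/-- A matrix homogeneous of degree `c` commutes with the sign operator up to `(-1)^c`. -/
theorem diagonal_intSign_mul {β β' : Type*} [Fintype β] [DecidableEq β] [Fintype β']
    [DecidableEq β'] (f : β → ℤ) (f' : β' → ℤ) (c : ℤ) (M : Matrix β' β R)
    (h : ∀ y x, M y x ≠ 0 → f' y = f x + c) :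
    Matrix.diagonal (fun y => intSign R (f' y)) * M =
      intSign R c • (M * Matrix.diagonal (fun x => intSign R (f x))) := by
  ext y x
  rw [Matrix.diagonal_mul, Matrix.smul_apply, Matrix.mul_diagonal]
  by_cases h0 : M y x = 0
  · simp [h0]
  · rw [h y x h0, intSign_add, smul_eq_mul]
    ring

end Sign

/-! ### Based complexes with a subcomplex, and their tensor products over `K` -/

/-- A finite free graded module with a distinguished basis, a differential, and a subcomplex spanned
by a subset of the basis. -/
structure BasedPair (R : Type u) [CommRing R] where
  B : Type
  fintype : Fintype B
  decEq : DecidableEq B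
  deg : B → ℤ
  low : B → Prop
  d : Matrix B B R
  d_deg : ∀ x y, d y x ≠ 0 → deg y = deg x + -1
  d_low : ∀ x y, d y x ≠ 0 → low x → low y

attribute [instance] BasedPair.fintype BasedPair.decEq

namespace BasedPair

variable {R : Type u} [CommRing R]

/-- The operator multiplying an element of degree `n` by `(-1)^n`. -/
def sign (P : BasedPair R) : Matrix P.B P.B R := Matrix.diagonal fun x => intSign R (P.deg x)

theorem sign_mul_sign (P : BasedPair R) : P.sign * P.sign = 1 := by
  rw [sign, Matrix.diagonal_mul_diagonal]
  simp [intSign_mul_self]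

theorem sign_mul_d (P : BasedPair R) : P.sign * P.d = - (P.d * P.sign) := by
  have h1 : intSign R (-1) = -1 := by simp [intSign]
  rw [sign, diagonal_intSign_mul _ _ (-1) _ (fun y x h => P.d_deg x y h), h1, neg_one_smul]

variable {m : ℕ}

/-- The differential of the tensor product of a family of complexes. -/
def tensorD (P : Fin m → BasedPair R) : Matrix (∀ k, (P k).B) (∀ k, (P k).B) R :=
  ∑ k, slotKron (fun j => (P j).sign) (fun j => (P j).d) (fun _ => 1) k

/-- The basis elements of degree `n` of the complex `⋃_{τ ∈ K} Y₁ ⊗ ⋯ ⊗ Yₘ`, where `Y_k` is the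
complex for `k ∈ τ` and the subcomplex for `k ∉ τ`. -/
def joinBasis (K : SComplex (Fin m)) (P : Fin m → BasedPair R) (n : ℤ) : Set (∀ k, (P k).B) :=
  {b | (∃ τ ∈ K, ∀ k, k ∉ τ → (P k).low (b k)) ∧ ∑ k, (P k).deg (b k) = n}

/-- Every factor preserves the subcomplex, so the same `τ ∈ K` that witnesses membership of `x`
witnesses that of `y`. Only the slot `k` changes the degree. -/
theorem slotKron_joinBasis {K : SComplex (Fin m)} {P Q : Fin m → BasedPair R}
    {a b c : ∀ k, Matrix (Q k).B (P k).B R} {k : Fin m} {e n : ℤ}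
    (ha : ∀ k x y, a k y x ≠ 0 → (Q k).deg y = (P k).deg x ∧ ((P k).low x → (Q k).low y))
    (hb : ∀ k x y, b k y x ≠ 0 → (Q k).deg y = (P k).deg x + e ∧ ((P k).low x → (Q k).low y))
    (hc : ∀ k x y, c k y x ≠ 0 → (Q k).deg y = (P k).deg x ∧ ((P k).low x → (Q k).low y))
    {x : ∀ k, (P k).B} {y : ∀ k, (Q k).B} (hx : x ∈ joinBasis K P n)
    (h : slotKron a b c k y x ≠ 0) : y ∈ joinBasis K Q (n + e) := by
  obtain ⟨⟨τ, hτ, hlow⟩, hdeg⟩ := hx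
  have h' := fun j => ne_zero_of_kron_ne_zero h j
  refine ⟨⟨τ, hτ, fun j hj => ?_⟩, ?_⟩
  · have := h' j
    dsimp only at this
    split_ifs at this
    · exact (ha _ _ _ this).2 (hlow j hj)
    · exact (hb _ _ _ this).2 (hlow j hj)
    · exact (hc _ _ _ this).2 (hlow j hj)
  · have e1 : ∀ j, (Q j).deg (y j) = (P j).deg (x j) + if j = k then e else 0 := by
      intro j
      have := h' j
      dsimp only at this
      split_ifs at this with h1 h2
      · rw [if_neg h1.ne, add_zero]
        exact (ha _ _ _ this).1
      · rw [if_pos h2]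
        exact (hb _ _ _ this).1
      · rw [if_neg h2, add_zero]
        exact (hc _ _ _ this).1
    rw [Finset.sum_congr rfl fun j _ => e1 j, Finset.sum_add_distrib, hdeg]
    simp

theorem kron_joinBasis {K : SComplex (Fin m)} {P Q : Fin m → BasedPair R}
    {a : ∀ k, Matrix (Q k).B (P k).B R} {n : ℤ}
    (ha : ∀ k x y, a k y x ≠ 0 → (Q k).deg y = (P k).deg x ∧ ((P k).low x → (Q k).low y))
    {x : ∀ k, (P k).B} {y : ∀ k, (Q k).B} (hx : x ∈ joinBasis K P n)
    (h : kron a y x ≠ 0) : y ∈ joinBasis K Q n := by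
  obtain ⟨⟨τ, hτ, hlow⟩, hdeg⟩ := hx
  have h' := fun j => ha _ _ _ (ne_zero_of_kron_ne_zero h j)
  refine ⟨⟨τ, hτ, fun j hj => (h' j).2 (hlow j hj)⟩, ?_⟩
  rw [← hdeg]
  exact Finset.sum_congr rfl fun j _ => (h' j).1

theorem sign_ne_zero {P : BasedPair R} {x y : P.B} (h : P.sign y x ≠ 0) :
    P.deg y = P.deg x ∧ (P.low x → P.low y) := by
  obtain rfl : y = x := by
    by_contra hne
    exact h (Matrix.diagonal_apply_ne _ hne)
  exact ⟨rfl, id⟩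

theorem one_ne_zero' {P : BasedPair R} {x y : P.B} (h : (1 : Matrix P.B P.B R) y x ≠ 0) :
    P.deg y = P.deg x ∧ (P.low x → P.low y) := by
  obtain rfl : y = x := by
    by_contra hne
    exact h (Matrix.one_apply_ne hne)
  exact ⟨rfl, id⟩

theorem tensorD_mem (K : SComplex (Fin m)) (P : Fin m → BasedPair R) (i j : ℤ) (hij : j + 1 = i)
    (x : (∀ k, (P k).B) → R) (hx : x ∈ supportedOn R (joinBasis K P i)) :
    (tensorD P).mulVecLin x ∈ supportedOn R (joinBasis K P j) := by
  refine mulVec_mem_supportedOn (fun b hb b' hb' => ?_) hx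
  rw [tensorD, Matrix.sum_apply] at hb'
  obtain ⟨k, -, hk⟩ := Finset.exists_ne_zero_of_sum_ne_zero hb'
  obtain rfl : j = i + -1 := by omega
  exact slotKron_joinBasis (fun _ _ _ => sign_ne_zero)
    (fun k x y h => ⟨(P k).d_deg x y h, (P k).d_low x y h⟩) (fun _ _ _ => one_ne_zero') hb hk

/-- The complex `⋃_{τ ∈ K} Y₁ ⊗ ⋯ ⊗ Yₘ`. -/
def joinDiff (K : SComplex (Fin m)) (P : Fin m → BasedPair R) :
    GradedDiff R fun n => supportedOn R (joinBasis K P n) :=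
  restrictDiff (tensorD P).mulVecLin (fun n => supportedOn R (joinBasis K P n)) (tensorD_mem K P)

end BasedPair

/-! ### Tensor products of deformation retractions -/

/-- A deformation retraction of based pairs. -/
structure BasedRetract {R : Type u} [CommRing R] (P Q : BasedPair R) where
  φ : Matrix P.B Q.B R
  ψ : Matrix Q.B P.B R
  h : Matrix P.B P.B R
  φ_supp : ∀ x y, φ y x ≠ 0 → P.deg y = Q.deg x ∧ (Q.low x → P.low y)
  ψ_supp : ∀ x y, ψ y x ≠ 0 → Q.deg y = P.deg x ∧ (P.low x → Q.low y)
  h_supp : ∀ x y, h y x ≠ 0 → P.deg y = P.deg x + 1 ∧ (P.low x → P.low y)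
  d_φ : P.d * φ = φ * Q.d
  d_ψ : Q.d * ψ = ψ * P.d
  ψ_φ : ψ * φ = 1
  homotopy : φ * ψ + P.d * h + h * P.d = 1

namespace BasedRetract

variable {R : Type u} [CommRing R] 

section One

variable {P Q : BasedPair R} (E : BasedRetract P Q)

theorem sign_φ : P.sign * E.φ = E.φ * Q.sign := by
  rw [BasedPair.sign, diagonal_intSign_mul Q.deg P.deg 0 _
    (fun y x h => by rw [(E.φ_supp x y h).1, add_zero]), intSign_zero, one_smul]
  rfl

theorem sign_ψ : Q.sign * E.ψ = E.ψ * P.sign := by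
  rw [BasedPair.sign, diagonal_intSign_mul P.deg Q.deg 0 _
    (fun y x h => by rw [(E.ψ_supp x y h).1, add_zero]), intSign_zero, one_smul]
  rfl

theorem sign_h : P.sign * E.h = - (E.h * P.sign) := by
  rw [BasedPair.sign, diagonal_intSign_mul P.deg P.deg 1 _
    (fun y x h => (E.h_supp x y h).1), intSign_one, neg_one_smul]

theorem sign_mul_p : P.sign * (E.φ * E.ψ) = E.φ * E.ψ * P.sign := by
  rw [← Matrix.mul_assoc, E.sign_φ, Matrix.mul_assoc, E.sign_ψ, Matrix.mul_assoc]

theorem d_mul_p : P.d * (E.φ * E.ψ) = E.φ * E.ψ * P.d := by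
  rw [← Matrix.mul_assoc, E.d_φ, Matrix.mul_assoc, E.d_ψ, Matrix.mul_assoc]

theorem p_supp (x y) (h : (E.φ * E.ψ) y x ≠ 0) : P.deg y = P.deg x ∧ (P.low x → P.low y) := by
  rw [Matrix.mul_apply] at h
  obtain ⟨z, -, hz⟩ := Finset.exists_ne_zero_of_sum_ne_zero h
  have h1 := E.φ_supp _ _ (left_ne_zero_of_mul hz)
  have h2 := E.ψ_supp _ _ (right_ne_zero_of_mul hz)
  exact ⟨h1.1.trans h2.1, h1.2 ∘ h2.2⟩

theorem sign_p_supp (x y) (h : (P.sign * (E.φ * E.ψ)) y x ≠ 0) :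
    P.deg y = P.deg x ∧ (P.low x → P.low y) := by
  rw [Matrix.mul_apply] at h
  obtain ⟨z, -, hz⟩ := Finset.exists_ne_zero_of_sum_ne_zero h
  have h1 := BasedPair.sign_ne_zero (left_ne_zero_of_mul hz)
  have h2 := E.p_supp _ _ (right_ne_zero_of_mul hz)
  exact ⟨h1.1.trans h2.1, h1.2 ∘ h2.2⟩

end One

variable {m : ℕ} {P Q : Fin m → BasedPair R} (E : ∀ k, BasedRetract (P k) (Q k))

/-- Holds slot by slot: a chain map of degree zero commutes with the sign operators, the
differential and the identity. -/
theorem tensorD_mul_kron_φ :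
    BasedPair.tensorD P * kron (fun k => (E k).φ) =
      kron (fun k => (E k).φ) * BasedPair.tensorD Q := by
  rw [BasedPair.tensorD, BasedPair.tensorD, Matrix.sum_mul, Matrix.mul_sum]
  refine Finset.sum_congr rfl fun k _ => ?_
  rw [slotKron, slotKron, kron_mul, kron_mul]
  congr 1
  funext j
  split_ifs
  · exact (E j).sign_φ
  · exact (E j).d_φ
  · rw [Matrix.one_mul, Matrix.mul_one]

theorem tensorD_mul_kron_ψ :
    BasedPair.tensorD Q * kron (fun k => (E k).ψ) =
      kron (fun k => (E k).ψ) * BasedPair.tensorD P := by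
  rw [BasedPair.tensorD, BasedPair.tensorD, Matrix.sum_mul, Matrix.mul_sum]
  refine Finset.sum_congr rfl fun k _ => ?_
  rw [slotKron, slotKron, kron_mul, kron_mul]
  congr 1
  funext j
  split_ifs
  · exact (E j).sign_ψ
  · exact (E j).d_ψ
  · rw [Matrix.one_mul, Matrix.mul_one]

/-- The homotopy of the tensor product of deformation retractions. -/
def tensorH : Matrix (∀ k, (P k).B) (∀ k, (P k).B) R :=
  ∑ k, slotKron (fun j => (P j).sign * ((E j).φ * (E j).ψ)) (fun j => (E j).h) (fun _ => 1) k

/-- With `p = φ ψ`, the homotopy is the sum over `l` of `(sign p) ⊗ ⋯ ⊗ h ⊗ 1 ⊗ ⋯`, where `h` stands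
in slot `l`. Its products with the slot `l` of the differential give the telescoping terms, as `d h
+ h d = 1 - p` and the signs square to one; its products with the other slots cancel in pairs. -/
theorem tensor_homotopy :
    kron (fun k => (E k).φ) * kron (fun k => (E k).ψ) +
      (BasedPair.tensorD P * tensorH E + tensorH E * BasedPair.tensorD P) = 1 := by
  rw [kron_mul, ← sum_slotKron_telescope (fun k => (E k).φ * (E k).ψ)]
  congr 1
  rw [BasedPair.tensorD, tensorH, Finset.sum_mul_sum, Finset.sum_mul_sum, Finset.sum_comm,
    ← Finset.sum_add_distrib]
  refine Finset.sum_congr rfl fun l _ => ?_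
  -- For the homotopy in slot `l`, only the differential in the same slot survives.
  rw [← Finset.sum_add_distrib, Finset.sum_eq_single l]
  · have key : ∀ k, (1 - (E k).φ * (E k).ψ : Matrix (P k).B (P k).B R) =
        (P k).d * (E k).h + (E k).h * (P k).d := fun k => by
      rw [← (E k).homotopy]
      abel
    have e1 : (1 - fun k => (E k).φ * (E k).ψ : ∀ k, Matrix (P k).B (P k).B R) =
        (fun k => (P k).d * (E k).h) + (fun k => (E k).h * (P k).d) := funext key
    rw [e1, ← slotKron_add]
    congr 1
    · rw [slotKron, slotKron, slotKron, kron_mul]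
      congr 1
      funext j
      split_ifs
      · rw [← mul_assoc, BasedPair.sign_mul_sign, one_mul]
      · rfl
      · exact one_mul _
    · rw [slotKron, slotKron, slotKron, kron_mul]
      congr 1
      funext j
      split_ifs
      · rw [(E j).sign_mul_p, mul_assoc, BasedPair.sign_mul_sign, mul_one]
      · rfl
      · exact one_mul _
  · intro k _ hkl
    rw [slotKron, slotKron, kron_mul, kron_mul]
    rcases lt_or_gt_of_ne hkl with h | h
    -- Differential to the left of the homotopy: in slot `k`, `d` commutes with `p` but anticommutes
    -- with the sign in front of it; the other slots commute.
    · rw [kron_eq_neg _ _ k _ _, neg_add_cancel]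
      · simp only [lt_self_iff_false, if_false, if_true, h]
        rw [mul_assoc (P k).sign, ← (E k).d_mul_p, ← mul_assoc, ← mul_assoc, (P k).sign_mul_d,
          neg_mul, neg_neg]
      · intro j hj
        rw [if_neg hj]
        by_cases h1 : j < k
        · rw [if_pos h1, if_pos (h1.trans h), mul_assoc (P j).sign, (E j).sign_mul_p]
        · rw [if_neg h1, one_mul, mul_one]
    -- Differential to the right of the homotopy: the sign operator of the differential meets `h` in
    -- slot `l` and anticommutes with it.
    · rw [kron_eq_neg _ _ l _ _, neg_add_cancel]
      · simp only [lt_self_iff_false, if_false, if_true, h]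
        exact (E l).sign_h
      · intro j hj
        by_cases h1 : j < l
        · rw [if_pos h1, if_pos (h1.trans h), mul_assoc (P j).sign, (E j).sign_mul_p]
        · rw [if_neg h1, if_neg hj, one_mul, mul_one]
  · intro h
    exact absurd (Finset.mem_univ _) h

/-- Deformation retractions of the factors induce one of `⋃_{τ ∈ K} Y₁ ⊗ ⋯ ⊗ Yₘ`. -/
def joinRetract (K : SComplex (Fin m)) :
    GradedRetract (BasedPair.joinDiff K P) (BasedPair.joinDiff K Q) :=
  GradedRetract.ofRestrict (kron fun k => (E k).ψ).mulVecLin (kron fun k => (E k).φ).mulVecLin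
    (tensorH E).mulVecLin
    (fun _ _ hx => mulVec_mem_supportedOn (fun _ hb _ h =>
      BasedPair.kron_joinBasis (fun k => (E k).ψ_supp) hb h) hx)
    (fun _ _ hx => mulVec_mem_supportedOn (fun _ hb _ h =>
      BasedPair.kron_joinBasis (fun k => (E k).φ_supp) hb h) hx)
    (fun i j hij _ hx => mulVec_mem_supportedOn (fun b hb b' hb' => by
      rw [tensorH, Matrix.sum_apply] at hb'
      obtain ⟨k, -, hk⟩ := Finset.exists_ne_zero_of_sum_ne_zero hb'
      rw [← hij]
      exact BasedPair.slotKron_joinBasis (fun k => (E k).sign_p_supp) (fun k => (E k).h_supp)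
        (fun _ _ _ => BasedPair.one_ne_zero') hb hk) hx)
    (fun _ x _ => by
      simp only [Matrix.mulVecLin_apply, Matrix.mulVec_mulVec]
      rw [tensorD_mul_kron_ψ])
    (fun _ x _ => by
      simp only [Matrix.mulVecLin_apply, Matrix.mulVec_mulVec]
      rw [tensorD_mul_kron_φ])
    (fun _ x _ => by
      simp only [Matrix.mulVecLin_apply, Matrix.mulVec_mulVec]
      rw [kron_mul]
      simp only [(E _).ψ_φ]
      rw [kron_one, Matrix.one_mulVec])
    (fun _ x _ => by
      simp only [Matrix.mulVecLin_apply, Matrix.mulVec_mulVec]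
      rw [← Matrix.add_mulVec, ← Matrix.add_mulVec, add_assoc, tensor_homotopy, Matrix.one_mulVec])

end BasedRetract

/-! ### Isomorphisms as retractions; the tensor differential on basis vectors -/

section

variable {R : Type u} [CommRing R]

/-- Isomorphic graded diagrams are deformation retracts of each other. -/
noncomputable def GradedRetract.ofBijective {C C' : ℤ → Type*} [∀ n, AddCommGroup (C n)]
    [∀ n, Module R (C n)] [∀ n, AddCommGroup (C' n)] [∀ n, Module R (C' n)] {δ : GradedDiff R C}
    {δ' : GradedDiff R C'} (r : ∀ n, C n →ₗ[R] C' n) (hr : ∀ n, Function.Bijective (r n))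
    (comm : ∀ i j hij, r j ∘ₗ δ i j hij = δ' i j hij ∘ₗ r i) : GradedRetract δ δ' where
  r := r
  s n := (LinearEquiv.ofBijective (r n) (hr n)).symm.toLinearMap
  h _ _ _ := 0
  r_comm := comm
  s_comm i j hij := LinearMap.ext fun x => by
    refine (hr j).1 ?_
    have h1 := LinearMap.congr_fun (comm i j hij)
      ((LinearEquiv.ofBijective (r i) (hr i)).symm x)
    have h2 := (LinearEquiv.ofBijective (r i) (hr i)).apply_symm_apply x
    have h3 := (LinearEquiv.ofBijective (r j) (hr j)).apply_symm_apply (δ' i j hij x)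
    simp only [LinearMap.comp_apply, LinearEquiv.coe_coe, LinearEquiv.ofBijective_apply]
      at h1 h2 h3 ⊢
    rw [h3, h1, h2]
  r_s n := LinearMap.ext fun x => (LinearEquiv.ofBijective (r n) (hr n)).apply_symm_apply x
  s_r i j k hij hjk := by
    rw [LinearMap.comp_zero, LinearMap.zero_comp, add_zero, add_zero]
    exact LinearMap.ext fun x => (LinearEquiv.ofBijective (r j) (hr j)).symm_apply_apply x

variable {m : ℕ}

theorem BasedPair.tensorD_single (P : Fin m → BasedPair R) (b : ∀ k, (P k).B) :
    (tensorD P).mulVec (Pi.single b 1) =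
      ∑ k, intSign R (∑ j with j < k, (P j).deg (b j)) •
        ∑ y, (P k).d y (b k) • Pi.single (Function.update b k y) 1 := by
  rw [Matrix.mulVec_single_one]
  ext b'
  rw [Matrix.col_apply, tensorD, Matrix.sum_apply, Finset.sum_apply]
  refine Finset.sum_congr rfl fun k _ => ?_
  rw [Pi.smul_apply, Finset.sum_apply, smul_eq_mul]
  simp only [Pi.smul_apply, smul_eq_mul]
  -- The `k`-th term changes `b` in slot `k` only; at any other `b'` both sides vanish.
  by_cases h : ∀ j, j ≠ k → b' j = b j
  · have h1 : b' = Function.update b k (b' k) := by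
      funext j
      by_cases hj : j = k
      · subst hj
        simp
      · simp [hj, h j hj]
    rw [Finset.sum_eq_single (b' k)]
    · rw [← h1, Pi.single_eq_same, mul_one, slotKron, kron_apply, intSign_sum]
      have e : ∀ j, (if j < k then (P j).sign else if j = k then (P j).d else 1) (b' j) (b j) =
          if j < k then intSign R ((P j).deg (b j)) else
            if j = k then (P j).d (b' j) (b j) else 1 := by
        intro j
        split_ifs with h2 h3
        · rw [h j h2.ne, BasedPair.sign, Matrix.diagonal_apply_eq]
        · rfl
        · rw [h j h3, Matrix.one_apply_eq]
      rw [Finset.prod_congr rfl fun j _ => e j, prod_slot, Finset.prod_const_one, mul_one, mul_comm]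
    · intro y _ hy
      rw [Pi.single_apply, if_neg, mul_zero]
      intro h2
      rw [h2] at hy
      simp at hy
    · intro h
      exact absurd (Finset.mem_univ _) h
  · push Not at h
    obtain ⟨j, hj, hne⟩ := h
    trans (0 : R)
    · by_contra h0
      have := ne_zero_of_kron_ne_zero h0 j
      dsimp only at this
      rw [if_neg hj] at this
      split_ifs at this
      · rw [BasedPair.sign, Matrix.diagonal_apply_ne _ hne] at this
        exact this rfl
      · rw [Matrix.one_apply_ne hne] at this
        exact this rfl
    · symm
      refine mul_eq_zero_of_right _ (Finset.sum_eq_zero fun y _ => ?_)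
      rw [Pi.single_apply, if_neg, mul_zero]
      intro h2
      rw [h2] at hne
      simp [hj] at hne

end

/-! ### Words, kinds and indices -/

section Letters

theorem mem_betaSet {V : Type*} [Fintype V] [LinearOrder V] {w : V → Letter} {k : V} :
    k ∈ betaSet w ↔ w k = .β := by
  simp [betaSet]

theorem mem_faceSet {V : Type*} [Fintype V] [LinearOrder V] {w : V → Letter} {k : V} :
    k ∈ faceSet w ↔ w k = .α ∨ w k = .β := by
  simp [faceSet]

theorem mem_wordIndex_fst {V : Type*} [Fintype V] [LinearOrder V] {w : V → Letter} {k : V} :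
    k ∈ (wordIndex w).1 ↔ w k = .α := by
  simp [wordIndex]

theorem mem_wordIndex_snd {V : Type*} [Fintype V] [LinearOrder V] {w : V → Letter} {k : V} :
    k ∈ (wordIndex w).2 ↔ w k = .β ∨ w k = .γ := by
  simp [wordIndex]

/-- The letter with the given index; at the index `(∅, {1})` the two letters `β` and `γ` are
distinguished by a Boolean. -/
def letterOf : PointIndex → Bool → Letter
  | .inSigma, _ => .α
  | .inOmega, true => .β
  | .inOmega, false => .γ
  | .neither, _ => .η

/-- The index `(σ, ω)` with the given components. -/
def kindIndex {m : ℕ} (s : Fin m → PointIndex) : Finset (Fin m) × Finset (Fin m) :=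
  wordIndex fun k => letterOf (s k) false

theorem kindIndex_mem_totalIndex {m : ℕ} (s : Fin m → PointIndex) :
    kindIndex s ∈ totalIndex (Fin m) := by
  refine Finset.disjoint_left.2 fun k h1 h2 => ?_
  rw [kindIndex, mem_wordIndex_fst] at h1
  rw [kindIndex, mem_wordIndex_snd, h1] at h2
  simp at h2

theorem pointIndex_kindIndex {m : ℕ} (s : Fin m → PointIndex) (k : Fin m) :
    pointIndex (kindIndex s) k = s k := by
  simp only [pointIndex, kindIndex, mem_wordIndex_fst, mem_wordIndex_snd]
  cases s k <;> simp [letterOf]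

theorem kindIndex_pointIndex {m : ℕ} {a : Finset (Fin m) × Finset (Fin m)}
    (ha : a ∈ totalIndex (Fin m)) : kindIndex (pointIndex a) = a := by
  have h : ∀ k, k ∈ a.1 → k ∉ a.2 := fun k hk => Finset.disjoint_left.1 ha hk
  refine Prod.ext (Finset.ext fun k => ?_) (Finset.ext fun k => ?_) <;>
    simp only [kindIndex, mem_wordIndex_fst, mem_wordIndex_snd] <;> rw [pointIndex] <;>
    specialize h k <;> split_ifs with h1 h2 <;> simp_all [letterOf]

theorem wordIndex_letterOf {m : ℕ} (s : Fin m → PointIndex) (b : Fin m → Bool) :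
    wordIndex (fun k => letterOf (s k) (b k)) = kindIndex s := by
  refine Prod.ext (Finset.ext fun k => ?_) (Finset.ext fun k => ?_) <;>
    simp only [kindIndex, mem_wordIndex_fst, mem_wordIndex_snd] <;>
    cases s k <;> cases b k <;> simp [letterOf]

/-- The index determines every letter except for the choice between `β` and `γ`. Requiring the
Boolean to be `false` outside the kind `inOmega` matches the field `kind_gen` of `NormalBasis`. -/
theorem exists_letterOf {m : ℕ} (s : Fin m → PointIndex) (w : Fin m → Letter)
    (h : wordIndex w = kindIndex s) :
    ∃ b : Fin m → Bool, (∀ k, b k = true → s k = .inOmega) ∧ w = fun k => letterOf (s k) (b k) := by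
  have h1 := fun k => Finset.ext_iff.1 (congrArg Prod.fst h) k
  have h2 := fun k => Finset.ext_iff.1 (congrArg Prod.snd h) k
  simp only [kindIndex, mem_wordIndex_fst, mem_wordIndex_snd] at h1 h2
  refine ⟨fun k => decide (w k = .β), fun k hk => ?_, funext fun k => ?_⟩
  · have hw := of_decide_eq_true hk
    have := h2 k
    rw [hw] at this
    revert this
    cases s k <;> simp [letterOf]
  · specialize h1 k
    specialize h2 k
    have h3 : decide (w k = .β) = true ↔ w k = .β := decide_eq_true_iff
    change w k = letterOf (s k) (decide (w k = .β))
    generalize decide (w k = .β) = b at h3 ⊢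
    revert h1 h2 h3
    cases s k <;> cases w k <;> cases b <;> simp [letterOf]

end Letters

/-! ### Normal complexes and the summands of the total complex of `K` -/

section Normal

variable {R : Type u} [CommRing R]

/-- The basis of a normal complex: one element for each generator, and a second one, of one degree
higher, for each generator of kind `(∅, {1})`. -/
@[ext]
structure NormalBasis (G : Type) (kind : G → PointIndex) where
  gen : G
  up : Bool
  kind_gen : up = true → kind gen = .inOmega

instance {G : Type} [Finite G] (kind : G → PointIndex) : Finite (NormalBasis G kind) :=
  Finite.of_injective (fun x : NormalBasis G kind => (x.gen, x.up)) fun _ _ h =>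
    NormalBasis.ext (congrArg Prod.fst h) (congrArg Prod.snd h)

noncomputable instance {G : Type} [Finite G] (kind : G → PointIndex) :
    Fintype (NormalBasis G kind) := Fintype.ofFinite _

noncomputable instance {G : Type} (kind : G → PointIndex) :
    DecidableEq (NormalBasis G kind) := Classical.decEq _

/-- Lowering a letter `β` to `γ`. -/
def NormalBasis.lower {G : Type} {kind : G → PointIndex} (x : NormalBasis G kind) :
    NormalBasis G kind :=
  ⟨x.gen, false, fun h => absurd h Bool.false_ne_true⟩

/-- The direct sum of shifts of copies of the complexes spanned by `α`, by `β, γ` and by `η`: there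
is one copy for each `g : G`, of the given kind and shifted by the given degree. -/
noncomputable abbrev normalPair (R : Type u) [CommRing R] (G : Type) [Finite G]
    (kind : G → PointIndex) (deg : G → ℤ) : BasedPair R where
  B := NormalBasis G kind
  fintype := inferInstance
  decEq := inferInstance
  deg x := deg x.gen + if x.up then 1 else 0
  low x := kind x.gen ≠ .inSigma ∧ x.up = false
  d y x := if x.up = true ∧ y = x.lower then 1 else 0
  d_deg _ _ h := by
    rw [ne_eq, ite_eq_right_iff, Classical.not_imp] at h
    obtain ⟨⟨h1, rfl⟩, -⟩ := h
    simp [h1, NormalBasis.lower]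
  d_low _ _ h := by
    rw [ne_eq, ite_eq_right_iff, Classical.not_imp] at h
    obtain ⟨⟨h1, rfl⟩, -⟩ := h
    simp [h1]

variable {m : ℕ} {G : Fin m → Type} {kind : ∀ k, G k → PointIndex}
  {deg : ∀ k, G k → ℤ}

namespace normalPair

/-- The word of a basis element of a tensor product of normal complexes. -/
def word (e : ∀ k, NormalBasis (G k) (kind k)) : Fin m → Letter :=
  fun k => letterOf (kind k (e k).gen) (e k).up

/-- The generators underlying a basis element. -/
def gen (e : ∀ k, NormalBasis (G k) (kind k)) : ∀ k, G k := fun k => (e k).gen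

/-- The sign comparing the differential of the tensor product with that of the words. -/
def unit (R : Type u) [CommRing R] (deg : ∀ k, G k → ℤ) (e : ∀ k, NormalBasis (G k) (kind k)) : R :=
  ∏ k, if (e k).up then intSign R (∑ j with j < k, deg j (e j).gen) else 1

theorem unit_mul_unit (e : ∀ k, NormalBasis (G k) (kind k)) :
    unit R deg e * unit R deg e = 1 := by
  rw [unit, ← Finset.prod_mul_distrib]
  refine Finset.prod_eq_one fun k _ => ?_
  split_ifs
  · exact intSign_mul_self _
  · exact one_mul 1

theorem mem_betaSet_word (e : ∀ k, NormalBasis (G k) (kind k)) (k : Fin m) :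
    k ∈ betaSet (word e) ↔ (e k).up = true := by
  have := (e k).kind_gen
  rw [mem_betaSet, word]
  cases h : (e k).up
  · cases kind k (e k).gen <;> simp [letterOf]
  · simp [this h, letterOf]

theorem word_update_lower (e : ∀ k, NormalBasis (G k) (kind k)) (k : Fin m)
    (h : (e k).up = true) :
    word (Function.update e k (e k).lower) = Function.update (word e) k .γ := by
  funext j
  by_cases hj : j = k
  · subst hj
    have := (e j).kind_gen h
    simp [word, NormalBasis.lower, this, letterOf]
  · simp [word, hj]

theorem gen_update_lower (e : ∀ k, NormalBasis (G k) (kind k)) (k : Fin m) :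
    gen (Function.update e k (e k).lower) = gen e := by
  funext j
  by_cases hj : j = k
  · subst hj
    simp [gen, NormalBasis.lower]
  · simp [gen, hj]

/-- Lowering slot `k` removes exactly one factor of the product; the others depend only on the
generators and on the remaining raised slots. -/
theorem unit_update_lower (e : ∀ k, NormalBasis (G k) (kind k)) (k : Fin m)
    (h : (e k).up = true) :
    unit R deg e = unit R deg (Function.update e k (e k).lower) *
      intSign R (∑ j with j < k, deg j (e j).gen) := by
  have hg := gen_update_lower e k
  have hg' : ∀ j, (Function.update e k (e k).lower j).gen = (e j).gen := congrFun hg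
  rw [unit, unit, ← Finset.mul_prod_erase _ _ (Finset.mem_univ k),
    ← Finset.mul_prod_erase _ (fun k_1 => if (Function.update e k (e k).lower k_1).up = true
      then _ else _) (Finset.mem_univ k), if_pos h]
  rw [if_neg (by simp [NormalBasis.lower]), one_mul, mul_comm]
  congr 1
  refine Finset.prod_congr rfl fun j hj => ?_
  simp only [hg']
  rw [Function.update_of_ne (Finset.ne_of_mem_erase hj)]

theorem eq_of_gen_eq_of_word_eq {e e' : ∀ k, NormalBasis (G k) (kind k)}
    (h1 : gen e = gen e') (h2 : word e = word e') : e = e' := by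
  funext k
  refine NormalBasis.ext (congrFun h1 k) ?_
  rw [Bool.eq_iff_iff, ← mem_betaSet_word, ← mem_betaSet_word, h2]

variable [∀ k, Finite (G k)]

theorem sum_d_smul {M : Type*} [AddCommGroup M] [Module R M] {k : Fin m}
    (x : NormalBasis (G k) (kind k)) (f : NormalBasis (G k) (kind k) → M) :
    ∑ y, (normalPair R (G k) (kind k) (deg k)).d y x • f y =
      if x.up then f x.lower else 0 := by
  split_ifs with h
  · rw [Finset.sum_eq_single x.lower]
    · simp [h]
    · intro y _ hy
      simp [hy]
    · intro h
      exact absurd (Finset.mem_univ _) h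
  · refine Finset.sum_eq_zero fun y _ => ?_
    simp [h]

theorem tensorD_single (e : ∀ k, NormalBasis (G k) (kind k)) :
    (BasedPair.tensorD fun k => normalPair R (G k) (kind k) (deg k)).mulVec (Pi.single e 1) =
      ∑ k, intSign R (∑ j with j < k, (deg j (e j).gen + if (e j).up then 1 else 0)) •
        if (e k).up then Pi.single (Function.update e k (e k).lower) 1 else 0 := by
  rw [BasedPair.tensorD_single]
  refine Finset.sum_congr rfl fun k _ => ?_
  congr 1
  exact sum_d_smul (e k) _

/-- The comparison of the tensor product of normal complexes with complexes of words. -/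
noncomputable def toWords (R : Type u) [CommRing R] (deg : ∀ k, G k → ℤ) : ((∀ k, NormalBasis (G k) (kind k)) → R) →ₗ[R]
    ((∀ k, G k) → ((Fin m → Letter) →₀ R)) := by
  classical exact Fintype.linearCombination R fun e =>
    Pi.single (gen e) (Finsupp.single (word e) (unit R deg e))

theorem toWords_single [DecidableEq (∀ k, G k)]
    (e : ∀ k, NormalBasis (G k) (kind k)) :
    toWords R deg (Pi.single e 1) = Pi.single (gen e) (Finsupp.single (word e) (unit R deg e)) := by
  rw [toWords, Fintype.linearCombination_apply_single, one_smul]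
  congr!

/-- The tensor differential carries the sign of the full degrees of the earlier factors, the word
differential only that of the earlier letters `β`. The discrepancy, the degrees of the earlier
generators, is the factor of `unit` lost on lowering. -/
theorem toWords_tensorD (x : (∀ k, NormalBasis (G k) (kind k)) → R) :
    toWords R deg ((BasedPair.tensorD fun k => normalPair R (G k) (kind k) (deg k)).mulVec x) =
      fun c => wordBoundary R (Fin m) (toWords R deg x c) := by
  classical
  suffices h : toWords R deg ∘ₗ
      (BasedPair.tensorD fun k => normalPair R (G k) (kind k) (deg k)).mulVecLin =
      (LinearMap.pi fun c => wordBoundary R (Fin m) ∘ₗ LinearMap.proj c) ∘ₗ toWords R deg from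
    LinearMap.congr_fun h x
  refine (Pi.basisFun R _).ext fun e => ?_
  rw [Pi.basisFun_apply, LinearMap.comp_apply, LinearMap.comp_apply, Matrix.mulVecLin_apply,
    tensorD_single, toWords_single, map_sum]
  simp only [map_smul]
  funext c
  rw [LinearMap.pi_apply, LinearMap.comp_apply, LinearMap.proj_apply, Finset.sum_apply]
  simp only [apply_ite (toWords R deg : _ → (∀ k, G k) → _), map_zero]
  simp only [toWords_single, gen_update_lower, Pi.smul_apply]
  by_cases hc : c = gen e
  · subst hc
    rw [Pi.single_eq_same, wordBoundary, altBoundary, Finsupp.linearCombination_single,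
      Finset.smul_sum, ← Finset.sum_subset (Finset.subset_univ (betaSet (word e)))]
    · refine Finset.sum_congr rfl fun k hk => ?_
      rw [mem_betaSet_word] at hk
      rw [if_pos hk, Pi.single_eq_same, word_update_lower e k hk, Finsupp.smul_single,
        Finsupp.smul_single, unit_update_lower e k hk]
      congr 1
      -- The total degree of the earlier slots splits into the generator degrees, absorbed by
      -- `unit`, and the number of earlier letters `β`, which is the exponent in `altBoundary`.
      have e1 : ∑ j with j < k, (deg j (e j).gen + if (e j).up then 1 else 0) =
          (∑ j with j < k, deg j (e j).gen) + ((betaSet (word e)).filter (· < k)).card := by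
        rw [Finset.sum_add_distrib, Finset.card_filter, Finset.sum_filter (fun j => j < k)]
        congr 1
        push_cast
        rw [← Finset.sum_filter, ← Finset.sum_filter, Finset.filter_filter]
        refine Finset.sum_congr (Finset.ext fun j => ?_) fun _ _ => rfl
        simp only [Finset.mem_filter, Finset.mem_univ, true_and, mem_betaSet_word]
        exact and_comm
      rw [e1, intSign_add, intSign_natCast, smul_eq_mul, smul_eq_mul]
      ring
    · intro k _ hk
      rw [mem_betaSet_word] at hk
      rw [if_neg hk]
      simp
  · rw [Pi.single_eq_of_ne hc, map_zero]
    refine Finset.sum_eq_zero fun k _ => ?_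
    split_ifs
    · rw [Pi.single_eq_of_ne hc, smul_zero]
    · simp

/-- The slots outside the subcomplex are those carrying `α` or `β`. -/
theorem mem_joinBasis_iff (K : SComplex (Fin m))
    (e : ∀ k, NormalBasis (G k) (kind k)) (n : ℤ) :
    e ∈ BasedPair.joinBasis K (fun k => normalPair R (G k) (kind k) (deg k)) n ↔
      faceSet (word e) ∈ K ∧ ((betaSet (word e)).card : ℤ) = n - ∑ k, deg k (gen e k) := by
  have h1 : ∀ k, k ∈ faceSet (word e) ↔ ¬ (normalPair R (G k) (kind k) (deg k)).low (e k) := by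
    intro k
    have := (e k).kind_gen
    rw [mem_faceSet, word]
    cases h : (e k).up
    · cases hk : kind k (e k).gen <;> simp [letterOf, h, hk]
    · simp [this h, letterOf, h]
  have h2 : ∑ k, (normalPair R (G k) (kind k) (deg k)).deg (e k) =
      ∑ k, deg k (gen e k) + (betaSet (word e)).card := by
    simp only [gen]
    rw [Finset.sum_add_distrib, Finset.card_eq_sum_ones, Nat.cast_sum,
      ← Finset.sum_filter (p := fun k => (e k).up = true)]
    congr 1
    rw [Nat.cast_one]
    refine Finset.sum_congr (Finset.ext fun k => ?_) fun _ _ => rfl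
    rw [mem_betaSet_word]
    simp
  rw [BasedPair.joinBasis, Set.mem_ofPred_eq, h2]
  -- The smallest admissible `τ` is the face set itself, and `K` is closed under subsets.
  refine and_congr ⟨?_, fun h => ⟨_, h, fun k hk => ?_⟩⟩ (by omega)
  · rintro ⟨τ, hτ, hlow⟩
    refine K.lower (fun k hk => ?_) hτ
    by_contra hkτ
    exact (h1 k).1 hk (hlow k hkτ)
  · by_contra h0
    exact hk ((h1 k).2 h0)

theorem toWords_apply (x : (∀ k, NormalBasis (G k) (kind k)) → R)
    (e : ∀ k, NormalBasis (G k) (kind k)) :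
    toWords R deg x (gen e) (word e) = x e * unit R deg e := by
  classical
  rw [toWords, Fintype.linearCombination_apply, Finset.sum_apply, Finsupp.finsetSum_apply,
    Finset.sum_eq_single e]
  · simp
  · intro e' _ hne
    by_cases h : gen e = gen e'
    · rw [Pi.smul_apply, h, Pi.single_eq_same, Finsupp.smul_apply, Finsupp.single_apply, if_neg,
        smul_zero]
      intro h2
      exact hne (eq_of_gen_eq_of_word_eq h.symm h2)
    · rw [Pi.smul_apply, Pi.single_eq_of_ne h, smul_zero, Finsupp.zero_apply]
  · intro h
    exact absurd (Finset.mem_univ _) h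

theorem exists_of_toWords_apply_ne_zero {x : (∀ k, NormalBasis (G k) (kind k)) → R}
    {c : ∀ k, G k} {w : Fin m → Letter} (h : toWords R deg x c w ≠ 0) :
    ∃ e, gen e = c ∧ word e = w ∧ x e ≠ 0 := by
  classical
  rw [toWords, Fintype.linearCombination_apply, Finset.sum_apply, Finsupp.finsetSum_apply] at h
  obtain ⟨e, -, he⟩ := Finset.exists_ne_zero_of_sum_ne_zero h
  rw [Pi.smul_apply, Finsupp.smul_apply] at he
  refine ⟨e, ?_, ?_, left_ne_zero_of_smul he⟩
  · by_contra h1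
    rw [Pi.single_eq_of_ne (Ne.symm h1)] at he
    simp at he
  · by_contra h1
    by_cases h2 : c = gen e
    · rw [h2, Pi.single_eq_same, Finsupp.single_apply, if_neg h1, smul_zero] at he
      exact he rfl
    · rw [Pi.single_eq_of_ne h2] at he
      simp at he

theorem toWords_mem (K : SComplex (Fin m)) (n : ℤ)
    {x : (∀ k, NormalBasis (G k) (kind k)) → R}
    (hx : x ∈ supportedOn R
      (BasedPair.joinBasis K (fun k => normalPair R (G k) (kind k) (deg k)) n)) (c : ∀ k, G k) :
    toWords R deg x c ∈ (totalComplex R K {kindIndex fun k => kind k (c k)}).C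
      (n - ∑ k, deg k (c k)) := by
  rw [totalComplex, Finsupp.mem_supported]
  intro w hw
  obtain ⟨e, rfl, rfl, he⟩ := exists_of_toWords_apply_ne_zero (Finsupp.mem_support_iff.1 hw)
  obtain ⟨h1, h2⟩ := (mem_joinBasis_iff K e n).1 (hx e he)
  exact ⟨h1, wordIndex_letterOf _ _, h2⟩

/-- The complex `⋃_{τ ∈ K} Y₁ ⊗ ⋯ ⊗ Yₘ` of normal complexes is a direct sum of shifts of
the summands of the total complex of `K`. -/
noncomputable def wordsRetract (K : SComplex (Fin m)) :
    GradedRetract (BasedPair.joinDiff K fun k => normalPair R (G k) (kind k) (deg k))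
      (GradedDiff.piShift
        (fun c : ∀ k, G k => (totalComplex R K {kindIndex fun k => kind k (c k)}).diff)
        (fun c => ∑ k, deg k (c k))) :=
  GradedRetract.ofBijective
    (fun n => LinearMap.pi fun c => (LinearMap.proj c ∘ₗ toWords R deg).restrict
      (fun _ hx => toWords_mem K n hx c))
    (fun n => by
      constructor
      · rw [injective_iff_map_eq_zero]
        rintro ⟨x, hx⟩ h
        refine Subtype.ext (funext fun e => ?_)
        have h1 : toWords R deg x (gen e) = 0 := congrArg Subtype.val (congrFun h (gen e))
        have h2 := toWords_apply (deg := deg) x e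
        rw [h1, Finsupp.zero_apply] at h2
        calc x e = x e * unit R deg e * unit R deg e := by rw [mul_assoc, unit_mul_unit, mul_one]
          _ = 0 := by rw [← h2, zero_mul]
      · intro y
        -- The coefficients are corrected by the sign, which is its own inverse.
        refine ⟨⟨fun e => (y (gen e)).1 (word e) * unit R deg e, ?_⟩, ?_⟩
        · intro e he
          have := (Finsupp.mem_supported _ _).1 (y (gen e)).2
            (Finsupp.mem_support_iff.2 (left_ne_zero_of_mul he))
          exact (mem_joinBasis_iff K e n).2 ⟨this.1, this.2.2⟩
        · refine funext fun c => Subtype.ext (Finsupp.ext fun w => ?_)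
          change toWords R deg _ c w = (y c).1 w
          by_cases hw : ∃ e : ∀ k, NormalBasis (G k) (kind k), gen e = c ∧ word e = w
          · obtain ⟨e, rfl, rfl⟩ := hw
            refine (toWords_apply _ e).trans ?_
            change (y (gen e)).1 (word e) * unit R deg e * unit R deg e = _
            rw [mul_assoc, unit_mul_unit, mul_one]
          · rw [not_exists] at hw
            trans 0
            · by_contra h
              obtain ⟨e, h1, h2, -⟩ := exists_of_toWords_apply_ne_zero h
              exact hw e ⟨h1, h2⟩
            · by_contra h
              have := (Finsupp.mem_supported _ _).1 (y c).2
                (Finsupp.mem_support_iff.2 (Ne.symm h))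
              obtain ⟨b, hb, rfl⟩ := exists_letterOf _ _ this.2.1
              exact hw (fun k => ⟨c k, b k, hb k⟩) ⟨rfl, rfl⟩)
    (fun i j hij => LinearMap.ext fun x => funext fun c => Subtype.ext
      (congrFun (toWords_tensorD x.1) c))

end normalPair

end Normal

/-! ### Bases of quotients of submodules -/

section RelBasis

variable {R : Type u} [CommRing R] {M M' : Type*} [AddCommGroup M] [Module R M]
  [AddCommGroup M'] [Module R M']

/-- The family `v` of elements of `Q` maps to a basis of `Q / P`. -/
structure RelBasis {κ : Type*} (P Q : Submodule R M) (v : κ → M) : Prop where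
  le : P ≤ Q
  mem : ∀ k, v k ∈ Q
  indep : ∀ c : κ →₀ R, Finsupp.linearCombination R v c ∈ P → c = 0
  span : Q ≤ P ⊔ Submodule.span R (Set.range v)

theorem linearCombination_mem {κ : Type*} {Q : Submodule R M} {v : κ → M} (h : ∀ k, v k ∈ Q)
    (c : κ →₀ R) : Finsupp.linearCombination R v c ∈ Q := by
  rw [Finsupp.linearCombination_apply]
  exact Submodule.sum_mem _ fun k _ => Submodule.smul_mem _ _ (h k)

namespace RelBasis

variable {κ κ' : Type*} {P Q T : Submodule R M} {v : κ → M} {w : κ' → M}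

/-- Lifted bases of the successive quotients of `P ≤ Q ≤ T` together give one of `T / P`; a relation
is first read modulo `Q`. -/
theorem append (hv : RelBasis P Q v) (hw : RelBasis Q T w) : RelBasis P T (Sum.elim v w) where
  le := hv.le.trans hw.le
  mem := by
    rintro (k | k)
    · exact hw.le (hv.mem k)
    · exact hw.mem k
  indep c hc := by
    obtain ⟨⟨a, b⟩, rfl⟩ := Finsupp.sumFinsuppEquivProdFinsupp.symm.surjective c
    have e : Finsupp.linearCombination R (Sum.elim v w)
        (Finsupp.sumFinsuppEquivProdFinsupp.symm (a, b)) =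
        Finsupp.linearCombination R v a + Finsupp.linearCombination R w b := by
      rw [Finsupp.linearCombination_apply, Finsupp.linearCombination_apply,
        Finsupp.linearCombination_apply]
      exact Finsupp.sum_sumElim _ _ _
    rw [e] at hc
    have hb : b = 0 := by
      refine hw.indep b ?_
      have := Q.sub_mem (hv.le hc) (linearCombination_mem hv.mem a)
      rwa [add_sub_cancel_left] at this
    subst hb
    rw [map_zero, add_zero] at hc
    rw [hv.indep a hc]
    ext (i | i) <;> simp
  span := by
    rw [Set.Sum.elim_range, Submodule.span_union, ← sup_assoc]
    exact hw.span.trans (sup_le_sup_right hv.span _)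

/-- The map `g` induces an isomorphism from `T / N` to `Q / P`: `N` is the preimage of `P` in `T`,
and the `u k` hit a basis. Applied with `g = d`, this supplies the chains `top`, `top'` and `u`. -/
theorem lift (hv : RelBasis P Q v) (g : M' →ₗ[R] M) {N T : Submodule R M'} {u : κ → M'}
    (hu : ∀ k, u k ∈ T) (hgu : ∀ k, g (u k) = v k) (hT : ∀ t ∈ T, g t ∈ Q) (hNT : N ≤ T)
    (hN : ∀ t ∈ T, t ∈ N ↔ g t ∈ P) : RelBasis N T u where
  le := hNT
  mem := hu
  indep c hc := by
    refine hv.indep c ?_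
    have h := (hN _ (hNT hc)).1 hc
    rw [Finsupp.apply_linearCombination] at h
    rwa [← (funext hgu : g ∘ u = v)]
  span := by
    intro t ht
    obtain ⟨p, hp, y, hy, hpy⟩ := Submodule.mem_sup.1 (hv.span (hT t ht))
    obtain ⟨c, rfl⟩ := (Finsupp.mem_span_range_iff_exists_finsupp).1 hy
    have hc : (c.sum fun i a => a • v i) = g (Finsupp.linearCombination R u c) := by
      rw [Finsupp.apply_linearCombination, (funext hgu : g ∘ u = v),
        Finsupp.linearCombination_apply]
    have hmem : t - Finsupp.linearCombination R u c ∈ T :=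
      T.sub_mem ht (linearCombination_mem hu c)
    have hN' : t - Finsupp.linearCombination R u c ∈ N := by
      rw [hN _ hmem, map_sub, ← hpy, hc, add_sub_cancel_right]
      exact hp
    rw [← sub_add_cancel t (Finsupp.linearCombination R u c)]
    exact Submodule.add_mem_sup hN' (Finsupp.mem_span_range_iff_exists_finsupp.2
      ⟨c, (Finsupp.linearCombination_apply R c).symm⟩)

/-- The second isomorphism theorem: for `B ≤ C`, `C / ((A ⊓ C) ⊔ B)` is `(A ⊔ C) / (A ⊔ B)`. -/
theorem sup_left {A B C : Submodule R M} (hBC : B ≤ C) (hv : RelBasis ((A ⊓ C) ⊔ B) C v) :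
    RelBasis (A ⊔ B) (A ⊔ C) v where
  le := sup_le_sup_left hBC _
  mem k := Submodule.mem_sup_right (hv.mem k)
  indep c hc := by
    refine hv.indep c ?_
    obtain ⟨a, ha, b, hb, hab⟩ := Submodule.mem_sup.1 hc
    rw [← hab]
    refine Submodule.add_mem_sup ⟨ha, ?_⟩ hb
    rw [eq_sub_of_add_eq hab]
    exact C.sub_mem (linearCombination_mem hv.mem c) (hBC hb)
  span := by
    refine sup_le ?_ (hv.span.trans ?_)
    · rw [sup_assoc]
      exact le_sup_left
    · exact sup_le_sup_right (sup_le_sup_right inf_le_left _) _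

end RelBasis

end RelBasis

/-! ### Homogeneous submodules of a graded free module -/

section Homogeneous

variable {R : Type u} [CommRing R] {σ : Type*} (deg : σ → ℤ)

/-- The part of degree `n` of the free module on a graded set. -/
def degPart (R : Type u) [CommRing R] (n : ℤ) : Submodule R (σ →₀ R) :=
  Finsupp.supported R R {s | deg s = n}

/-- The projection to the part of degree `n`. -/
noncomputable def degProj (R : Type u) [CommRing R] (n : ℤ) : (σ →₀ R) →ₗ[R] (σ →₀ R) where
  toFun x := x.filter fun s => deg s = n
  map_add' _ _ := Finsupp.filter_add
  map_smul' _ _ := Finsupp.filter_smul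

variable {deg}

theorem degProj_mem (n : ℤ) (x : σ →₀ R) : degProj deg R n x ∈ degPart deg R n := by
  rw [degPart, Finsupp.mem_supported]
  intro s hs
  have h : ¬ x s = 0 ∧ deg s = n := by simpa [degProj] using hs
  exact h.2

theorem degProj_of_mem {n : ℤ} {x : σ →₀ R} (hx : x ∈ degPart deg R n) :
    degProj deg R n x = x := by
  refine Finsupp.filter_eq_self_iff _ _ |>.2 fun s hs => ?_
  exact (Finsupp.mem_supported _ _).1 hx (Finsupp.mem_support_iff.2 hs)

theorem degProj_of_mem_ne {n n' : ℤ} (hn : n' ≠ n) {x : σ →₀ R} (hx : x ∈ degPart deg R n') :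
    degProj deg R n x = 0 := by
  refine Finsupp.filter_eq_zero_iff _ _ |>.2 fun s hs => ?_
  by_contra h
  exact hn (((Finsupp.mem_supported _ _).1 hx (Finsupp.mem_support_iff.2 h)).symm.trans hs)

theorem sum_degProj (x : σ →₀ R) :
    ∑ n ∈ x.support.image deg, degProj deg R n x = x := by
  ext s
  rw [Finsupp.finsetSum_apply]
  have e : ∀ n, degProj deg R n x s = if deg s = n then x s else 0 := fun n =>
    Finsupp.filter_apply _ _ _
  simp only [e]
  by_cases hs : x s = 0
  · simp [hs]
  · rw [Finset.sum_ite_eq, if_pos (Finset.mem_image_of_mem _ (Finsupp.mem_support_iff.2 hs))]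

/-- A submodule containing the homogeneous components of its elements. -/
def IsHomogeneousSubmodule (deg : σ → ℤ) (P : Submodule R (σ →₀ R)) : Prop :=
  ∀ n, ∀ x ∈ P, degProj deg R n x ∈ P

theorem IsHomogeneousSubmodule.inf {P Q : Submodule R (σ →₀ R)}
    (hP : IsHomogeneousSubmodule deg P) (hQ : IsHomogeneousSubmodule deg Q) :
    IsHomogeneousSubmodule deg (P ⊓ Q) := fun n x hx => ⟨hP n x hx.1, hQ n x hx.2⟩

theorem IsHomogeneousSubmodule.sup {P Q : Submodule R (σ →₀ R)}
    (hP : IsHomogeneousSubmodule deg P) (hQ : IsHomogeneousSubmodule deg Q) :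
    IsHomogeneousSubmodule deg (P ⊔ Q) := fun n x hx => by
  obtain ⟨p, hp, q, hq, rfl⟩ := Submodule.mem_sup.1 hx
  rw [map_add]
  exact Submodule.add_mem_sup (hP n p hp) (hQ n q hq)

theorem isHomogeneousSubmodule_bot :
    IsHomogeneousSubmodule deg (⊥ : Submodule R (σ →₀ R)) := fun n x hx => by
  rw [Submodule.mem_bot] at hx ⊢
  rw [hx, map_zero]

theorem isHomogeneousSubmodule_supported (s : Set σ) :
    IsHomogeneousSubmodule deg (Finsupp.supported R R s) := fun n x hx => by
  rw [Finsupp.mem_supported] at hx ⊢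
  refine Set.Subset.trans (fun t ht => ?_) hx
  have h : ¬ x t = 0 ∧ deg t = n := by simpa [degProj] using ht
  exact Finsupp.mem_support_iff.2 h.1

section Diff

variable {d : (σ →₀ R) →ₗ[R] (σ →₀ R)}

theorem degProj_comm (hd : ∀ n, ∀ x ∈ degPart deg R n, d x ∈ degPart deg R (n + -1)) (n : ℤ)
    (x : σ →₀ R) : degProj deg R n (d x) = d (degProj deg R (n + 1) x) := by
  suffices h : degProj deg R n ∘ₗ d = d ∘ₗ degProj deg R (n + 1) from LinearMap.congr_fun h x
  refine Finsupp.lhom_ext fun s r => ?_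
  rw [LinearMap.comp_apply, LinearMap.comp_apply]
  have hs : Finsupp.single s r ∈ degPart deg R (deg s) := Finsupp.single_mem_supported R r rfl
  by_cases h : deg s = n + 1
  · rw [degProj_of_mem (n := n + 1) (h ▸ hs), degProj_of_mem]
    have := hd _ _ hs
    rwa [h, add_neg_cancel_right] at this
  · rw [degProj_of_mem_ne h hs, map_zero]
    exact degProj_of_mem_ne (by omega) (hd _ _ hs)

theorem IsHomogeneousSubmodule.map
    (hd : ∀ n, ∀ x ∈ degPart deg R n, d x ∈ degPart deg R (n + -1))
    {P : Submodule R (σ →₀ R)} (hP : IsHomogeneousSubmodule deg P) :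
    IsHomogeneousSubmodule deg (P.map d) := by
  rintro n _ ⟨x, hx, rfl⟩
  exact ⟨_, hP (n + 1) x hx, (degProj_comm hd n x).symm⟩

theorem isHomogeneousSubmodule_ker
    (hd : ∀ n, ∀ x ∈ degPart deg R n, d x ∈ degPart deg R (n + -1)) :
    IsHomogeneousSubmodule deg (LinearMap.ker d) := fun n x hx => by
  rw [LinearMap.mem_ker] at hx ⊢
  obtain ⟨k, rfl⟩ : ∃ k, n = k + 1 := ⟨n - 1, by omega⟩
  rw [← degProj_comm hd, hx, map_zero]

end Diff

/-- The free modules `N n` are models of the degree `n` parts of `Q / P`. A basis of each is lifted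
to homogeneous elements of `Q`; the index records degree and position, so that the generators
obtained later are counted by ranks of homology groups. -/
theorem exists_homogeneous_relBasis [Nontrivial R] {P Q : Submodule R (σ →₀ R)} (hPQ : P ≤ Q)
    (hP : IsHomogeneousSubmodule deg P) (hQ : IsHomogeneousSubmodule deg Q) (N : ℤ → Type*)
    [∀ n, AddCommGroup (N n)] [∀ n, Module R (N n)] [∀ n, Module.Free R (N n)]
    [∀ n, Module.Finite R (N n)] (f : ∀ n, ↥(Q ⊓ degPart deg R n) →ₗ[R] N n)
    (hf : ∀ n, Function.Surjective (f n)) (hker : ∀ n x, f n x = 0 ↔ (x : σ →₀ R) ∈ P) :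
    ∃ v : (Σ n : ℤ, Fin (Module.finrank R (N n))) → (σ →₀ R),
      (∀ k, v k ∈ degPart deg R k.1) ∧ RelBasis P Q v := by
  let b : ∀ n, Module.Basis (Fin (Module.finrank R (N n))) R (N n) :=
    fun n => Module.finBasis R (N n)
  have hb : ∀ n (i : Fin (Module.finrank R (N n))), ∃ y, f n y = b n i := fun n i => hf n _
  choose v' hv' using hb
  have hinj : ∀ n : ℤ, Function.Injective (β := Σ n : ℤ, Fin (Module.finrank R (N n)))
      fun i : Fin (Module.finrank R (N n)) => ⟨n, i⟩ :=
    fun n i j h => eq_of_heq (Sigma.mk.inj h).2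
  let rs : ∀ n : ℤ, ((Σ n : ℤ, Fin (Module.finrank R (N n))) →₀ R) →ₗ[R]
      (Fin (Module.finrank R (N n)) →₀ R) := fun n => Finsupp.lcomapDomain _ (hinj n)
  have hcomp : ∀ n, f n ∘ v' n = b n := fun n => funext fun i => hv' n i
  have hlc : ∀ n (a : Fin (Module.finrank R (N n)) →₀ R),
      Finsupp.linearCombination R (fun i => (v' n i : σ →₀ R)) a =
        (Finsupp.linearCombination R (v' n) a : ↥(Q ⊓ degPart deg R n)) := fun n a =>
    (Finsupp.apply_linearCombination R (Q ⊓ degPart deg R n).subtype (v' n) a).symm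
  refine ⟨fun k => v' k.1 k.2, fun k => (v' k.1 k.2).2.2, hPQ, fun k => (v' k.1 k.2).2.1,
    fun c hc => ?_, fun x hx => ?_⟩
  -- Only the generators of degree `n` contribute to the component of degree `n`.
  · have hproj : ∀ n, degProj deg R n
        (Finsupp.linearCombination R (fun k : Σ n : ℤ, Fin (Module.finrank R (N n)) =>
          (v' k.1 k.2 : σ →₀ R)) c) =
        Finsupp.linearCombination R (fun i => (v' n i : σ →₀ R))
          (rs n c) := by
      intro n
      suffices h : degProj deg R n ∘ₗ
          Finsupp.linearCombination R (fun k : Σ n : ℤ, Fin (Module.finrank R (N n)) =>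
            (v' k.1 k.2 : σ →₀ R)) =
          Finsupp.linearCombination R (fun i => (v' n i : σ →₀ R)) ∘ₗ
            rs n from LinearMap.congr_fun h c
      refine Finsupp.lhom_ext fun k r => ?_
      obtain ⟨n', i⟩ := k
      rw [LinearMap.comp_apply, LinearMap.comp_apply, Finsupp.linearCombination_single, map_smul]
      by_cases h : n' = n
      · subst h
        rw [degProj_of_mem (v' n' i).2.2]
        have : rs n'
            (Finsupp.single (⟨n', i⟩ : Σ n : ℤ, Fin (Module.finrank R (N n))) r) =
            Finsupp.single i r := Finsupp.comapDomain_single _ _ _ _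
        rw [this, Finsupp.linearCombination_single]
      · rw [degProj_of_mem_ne h (v' n' i).2.2, smul_zero]
        have : (rs n)
            (Finsupp.single (⟨n', i⟩ : Σ n : ℤ, Fin (Module.finrank R (N n))) r) = 0 := by
          ext j
          refine Finsupp.single_eq_of_ne fun h' => h ?_
          exact (congrArg Sigma.fst h').symm
        rw [this, map_zero]
    ext ⟨n, i⟩
    -- Since `P` is homogeneous, `f n` kills the degree `n` component of the relation, giving a
    -- relation among the basis vectors `b n`.
    have h1 := hP n _ hc
    rw [hproj, hlc, ← hker, Finsupp.apply_linearCombination, hcomp] at h1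
    have h2 := linearIndependent_iff.1 (b n).linearIndependent _ h1
    exact DFunLike.congr_fun h2 i
  · rw [← sum_degProj (deg := deg) x]
    refine Submodule.sum_mem _ fun n _ => ?_
    set y : ↥(Q ⊓ degPart deg R n) := ⟨degProj deg R n x, hQ n x hx, degProj_mem n x⟩
    have h1 := (b n).linearCombination_repr (f n y)
    rw [← hcomp, ← Finsupp.apply_linearCombination, ← sub_eq_zero, ← map_sub, hker] at h1
    have h2 : (y : σ →₀ R) = -((Finsupp.linearCombination R (v' n) ((b n).repr (f n y)) - y :
        ↥(Q ⊓ degPart deg R n)) : σ →₀ R) +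
        Finsupp.linearCombination R (fun i => (v' n i : σ →₀ R)) ((b n).repr (f n y)) := by
      rw [hlc, Submodule.coe_sub]
      abel
    change (y : σ →₀ R) ∈ _
    rw [h2]
    refine Submodule.add_mem_sup (P.neg_mem h1) (linearCombination_mem (fun i => ?_) _)
    exact Submodule.subset_span ⟨⟨n, i⟩, rfl⟩

end Homogeneous

/-! ### The normal form of a complex with a subcomplex -/

section NormalForm

variable {R : Type u} [CommRing R] {σ : Type} {deg : σ → ℤ} {d : (σ →₀ R) →ₗ[R] (σ →₀ R)}

/-- A homogeneous basis of the free module on `sF`, adapted to the free module on `sE`, in which the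
differential is in normal form. -/
structure NormalFamily (deg : σ → ℤ) (d : (σ →₀ R) →ₗ[R] (σ →₀ R)) (sE sF : Set σ) (J J' : Type)
    (K : PointIndex → Type) where
  jdeg : J → ℤ
  jdeg' : J' → ℤ
  kdeg : ∀ s, K s → ℤ
  bot : J → (σ →₀ R)
  top : J → (σ →₀ R)
  bot' : J' → (σ →₀ R)
  top' : J' → (σ →₀ R)
  z : ∀ s, K s → (σ →₀ R)
  u : K .inOmega → (σ →₀ R)
  bot_deg : ∀ j, bot j ∈ degPart deg R (jdeg j)
  top_deg : ∀ j, top j ∈ degPart deg R (jdeg j + 1)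
  bot_deg' : ∀ j, bot' j ∈ degPart deg R (jdeg' j)
  top_deg' : ∀ j, top' j ∈ degPart deg R (jdeg' j + 1)
  z_deg : ∀ s k, z s k ∈ degPart deg R (kdeg s k)
  u_deg : ∀ k, u k ∈ degPart deg R (kdeg _ k + 1)
  d_bot : ∀ j, d (bot j) = 0
  d_top : ∀ j, d (top j) = bot j
  d_bot' : ∀ j, d (bot' j) = 0
  d_top' : ∀ j, d (top' j) = bot' j
  d_z : ∀ s k, d (z s k) = 0
  d_u : ∀ k, d (u k) = z _ k
  relE : RelBasis ⊥ (Finsupp.supported R R sE)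
    (Sum.elim (Sum.elim (Sum.elim bot (z .inOmega)) (z .neither)) top)
  relF : RelBasis (Finsupp.supported R R sE) (Finsupp.supported R R sF)
    (Sum.elim (Sum.elim (Sum.elim bot' (z .inSigma)) u) top')

theorem exists_homogeneous_preimage
    (hdeg : ∀ n, ∀ x ∈ degPart deg R n, d x ∈ degPart deg R (n + -1))
    {P : Submodule R (σ →₀ R)} (hP : IsHomogeneousSubmodule deg P) {n : ℤ} {y : σ →₀ R}
    (hy : y ∈ degPart deg R n) (hyP : y ∈ P.map d) :
    ∃ x ∈ P, x ∈ degPart deg R (n + 1) ∧ d x = y := by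
  obtain ⟨x, hx, rfl⟩ := hyP
  exact ⟨_, hP (n + 1) x hx, degProj_mem _ _, by rw [← degProj_comm hdeg, degProj_of_mem hy]⟩

/-- Write `Z` for the kernel of `d`. The subcomplex is filtered by `0 ≤ dE ≤ E ∩ dF ≤ E ∩ Z ≤ E`.
The two middle quotients are the kernel and the image of the map on homology, and `d` carries the
last quotient onto `dE`. Above it one uses `E ≤ E + dF ≤ E + (F ∩ Z) ≤ F ∩ d⁻¹E ≤ F`: the first
quotient is `dF / (E ∩ dF)`, the second is the cokernel, and `d` identifies the third with `(E ∩ dF)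
/ dE` and the fourth with `(E + dF) / E`. Hence bases of the quotients already treated can be lifted
along `d`, and all basis vectors are concatenated with `RelBasis.append`. -/
theorem exists_normalFamily [IsDomain R] [IsPrincipalIdealRing R] [Finite σ]
    (hdd : ∀ x, d (d x) = 0)
    (hdeg : ∀ n, ∀ x ∈ degPart deg R n, d x ∈ degPart deg R (n + -1)) {sE sF : Set σ}
    (hEF : sE ⊆ sF) {E F : Submodule R (σ →₀ R)}
    (hEdef : E = Finsupp.supported R R sE) (hFdef : F = Finsupp.supported R R sF) (hE : ∀ x ∈ E, d x ∈ E)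
    (hF : ∀ x ∈ F, d x ∈ F)
    (N : PointIndex → ℤ → Type u) [∀ s n, AddCommGroup (N s n)] [∀ s n, Module R (N s n)]
    [∀ s n, Module.Free R (N s n)] [∀ s n, Module.Finite R (N s n)]
    (fω : ∀ n, ↥(E ⊓ (F).map d ⊓ degPart deg R n)
      →ₗ[R] N .inOmega n) (fω_surj : ∀ n, Function.Surjective (fω n))
    (fω_ker : ∀ n x, fω n x = 0 ↔ (x : σ →₀ R) ∈ (E).map d)
    (fη : ∀ n, ↥(E ⊓ LinearMap.ker d ⊓ degPart deg R n)
      →ₗ[R] N .neither n) (fη_surj : ∀ n, Function.Surjective (fη n))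
    (fη_ker : ∀ n x, fη n x = 0 ↔
      (x : σ →₀ R) ∈ E ⊓ (F).map d)
    (fα : ∀ n, ↥(F ⊓ LinearMap.ker d ⊓ degPart deg R n)
      →ₗ[R] N .inSigma n) (fα_surj : ∀ n, Function.Surjective (fα n))
    (fα_ker : ∀ n x, fα n x = 0 ↔ (x : σ →₀ R) ∈
      E ⊓ (F ⊓ LinearMap.ker d) ⊔
        (F).map d) :
    ∃ (J J' : Type) (F : NormalFamily (R := R) deg d sE sF J J'
      fun s => Σ n : ℤ, Fin (Module.finrank R (N s n))), ∀ s k, F.kdeg s k = k.1 := by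
  classical
  have hEFle : E ≤ F := by
    rw [hEdef, hFdef]
    exact Finsupp.supported_mono hEF
  have homE : IsHomogeneousSubmodule deg E := hEdef ▸ isHomogeneousSubmodule_supported sE
  have homF : IsHomogeneousSubmodule deg F := hFdef ▸ isHomogeneousSubmodule_supported sF
  have homK : IsHomogeneousSubmodule deg (LinearMap.ker d) := isHomogeneousSubmodule_ker hdeg
  have homdE := homE.map hdeg
  have homdF := homF.map hdeg
  have dE_le : E.map d ≤ E ⊓ F.map d := by
    rintro _ ⟨x, hx, rfl⟩
    exact ⟨hE x hx, ⟨x, hEFle hx, rfl⟩⟩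
  have dF_le : F.map d ≤ F ⊓ LinearMap.ker d := by
    rintro _ ⟨x, hx, rfl⟩
    exact ⟨hF x hx, hdd x⟩
  -- The homogeneous parts of `dE` are free, being submodules of a finite free module over a
  -- principal ideal domain.
  obtain ⟨v1, v1deg, R1⟩ := exists_homogeneous_relBasis (deg := deg) (bot_le : ⊥ ≤ E.map d)
    isHomogeneousSubmodule_bot homdE (fun n => ↥(E.map d ⊓ degPart deg R n))
    (fun n => LinearMap.id) (fun n => Function.surjective_id) (fun n x => by
      rw [LinearMap.id_apply, Submodule.mem_bot, Submodule.coe_eq_zero])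
  obtain ⟨v2, v2deg, R2⟩ := exists_homogeneous_relBasis dE_le homdE (homE.inf homdF)
    (N .inOmega) fω fω_surj fω_ker
  obtain ⟨v3, v3deg, R3⟩ := exists_homogeneous_relBasis
    (inf_le_inf_left E (dF_le.trans inf_le_right)) (homE.inf homdF) (homE.inf homK)
    (N .neither) fη fη_surj fη_ker
  obtain ⟨v5, v5deg, R5⟩ := exists_homogeneous_relBasis (P := E ⊓ (F ⊓ LinearMap.ker d) ⊔ F.map d)
    (sup_le inf_le_right dF_le) ((homE.inf (homF.inf homK)).sup homdF) (homF.inf homK)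
    (N .inSigma) fα fα_surj fα_ker
  -- The projection along `E`. It embeds `dF / (E ∩ dF)` into a free module, which makes that
  -- quotient free.
  let g : (σ →₀ R) →ₗ[R] (σ →₀ R) :=
    { toFun := fun x => x.filter fun s => s ∉ sE
      map_add' := fun _ _ => Finsupp.filter_add
      map_smul' := fun _ _ => Finsupp.filter_smul }
  have hg : ∀ x, g x = 0 ↔ x ∈ E := fun x => by
    refine (Finsupp.filter_eq_zero_iff _ _).trans ?_
    rw [hEdef, Finsupp.mem_supported]
    constructor
    · intro h s hs
      by_contra h'
      exact Finsupp.mem_support_iff.1 hs (h s h')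
    · intro h s hs
      by_contra h'
      exact hs (h (Finsupp.mem_support_iff.2 h'))
  -- The superfluous `⊔ ⊥` brings the denominator into the form required by `RelBasis.sup_left`.
  obtain ⟨v4, v4deg, R4⟩ := exists_homogeneous_relBasis (P := E ⊓ F.map d ⊔ ⊥) (Q := F.map d)
    (sup_le inf_le_right bot_le) ((homE.inf homdF).sup isHomogeneousSubmodule_bot) homdF
    (fun n => LinearMap.range (g ∘ₗ (F.map d ⊓ degPart deg R n).subtype))
    (fun n => LinearMap.rangeRestrict _) (fun n => LinearMap.surjective_rangeRestrict _)
    (fun n x => by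
      rw [← Submodule.coe_eq_zero, sup_bot_eq]
      refine (hg x).trans ⟨fun h => ⟨h, x.2.1⟩, fun h => h.1⟩)
  choose u1 u1E u1deg u1d using fun k => exists_homogeneous_preimage hdeg homE (v1deg k) (R1.mem k)
  choose u2 u2F u2deg u2d using fun k =>
    exists_homogeneous_preimage hdeg homF (v2deg k) (R2.mem k).2
  choose u4 u4F u4deg u4d using fun k => exists_homogeneous_preimage hdeg homF (v4deg k) (R4.mem k)
  have S1 : RelBasis (E ⊓ LinearMap.ker d) E u1 :=
    R1.lift d u1E u1d (fun t ht => ⟨t, ht, rfl⟩) inf_le_left fun t ht =>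
      ⟨fun h => h.2, fun h => ⟨ht, h⟩⟩
  have S4 : RelBasis E (E ⊔ F.map d) v4 := by
    have := R4.sup_left bot_le
    rwa [sup_bot_eq] at this
  have S5 : RelBasis (E ⊔ F.map d) (E ⊔ F ⊓ LinearMap.ker d) v5 := R5.sup_left dF_le
  -- Modulo `E + (F ∩ Z)`, a chain of `F` with boundary in `E` is determined by this boundary modulo
  -- `dE`.
  have S2 : RelBasis (E ⊔ F ⊓ LinearMap.ker d) (F ⊓ E.comap d) u2 := by
    refine R2.lift d (fun k => ⟨u2F k, ?_⟩) u2d (fun t ht => ⟨ht.2, t, ht.1, rfl⟩) ?_ ?_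
    · change d (u2 k) ∈ E
      rw [u2d]
      exact (R2.mem k).1
    · refine sup_le (le_inf hEFle fun x hx => hE x hx) (le_inf inf_le_left fun x hx => ?_)
      rw [Submodule.mem_comap, LinearMap.mem_ker.1 hx.2]
      exact E.zero_mem
    · intro t ht
      constructor
      · intro h
        obtain ⟨e, he, z, hz, rfl⟩ := Submodule.mem_sup.1 h
        rw [map_add, LinearMap.mem_ker.1 hz.2, add_zero]
        exact ⟨e, he, rfl⟩
      · rintro ⟨e, he, hde⟩
        -- If `d t = d e` with `e ∈ E`, then `t` is `e` plus the cycle `t - e`.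
        rw [← add_sub_cancel e t]
        refine Submodule.add_mem_sup he ⟨F.sub_mem ht.1 (hEFle he), ?_⟩
        change d (t - e) = 0
        rw [map_sub, hde, sub_self]
  have S6 : RelBasis (F ⊓ E.comap d) F u4 :=
    S4.lift d u4F u4d (fun t ht => Submodule.mem_sup_right ⟨t, ht, rfl⟩) inf_le_left fun t ht =>
      ⟨fun h => h.2, fun h => ⟨ht, h⟩⟩
  refine ⟨_, _,
    { jdeg := fun k => k.1
      jdeg' := fun k => k.1
      kdeg := fun s k => k.1
      bot := v1
      top := u1
      bot' := v4
      top' := u4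
      z := fun s => match s with
        | .inOmega => v2
        | .neither => v3
        | .inSigma => v5
      u := u2
      bot_deg := v1deg
      top_deg := u1deg
      bot_deg' := v4deg
      top_deg' := u4deg
      z_deg := fun s => match s with
        | .inOmega => v2deg
        | .neither => v3deg
        | .inSigma => v5deg
      u_deg := u2deg
      d_bot := fun j => by rw [← u1d, hdd]
      d_top := u1d
      d_bot' := fun j => by rw [← u4d, hdd]
      d_top' := u4d
      d_z := fun s => match s with
        | .inOmega => fun j => by
            change d (v2 j) = 0
            rw [← u2d, hdd]
        | .neither => fun j => LinearMap.mem_ker.1 (R3.mem j).2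
        | .inSigma => fun j => LinearMap.mem_ker.1 (R5.mem j).2
      d_u := u2d
      relE := hEdef ▸ ((R1.append R2).append R3).append S1
      relF := hEdef ▸ hFdef ▸ ((S4.append S5).append S2).append S6 }, fun s k => rfl⟩

/-- The based pair of the free modules on `sE ⊆ sF`. -/
noncomputable def supportedPair [Finite σ] (deg : σ → ℤ) (d : (σ →₀ R) →ₗ[R] (σ →₀ R))
    (hdeg : ∀ n, ∀ x ∈ degPart deg R n, d x ∈ degPart deg R (n + -1)) (sE sF : Set σ)
    (hE : ∀ x ∈ Finsupp.supported R R sE, d x ∈ Finsupp.supported R R sE) : BasedPair R where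
  B := sF
  fintype := Fintype.ofFinite _
  decEq := Classical.decEq _
  deg s := deg s.1
  low s := s.1 ∈ sE
  d y x := d (Finsupp.single x.1 1) y.1
  d_deg x _ h := (Finsupp.mem_supported _ _).1
    (hdeg (deg x) _ (Finsupp.single_mem_supported R 1 rfl)) (Finsupp.mem_support_iff.2 h)
  d_low _ _ h hx := (Finsupp.mem_supported _ _).1
    (hE _ (Finsupp.single_mem_supported R 1 hx)) (Finsupp.mem_support_iff.2 h)

end NormalForm

instance : Finite PointIndex :=
  Finite.of_injective (fun s : PointIndex => match s with
    | .neither => (0 : Fin 3)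
    | .inOmega => 1
    | .inSigma => 2) (by rintro (_ | _ | _) (_ | _ | _) h <;> first | rfl | simp at h)

/-! ### Contracting the acyclic pairs of a normal basis -/

section Retract

variable {R : Type u} [CommRing R] {σ : Type} {deg : σ → ℤ} {d : (σ →₀ R) →ₗ[R] (σ →₀ R)}

/-- Transfers a support condition from the basis `b`, where `L` is known, to the standard basis, in
which degree and subcomplex of a based pair are recorded. -/
theorem toMatrix'_ne_zero {S T I : Type*} [Fintype S] [DecidableEq S] [Fintype T]
    (L : (S → R) →ₗ[R] (T → R)) (b : I → (S → R)) {I₀ : Set I} {t : Set T} {s : S} {y : T}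
    (hs : Pi.single s 1 ∈ Submodule.span R (b '' I₀)) (hL : ∀ i ∈ I₀, L (b i) ∈ supportedOn R t)
    (h : LinearMap.toMatrix' L y s ≠ 0) : y ∈ t := by
  have h1 : Submodule.span R (b '' I₀) ≤ (supportedOn R t).comap L := by
    rw [Submodule.span_le]
    rintro _ ⟨i, hi, rfl⟩
    exact hL i hi
  rw [LinearMap.toMatrix'_apply] at h
  refine h1 hs y ?_
  convert h using 3

/-- A deformation retraction of based complexes given in terms of a basis of the big complex. -/
noncomputable def BasedRetract.ofBasis {P Q : BasedPair R} {I : Type} (b : Module.Basis I R (P.B → R))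
    (bdeg : I → ℤ) (blow : Set I) (g : Q.B → I) (t : I → (Q.B → R)) (h d' : I → (P.B → R))
    (b_deg : ∀ i, b i ∈ supportedOn R {s | P.deg s = bdeg i})
    (b_low : ∀ i ∈ blow, b i ∈ supportedOn R {s | P.low s})
    (single_deg : ∀ s, Pi.single s (1 : R) ∈ Submodule.span R (b '' {i | bdeg i = P.deg s}))
    (single_low : ∀ s, P.low s → Pi.single s (1 : R) ∈ Submodule.span R (b '' blow))
    (t_deg : ∀ i, t i ∈ supportedOn R {x | Q.deg x = bdeg i})
    (t_low : ∀ i ∈ blow, t i ∈ supportedOn R {x | Q.low x})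
    (h_deg : ∀ i, h i ∈ supportedOn R {s | P.deg s = bdeg i + 1})
    (h_low : ∀ i ∈ blow, h i ∈ supportedOn R {s | P.low s})
    (g_deg : ∀ x, bdeg (g x) = Q.deg x) (g_low : ∀ x, Q.low x → g x ∈ blow)
    (t_g : ∀ x, t (g x) = Pi.single x 1)
    (d_b : ∀ i, P.d.mulVecLin (b i) = d' i)
    (d_t : ∀ i, Q.d.mulVecLin (t i) = b.constr R t (d' i))
    (d_g : ∀ x, d' (g x) = Fintype.linearCombination R (b ∘ g) (Q.d.mulVecLin (Pi.single x 1)))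
    (hom : ∀ i, Fintype.linearCombination R (b ∘ g) (t i) + P.d.mulVecLin (h i) +
      b.constr R h (d' i) = b i) : BasedRetract P Q where
  φ := LinearMap.toMatrix' (Fintype.linearCombination R (b ∘ g))
  ψ := LinearMap.toMatrix' (b.constr R t)
  h := LinearMap.toMatrix' (b.constr R h)
  φ_supp x y hxy := by
    rw [LinearMap.toMatrix'_apply] at hxy
    have e : Fintype.linearCombination R (b ∘ g) (Pi.single x 1) = b (g x) := by
      rw [Fintype.linearCombination_apply_single, one_smul]
      rfl
    rw [e] at hxy
    exact ⟨(b_deg (g x) y hxy).trans (g_deg x), fun hx => b_low _ (g_low x hx) y hxy⟩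
  ψ_supp x y hxy :=
    ⟨toMatrix'_ne_zero _ b (t := {y | Q.deg y = P.deg x}) (single_deg x) (fun i hi => by
        rw [b.constr_basis]
        exact (show bdeg i = P.deg x from hi) ▸ t_deg i) hxy,
      fun hx => toMatrix'_ne_zero _ b (t := {y | Q.low y}) (single_low x hx) (fun i hi => by
        rw [b.constr_basis]
        exact t_low i hi) hxy⟩
  h_supp x y hxy :=
    ⟨toMatrix'_ne_zero _ b (t := {y | P.deg y = P.deg x + 1}) (single_deg x) (fun i hi => by
        rw [b.constr_basis]
        exact (show bdeg i = P.deg x from hi) ▸ h_deg i) hxy,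
      fun hx => toMatrix'_ne_zero _ b (t := {y | P.low y}) (single_low x hx) (fun i hi => by
        rw [b.constr_basis]
        exact h_low i hi) hxy⟩
  d_φ := by
    apply Matrix.toLin'.injective
    rw [Matrix.toLin'_mul, Matrix.toLin'_mul, Matrix.toLin'_toMatrix']
    refine LinearMap.pi_ext' fun x => LinearMap.ext_ring ?_
    refine Eq.trans ?_ ((d_b (g x)).trans (d_g x))
    change P.d.mulVecLin (Fintype.linearCombination R (b ∘ g) (Pi.single x 1)) = _
    rw [Fintype.linearCombination_apply_single, one_smul]
    rfl
  d_ψ := by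
    apply Matrix.toLin'.injective
    rw [Matrix.toLin'_mul, Matrix.toLin'_mul, Matrix.toLin'_toMatrix']
    refine b.ext fun i => ?_
    rw [LinearMap.comp_apply, LinearMap.comp_apply, b.constr_basis]
    exact (d_t i).trans (congrArg _ (d_b i).symm)
  ψ_φ := by
    rw [← LinearMap.toMatrix'_comp, ← LinearMap.toMatrix'_id]
    congr 1
    refine LinearMap.pi_ext' fun x => LinearMap.ext_ring ?_
    change b.constr R t (Fintype.linearCombination R (b ∘ g) (Pi.single x 1)) = Pi.single x 1
    rw [Fintype.linearCombination_apply_single, one_smul, Function.comp_apply, b.constr_basis, t_g]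
  homotopy := by
    apply Matrix.toLin'.injective
    rw [map_add, map_add, Matrix.toLin'_mul, Matrix.toLin'_mul, Matrix.toLin'_mul,
      Matrix.toLin'_toMatrix', Matrix.toLin'_toMatrix', Matrix.toLin'_toMatrix', Matrix.toLin'_one]
    refine b.ext fun i => ?_
    refine Eq.trans ?_ (hom i)
    rw [LinearMap.add_apply, LinearMap.add_apply, LinearMap.comp_apply, LinearMap.comp_apply,
      LinearMap.comp_apply, b.constr_basis, b.constr_basis, ← d_b i]
    rfl

namespace NormalFamily

variable {sE sF : Set σ} {J J' : Type} {K : PointIndex → Type}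
  (F : NormalFamily deg d sE sF J J' K)

/-- The index set of the basis. -/
abbrev Index (J J' : Type) (K : PointIndex → Type) : Type :=
  (((J ⊕ K .inOmega) ⊕ K .neither) ⊕ J) ⊕ (((J' ⊕ K .inSigma) ⊕ K .inOmega) ⊕ J')

/-- The basis vectors. -/
def vec : Index J J' K → (σ →₀ R) :=
  Sum.elim (Sum.elim (Sum.elim (Sum.elim F.bot (F.z .inOmega)) (F.z .neither)) F.top)
    (Sum.elim (Sum.elim (Sum.elim F.bot' (F.z .inSigma)) F.u) F.top')

/-- The degrees of the basis vectors. -/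
def vecDeg : Index J J' K → ℤ :=
  Sum.elim (Sum.elim (Sum.elim (Sum.elim F.jdeg (F.kdeg .inOmega)) (F.kdeg .neither))
      (fun j => F.jdeg j + 1))
    (Sum.elim (Sum.elim (Sum.elim F.jdeg' (F.kdeg .inSigma)) (fun k => F.kdeg .inOmega k + 1))
      (fun j => F.jdeg' j + 1))

theorem vec_deg (i : Index J J' K) : F.vec i ∈ degPart deg R (F.vecDeg i) := by
  rcases i with (((i | i) | i) | i) | (((i | i) | i) | i)
  · exact F.bot_deg i
  · exact F.z_deg _ i
  · exact F.z_deg _ i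
  · exact F.top_deg i
  · exact F.bot_deg' i
  · exact F.z_deg _ i
  · exact F.u_deg i
  · exact F.top_deg' i

theorem relBasis_vec : RelBasis ⊥ (Finsupp.supported R R sF) F.vec := F.relE.append F.relF

/-- Restriction of functions to `sF`. -/
noncomputable def evalOn (R : Type u) [CommRing R] (sF : Set σ) : (σ →₀ R) →ₗ[R] (sF → R) :=
  LinearMap.pi fun s => Finsupp.lapply s.1

theorem evalOn_injective {sF : Set σ} {x : σ →₀ R} (hx : x ∈ Finsupp.supported R R sF)
    (h : evalOn R sF x = 0) : x = 0 := by
  ext s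
  by_contra hs
  exact hs (congrFun h ⟨s, (Finsupp.mem_supported _ _).1 hx (Finsupp.mem_support_iff.2 hs)⟩)

theorem evalOn_single [DecidableEq sF] (s : sF) :
    evalOn R sF (Finsupp.single s.1 1) = Pi.single s 1 := by
  classical
  funext t
  change Finsupp.single s.1 (1 : R) t.1 = _
  rw [Finsupp.single_apply, Pi.single_apply]
  simp only [Subtype.ext_iff, eq_comm]

/-- Project an expansion in the basis to degree `n`: vectors of other degrees vanish, the rest are
fixed. -/
theorem mem_span_vecDeg {n : ℤ} {x : σ →₀ R} (hx : x ∈ degPart deg R n)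
    (hF : x ∈ Finsupp.supported R R sF) :
    x ∈ Submodule.span R (F.vec '' {i | F.vecDeg i = n}) := by
  rw [← degProj_of_mem hx]
  have h := F.relBasis_vec.span hF
  rw [bot_sup_eq] at h
  have h1 : Submodule.span R (Set.range F.vec) ≤
      (Submodule.span R (F.vec '' {i | F.vecDeg i = n})).comap (degProj deg R n) := by
    rw [Submodule.span_le]
    rintro _ ⟨i, rfl⟩
    change degProj deg R n (F.vec i) ∈ Submodule.span R (F.vec '' {i | F.vecDeg i = n})
    by_cases hi : F.vecDeg i = n
    · rw [degProj_of_mem (hi ▸ F.vec_deg i)]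
      exact Submodule.subset_span ⟨i, hi, rfl⟩
    · rw [degProj_of_mem_ne hi (F.vec_deg i)]
      exact Submodule.zero_mem _
  exact h1 h

theorem mem_span_low {x : σ →₀ R} (hx : x ∈ Finsupp.supported R R sE) :
    x ∈ Submodule.span R (F.vec '' Set.range Sum.inl) := by
  have h := F.relE.span hx
  rw [bot_sup_eq] at h
  refine Submodule.span_mono ?_ h
  rintro _ ⟨i, rfl⟩
  exact ⟨Sum.inl i, ⟨i, rfl⟩, rfl⟩

theorem evalOn_linearIndependent :
    LinearIndependent R (evalOn R sF ∘ F.vec) := by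
  rw [linearIndependent_iff]
  intro c hc
  rw [← Finsupp.apply_linearCombination] at hc
  refine F.relBasis_vec.indep c ?_
  rw [Submodule.mem_bot]
  exact evalOn_injective (linearCombination_mem F.relBasis_vec.mem c) hc

theorem evalOn_span [Finite σ] : ⊤ ≤ Submodule.span R (Set.range (evalOn R sF ∘ F.vec)) := by
  classical
  have := Fintype.ofFinite sF
  intro y _
  rw [pi_eq_sum_univ' y]
  refine Submodule.sum_mem _ fun s _ => Submodule.smul_mem _ _ ?_
  have h := F.relBasis_vec.span (Finsupp.single_mem_supported R (1 : R) s.2)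
  rw [bot_sup_eq] at h
  rw [Set.range_comp, Submodule.span_image]
  refine ⟨_, h, ?_⟩
  rw [evalOn_single]

/-- The basis of the functions on `sF`. -/
noncomputable def basis [Finite σ] : Module.Basis (Index J J' K) R (sF → R) :=
  Module.Basis.mk F.evalOn_linearIndependent F.evalOn_span

theorem basis_apply [Finite σ] (i : Index J J' K) : F.basis i = evalOn R sF (F.vec i) :=
  Module.Basis.mk_apply _ _ i

theorem basis_mem_deg [Finite σ] (i : Index J J' K) :
    F.basis i ∈ supportedOn R {s : sF | deg s = F.vecDeg i} := by
  rw [basis_apply]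
  intro s hs
  exact (Finsupp.mem_supported _ _).1 (F.vec_deg i) (Finsupp.mem_support_iff.2 hs)

theorem basis_mem_low [Finite σ] (i) :
    F.basis (Sum.inl i) ∈ supportedOn R {s : sF | s.1 ∈ sE} := by
  rw [basis_apply]
  intro s hs
  exact (Finsupp.mem_supported _ _).1 (F.relE.mem i) (Finsupp.mem_support_iff.2 hs)

theorem single_mem_span_deg [Finite σ] [DecidableEq sF] (s : sF) :
    Pi.single s (1 : R) ∈ Submodule.span R (F.basis '' {i | F.vecDeg i = deg s.1}) := by
  have h := F.mem_span_vecDeg (n := deg s.1) (Finsupp.single_mem_supported R (1 : R) rfl)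
    (Finsupp.single_mem_supported R (1 : R) s.2)
  have h2 := Submodule.mem_map_of_mem (f := evalOn R sF) h
  rw [evalOn_single, Submodule.map_span, Set.image_image] at h2
  simpa only [basis_apply] using h2

theorem single_mem_span_low [Finite σ] [DecidableEq sF] (s : sF) (hs : s.1 ∈ sE) :
    Pi.single s (1 : R) ∈ Submodule.span R (F.basis '' Set.range Sum.inl) := by
  have h := F.mem_span_low (Finsupp.single_mem_supported R (1 : R) hs)
  have h2 := Submodule.mem_map_of_mem (f := evalOn R sF) h
  rw [evalOn_single, Submodule.map_span, Set.image_image] at h2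
  simpa only [basis_apply] using h2

/-- The generators are part of a basis of a finite free module. -/
theorem finite_gen [Nontrivial R] [Finite σ] (F : NormalFamily (R := R) deg d sE sF J J' K) :
    Finite (Σ s, K s) := by
  have h : Finite (Index J J' K) := Module.Finite.finite_basis F.basis
  have : ∀ s, Finite (K s) := fun s => match s with
    | .inOmega => Finite.of_injective
        (fun k : K .inOmega => (Sum.inl (Sum.inl (Sum.inl (Sum.inr k))) : Index J J' K))
        fun _ _ h => by simpa using h
    | .neither => Finite.of_injective
        (fun k : K .neither => (Sum.inl (Sum.inl (Sum.inr k)) : Index J J' K))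
        fun _ _ h => by simpa using h
    | .inSigma => Finite.of_injective
        (fun k : K .inSigma => (Sum.inr (Sum.inl (Sum.inl (Sum.inr k))) : Index J J' K))
        fun _ _ h => by simpa using h
  infer_instance

/-- The generators of the normal form. -/
abbrev Gen (K : PointIndex → Type) : Type := NormalBasis (Σ s, K s) Sigma.fst

/-- The basis vector of an element of the basis of the normal form. -/
def genIndex : Gen K → Index J J' K
  | ⟨⟨.inOmega, k⟩, false, _⟩ => Sum.inl (Sum.inl (Sum.inl (Sum.inr k)))
  | ⟨⟨.inOmega, k⟩, true, _⟩ => Sum.inr (Sum.inl (Sum.inr k))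
  | ⟨⟨.neither, k⟩, _, _⟩ => Sum.inl (Sum.inl (Sum.inr k))
  | ⟨⟨.inSigma, k⟩, _, _⟩ => Sum.inr (Sum.inl (Sum.inl (Sum.inr k)))

/-- The images of the basis vectors in the normal form. -/
noncomputable def toGen : Index J J' K → (Gen K → R) :=
  Sum.elim
    (Sum.elim (Sum.elim (Sum.elim (fun _ => 0)
      (fun k => Pi.single ⟨⟨.inOmega, k⟩, false, fun h => absurd h Bool.false_ne_true⟩ 1))
      (fun k => Pi.single ⟨⟨.neither, k⟩, false, fun h => absurd h Bool.false_ne_true⟩ 1))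
      (fun _ => 0))
    (Sum.elim (Sum.elim (Sum.elim (fun _ => 0)
      (fun k => Pi.single ⟨⟨.inSigma, k⟩, false, fun h => absurd h Bool.false_ne_true⟩ 1))
      (fun k => Pi.single ⟨⟨.inOmega, k⟩, true, fun _ => rfl⟩ 1))
      (fun _ => 0))

theorem toGen_genIndex (x : Gen K) :
    toGen (R := R) (genIndex (J := J) (J' := J') x) = Pi.single x 1 := by
  obtain ⟨⟨_ | _ | _, k⟩, _ | _, h⟩ := x
  · rfl
  · exact absurd (h rfl) (by simp)
  · rfl
  · rfl
  · rfl
  · exact absurd (h rfl) (by simp)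

theorem vecDeg_genIndex (x : Gen K) :
    F.vecDeg (genIndex x) = F.kdeg x.gen.1 x.gen.2 + if x.up then 1 else 0 := by
  obtain ⟨⟨_ | _ | _, k⟩, _ | _, h⟩ := x
  · exact (add_zero _).symm
  · exact absurd (h rfl) (by simp)
  · exact (add_zero _).symm
  · rfl
  · exact (add_zero _).symm
  · exact absurd (h rfl) (by simp)

theorem toGen_deg (i : Index J J' K) : toGen i ∈ supportedOn R
    {x : Gen K | (F.kdeg x.gen.1 x.gen.2 + if x.up then 1 else 0) = F.vecDeg i} := by
  have h0 : ∀ t : Set (Gen K), (fun _ => 0 : Gen K → R) ∈ supportedOn R t := fun t =>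
    Submodule.zero_mem _
  have h1 : ∀ (x : Gen K) (t : Set (Gen K)), x ∈ t → Pi.single x (1 : R) ∈ supportedOn R t := by
    intro x t hx y hy
    rw [Pi.single_apply, ite_ne_right_iff] at hy
    exact hy.1 ▸ hx
  rcases i with (((i | i) | i) | i) | (((i | i) | i) | i)
  exacts [h0 _, h1 _ _ (add_zero _), h1 _ _ (add_zero _), h0 _, h0 _, h1 _ _ (add_zero _),
    h1 _ _ rfl, h0 _]

theorem toGen_low (i) : toGen (J' := J') (Sum.inl i : Index J J' K) ∈ supportedOn R
    {x : Gen K | x.gen.1 ≠ .inSigma ∧ x.up = false} := by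
  have h0 : ∀ t : Set (Gen K), (fun _ => 0 : Gen K → R) ∈ supportedOn R t := fun t =>
    Submodule.zero_mem _
  have h1 : ∀ (x : Gen K) (t : Set (Gen K)), x ∈ t → Pi.single x (1 : R) ∈ supportedOn R t := by
    intro x t hx y hy
    rw [Pi.single_apply, ite_ne_right_iff] at hy
    exact hy.1 ▸ hx
  rcases i with ((i | i) | i) | i
  exacts [h0 _, h1 _ _ ⟨by simp, rfl⟩, h1 _ _ ⟨by simp, rfl⟩, h0 _]

/-- The differential on the basis vectors. -/
noncomputable def dVec (F : NormalFamily (R := R) deg d sE sF J J' K) : Index J J' K → (σ →₀ R) :=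
  Sum.elim (Sum.elim (Sum.elim (Sum.elim (fun _ => 0) (fun _ => 0)) (fun _ => 0)) F.bot)
    (Sum.elim (Sum.elim (Sum.elim (fun _ => 0) (fun _ => 0)) (F.z .inOmega)) F.bot')

theorem d_vec (i : Index J J' K) : d (F.vec i) = F.dVec i := by
  rcases i with (((i | i) | i) | i) | (((i | i) | i) | i)
  exacts [F.d_bot i, F.d_z _ i, F.d_z _ i, F.d_top i, F.d_bot' i, F.d_z _ i, F.d_u i, F.d_top' i]

/-- The basis vectors in terms of which the differential of a basis vector is expressed. -/
def dIndex : Index J J' K → Option (Index J J' K) :=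
  Sum.elim (Sum.elim (Sum.elim (Sum.elim (fun _ => none) (fun _ => none)) (fun _ => none))
      (fun j => some (Sum.inl (Sum.inl (Sum.inl (Sum.inl j))))))
    (Sum.elim (Sum.elim (Sum.elim (fun _ => none) (fun _ => none))
      (fun k => some (Sum.inl (Sum.inl (Sum.inl (Sum.inr k))))))
      (fun j => some (Sum.inr (Sum.inl (Sum.inl (Sum.inl j))))))

/-- The homotopy permutes the basis vectors, up to zeros. -/
def hIndex : Index J J' K → Option (Index J J' K) :=
  Sum.elim (Sum.elim (Sum.elim (Sum.elim (fun j => some (Sum.inl (Sum.inr j))) (fun _ => none))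
      (fun _ => none)) (fun _ => none))
    (Sum.elim (Sum.elim (Sum.elim (fun j => some (Sum.inr (Sum.inr j))) (fun _ => none))
      (fun _ => none)) (fun _ => none))

theorem dVec_eq (i : Index J J' K) : F.dVec i = (dIndex i).elim 0 F.vec := by
  rcases i with (((i | i) | i) | i) | (((i | i) | i) | i) <;> rfl

/-- The differential of a generator of the normal form. -/
theorem normalPair_d_single [Finite (Σ s, K s)] (x : Gen K) :
    (normalPair R (Σ s, K s) Sigma.fst (fun g => F.kdeg g.1 g.2)).d.mulVecLin (Pi.single x 1) =
      if x.up then Pi.single x.lower 1 else 0 := by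
  rw [Matrix.mulVecLin_apply, Matrix.mulVec_single_one]
  funext y
  change (if x.up = true ∧ y = x.lower then (1 : R) else 0) = _
  split_ifs with h2 h3 h3
  · rw [h2.2, Pi.single_eq_same]
  · exact absurd h2.1 h3
  · rw [Pi.single_eq_of_ne]
    exact fun h => h2 ⟨h3, h⟩
  · rfl

section

variable [Finite σ] (hdeg : ∀ n, ∀ x ∈ degPart deg R n, d x ∈ degPart deg R (n + -1))
  (hE : ∀ x ∈ Finsupp.supported R R sE, d x ∈ Finsupp.supported R R sE)

theorem supportedPair_d_evalOn {x : σ →₀ R} (hx : x ∈ Finsupp.supported R R sF) :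
    (supportedPair deg d hdeg sE sF hE).d.mulVecLin (evalOn R sF x) = evalOn R sF (d x) := by
  rw [Finsupp.supported_eq_span_single] at hx
  induction hx using Submodule.span_induction with
  | mem x h =>
    obtain ⟨s, hs, rfl⟩ := h
    let inst : DecidableEq sF := (supportedPair deg d hdeg sE sF hE).decEq
    have e : evalOn R sF (Finsupp.single s 1) = Pi.single (⟨s, hs⟩ : sF) 1 :=
      evalOn_single (⟨s, hs⟩ : sF)
    rw [e]
    exact Matrix.mulVec_single_one (supportedPair deg d hdeg sE sF hE).d _
  | zero => exact (congrArg _ (map_zero _)).trans ((map_zero _).trans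
      ((congrArg _ (map_zero d)).trans (map_zero _)).symm)
  | add x y _ _ h1 h2 =>
    rw [map_add d]
    exact ((congrArg _ (map_add _ _ _)).trans (map_add _ _ _)).trans
      ((congrArg₂ (· + ·) h1 h2).trans (map_add (evalOn R sF) _ _).symm)
  | smul r x _ h =>
    rw [map_smul d]
    exact ((congrArg _ (map_smul _ _ _)).trans (map_smul _ _ _)).trans
      ((congrArg (r • ·) h).trans (map_smul (evalOn R sF) _ _).symm)

/-- The basis vector with a given optional index. -/
noncomputable def optBasis (F : NormalFamily (R := R) deg d sE sF J J' K)
    (o : Option (Index J J' K)) : sF → R := o.elim 0 F.basis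

theorem supportedPair_d_basis (i : Index J J' K) :
    (supportedPair deg d hdeg sE sF hE).d.mulVecLin (F.basis i) = F.optBasis (dIndex i) := by
  rw [basis_apply]
  refine (supportedPair_d_evalOn hdeg hE (F.relBasis_vec.mem i)).trans ?_
  rw [d_vec, dVec_eq, optBasis]
  cases dIndex i with
  | none => exact map_zero _
  | some j => exact (F.basis_apply j).symm

theorem optBasis_hIndex_deg (i : Index J J' K) :
    F.optBasis (hIndex i) ∈ supportedOn R {s : sF | deg s = F.vecDeg i + 1} := by
  rcases i with (((i | i) | i) | i) | (((i | i) | i) | i)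
  exacts [F.basis_mem_deg (Sum.inl (Sum.inr i)), Submodule.zero_mem _, Submodule.zero_mem _,
    Submodule.zero_mem _, F.basis_mem_deg (Sum.inr (Sum.inr i)), Submodule.zero_mem _,
    Submodule.zero_mem _, Submodule.zero_mem _]

theorem optBasis_hIndex_low (i) :
    F.optBasis (hIndex (Sum.inl i)) ∈ supportedOn R {s : sF | s.1 ∈ sE} := by
  rcases i with ((i | i) | i) | i
  exacts [F.basis_mem_low (Sum.inr i), Submodule.zero_mem _, Submodule.zero_mem _,
    Submodule.zero_mem _]

theorem genIndex_low (x : Gen K) (hx : x.gen.1 ≠ .inSigma ∧ x.up = false) :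
    (genIndex x : Index J J' K) ∈ Set.range Sum.inl := by
  obtain ⟨⟨_ | _ | _, k⟩, _ | _, h⟩ := x
  · exact ⟨_, rfl⟩
  · exact ⟨_, rfl⟩
  · exact ⟨_, rfl⟩
  · exact absurd hx.2 (by simp)
  · exact absurd rfl hx.1
  · exact absurd rfl hx.1

/-- The images of the basis vectors in the normal form, as optional generators. -/
def optGen : Index J J' K → Option (Gen K) :=
  Sum.elim
    (Sum.elim (Sum.elim (Sum.elim (fun _ => none)
      (fun k => some ⟨⟨.inOmega, k⟩, false, fun h => absurd h Bool.false_ne_true⟩))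
      (fun k => some ⟨⟨.neither, k⟩, false, fun h => absurd h Bool.false_ne_true⟩))
      (fun _ => none))
    (Sum.elim (Sum.elim (Sum.elim (fun _ => none)
      (fun k => some ⟨⟨.inSigma, k⟩, false, fun h => absurd h Bool.false_ne_true⟩))
      (fun k => some ⟨⟨.inOmega, k⟩, true, fun _ => rfl⟩))
      (fun _ => none))

theorem toGen_eq (i : Index J J' K) :
    toGen i = (optGen i).elim 0 fun x : Gen K => Pi.single x (1 : R) := by
  rcases i with (((i | i) | i) | i) | (((i | i) | i) | i) <;> rfl

theorem constr_optBasis {M : Type*} [AddCommGroup M] [Module R M] (f : Index J J' K → M)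
    (o : Option (Index J J' K)) : F.basis.constr R f (F.optBasis o) = o.elim 0 f := by
  cases o with
  | none => exact map_zero _
  | some i => exact F.basis.constr_basis R f i

/-- The linear map from the normal form. -/
theorem linearCombination_toGen [Finite (Σ s, K s)] (i : Index J J' K) :
    Fintype.linearCombination R (F.basis ∘ genIndex) (toGen i : Gen K → R) =
      F.optBasis ((optGen i).map genIndex) := by
  rw [toGen_eq]
  cases optGen i with
  | none => exact map_zero _
  | some x =>
    refine (Fintype.linearCombination_apply_single R _ x 1).trans (one_smul R _)

theorem d_genIndex (x : Gen K) : dIndex (genIndex x : Index J J' K) =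
    if x.up then some (genIndex x.lower) else none := by
  obtain ⟨⟨_ | _ | _, k⟩, _ | _, h⟩ := x
  · rfl
  · exact absurd (h rfl) (by simp)
  · rfl
  · rfl
  · rfl
  · exact absurd (h rfl) (by simp)

/-- The homotopy identity, vector by vector: the surviving vectors are reproduced by `φ ψ`, each
`bot` by `d h` and each `top` by `h d`. -/
theorem optBasis_decomposition (i : Index J J' K) :
    F.optBasis ((optGen i).map genIndex) +
      ((hIndex i).elim 0 fun j => F.optBasis (dIndex j)) +
      ((dIndex i).elim 0 fun j => F.optBasis (hIndex j)) = F.basis i := by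
  rcases i with (((i | i) | i) | i) | (((i | i) | i) | i) <;>
    simp [optBasis, optGen, hIndex, dIndex, genIndex]

/-- The reduction of a filtered complex with a normal basis to its normal form. -/
noncomputable def retract [Finite (Σ s, K s)] :
    BasedRetract (supportedPair deg d hdeg sE sF hE)
      (normalPair R (Σ s, K s) Sigma.fst (fun g => F.kdeg g.1 g.2)) :=
  BasedRetract.ofBasis (P := supportedPair deg d hdeg sE sF hE)
    (Q := normalPair R (Σ s, K s) Sigma.fst (fun g => F.kdeg g.1 g.2))
    F.basis F.vecDeg (Set.range Sum.inl) genIndex toGen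
    (fun i => F.optBasis (hIndex i)) (fun i => F.optBasis (dIndex i))
    F.basis_mem_deg
    (by
      rintro _ ⟨i, rfl⟩
      exact F.basis_mem_low i)
    (fun s => by
      let inst : DecidableEq sF := (supportedPair deg d hdeg sE sF hE).decEq
      exact F.single_mem_span_deg (show sF from s))
    (fun s hs => by
      let inst : DecidableEq sF := (supportedPair deg d hdeg sE sF hE).decEq
      exact F.single_mem_span_low (show sF from s) hs)
    F.toGen_deg
    (by
      rintro _ ⟨i, rfl⟩
      exact toGen_low i)
    F.optBasis_hIndex_deg
    (by
      rintro _ ⟨i, rfl⟩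
      exact F.optBasis_hIndex_low i)
    F.vecDeg_genIndex genIndex_low toGen_genIndex (F.supportedPair_d_basis hdeg hE)
    (fun i => by
      refine Eq.trans ?_ (F.constr_optBasis toGen (dIndex i)).symm
      rw [toGen_eq]
      rcases i with (((i | i) | i) | i) | (((i | i) | i) | i)
      exacts [map_zero _, F.normalPair_d_single _, F.normalPair_d_single _, map_zero _, map_zero _,
        F.normalPair_d_single _, F.normalPair_d_single _, map_zero _])
    (fun x => by
      rw [normalPair_d_single, d_genIndex]
      split_ifs
      · exact ((Fintype.linearCombination_apply_single R (F.basis ∘ genIndex) x.lower 1).trans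
          (one_smul R _)).symm
      · exact (map_zero _).symm)
    (fun i => by
      have e1 := F.linearCombination_toGen i
      have e2 := F.constr_optBasis (fun i => F.optBasis (hIndex i)) (dIndex i)
      have e3 : (supportedPair deg d hdeg sE sF hE).d.mulVecLin (F.optBasis (hIndex i)) =
          (hIndex i).elim 0 fun j => F.optBasis (dIndex j) := by
        cases hIndex i with
        | none => exact map_zero _
        | some j => exact F.supportedPair_d_basis hdeg hE j
      exact Eq.trans (congrArg₂ (fun x y : sF → R => x + y)
        (congrArg₂ (fun x y : sF → R => x + y) e1 e3) e2) (F.optBasis_decomposition i))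

end

end NormalFamily

end Retract

/-! ### Normal form of the chains of a simplicial pair -/

section SimplicialPair

variable {R : Type u} [CommRing R] {V : Type}

theorem supported_mono_of_le {L' L : SComplex V} (h : L' ≤ L) :
    Finsupp.supported R R {s | s ∈ L'} ≤ Finsupp.supported R R {s | s ∈ L} :=
  Finsupp.supported_mono fun _ hs => h hs

variable [LinearOrder V]

/-- The number of vertices of a simplex: its degree in the suspended reduced complex. -/
def simplexDeg (s : Finset V) : ℤ := s.card

theorem simplicialBoundary_deg (n : ℤ) (x : Finset V →₀ R) (hx : x ∈ degPart simplexDeg R n) :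
    simplicialBoundary R V x ∈ degPart simplexDeg R (n + -1) := by
  refine altBoundary_mem R _ _ _ _ ?_ x hx
  intro s hs v hv
  have h1 := Finset.card_erase_add_one hv
  change ((s.card : ℕ) : ℤ) = n at hs
  change (((s.erase v).card : ℕ) : ℤ) = n + -1
  omega

theorem simplicialBoundary_supported (L : SComplex V) (x : Finset V →₀ R)
    (hx : x ∈ Finsupp.supported R R {s | s ∈ L}) :
    simplicialBoundary R V x ∈ Finsupp.supported R R {s | s ∈ L} :=
  altBoundary_mem R _ _ _ _ (fun s hs v _ => L.lower (Finset.erase_subset v s) hs) x hx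

theorem simplicialBoundary_simplicialBoundary (x : Finset V →₀ R) :
    simplicialBoundary R V (simplicialBoundary R V x) = 0 :=
  altBoundary_altBoundary R _ _ (fun _ _ _ => rfl) (fun _ _ _ => Finset.erase_right_comm) x

theorem mem_reducedComplex_C {L : SComplex V} {n : ℤ} {x : Finset V →₀ R} :
    x ∈ (reducedComplex R L).C (n - 1) ↔
      x ∈ Finsupp.supported R R {s | s ∈ L} ∧ x ∈ degPart simplexDeg R n := by
  have h : (reducedComplex R L).C (n - 1) =
      Finsupp.supported R R ({s | s ∈ L} ∩ {s | simplexDeg s = n}) := by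
    change Finsupp.supported R R {s : Finset V | s ∈ L ∧ (s.card : ℤ) = n - 1 + 1} = _
    rw [sub_add_cancel]
    rfl
  rw [h, Finsupp.supported_inter]
  rfl

/-- The homogeneous cycles of a simplicial complex. -/
noncomputable abbrev simplexCycles (R : Type u) [CommRing R] (L : SComplex V) (n : ℤ) :
    Submodule R (Finset V →₀ R) :=
  Finsupp.supported R R {s | s ∈ L} ⊓ LinearMap.ker (simplicialBoundary R V) ⊓
    degPart simplexDeg R n

/-- The homology class of a homogeneous cycle. -/
noncomputable def homologyClass (R : Type u) [CommRing R] (L : SComplex V) (n : ℤ) :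
    simplexCycles R L n →ₗ[R] (reducedComplex R L).homology (n - 1) :=
  Subquotient.mk _ _ ∘ₗ
    { toFun := fun x => ⟨⟨x.1, mem_reducedComplex_C.2 ⟨x.2.1.1, x.2.2⟩⟩,
        LinearMap.mem_ker.2 (Subtype.ext (LinearMap.mem_ker.1 x.2.1.2))⟩
      map_add' := fun _ _ => rfl
      map_smul' := fun _ _ => rfl }

theorem homologyClass_surjective (L : SComplex V) (n : ℤ) :
    Function.Surjective (homologyClass R L n) := by
  intro y
  obtain ⟨⟨x, hx⟩, rfl⟩ := Subquotient.mk_surjective _ _ y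
  have hx1 := mem_reducedComplex_C.1 x.2
  exact ⟨⟨x.1, ⟨hx1.1, LinearMap.mem_ker.2 (congrArg Subtype.val (LinearMap.mem_ker.1 hx))⟩,
    hx1.2⟩, rfl⟩

/-- The bounding chain on the right need not be homogeneous; its component of degree `n + 1` bounds
as well. -/
theorem homologyClass_eq_zero {L : SComplex V} {n : ℤ} {x : simplexCycles R L n} :
    homologyClass R L n x = 0 ↔
      (x : Finset V →₀ R) ∈ (Finsupp.supported R R {s | s ∈ L}).map (simplicialBoundary R V) := by
  refine (Subquotient.mk_eq_zero (M := (reducedComplex R L).C (n - 1))).trans ⟨?_, fun h => ?_⟩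
  · rintro ⟨y, hy⟩
    have e : n - 1 + 1 = n + 1 - 1 := by ring
    have hy2 : y.1 ∈ (reducedComplex R L).C (n + 1 - 1) := e ▸ y.2
    exact ⟨y.1, (mem_reducedComplex_C.1 hy2).1, congrArg Subtype.val hy⟩
  · obtain ⟨y, hy, hy1, hy2⟩ := exists_homogeneous_preimage simplicialBoundary_deg
      (isHomogeneousSubmodule_supported _) x.2.2 h
    have e : n - 1 + 1 = n + 1 - 1 := by ring
    have hy3 : y ∈ (reducedComplex R L).C (n - 1 + 1) := e ▸ mem_reducedComplex_C.2 ⟨hy, hy1⟩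
    exact ⟨⟨y, hy3⟩, Subtype.ext hy2⟩

variable {L' L : SComplex V} (h : L' ≤ L)

theorem homologyMap_homologyClass (n : ℤ) (x : simplexCycles R L' n) :
    Subcomplex.homologyMap (reducedComplex_mono R h) (n - 1) (homologyClass R L' n x) =
      homologyClass R L n ⟨x.1, ⟨supported_mono_of_le h x.2.1.1, x.2.1.2⟩, x.2.2⟩ := rfl

/-- The complex of `L`, filtered by the subcomplex of `L'`. -/
noncomputable def simplicialPair (R : Type u) [CommRing R] [Finite V] (L' L : SComplex V) :
    BasedPair R :=
  supportedPair simplexDeg (simplicialBoundary R V) simplicialBoundary_deg {s | s ∈ L'} {s | s ∈ L}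
    (simplicialBoundary_supported L')

/-- The generators of the normal form of a pair of simplicial complexes. -/
abbrev SimplicialGen (R : Type u) [CommRing R] {L' L : SComplex V} (h : L' ≤ L) : Type :=
  Σ s : PointIndex, Σ n : ℤ, Fin (Module.finrank R
    (charGroup (Subcomplex.homologyMap (reducedComplex_mono R h) (n - 1)) s))

instance finite_reducedHomology [IsNoetherianRing R] [Finite V] (L : SComplex V) (n : ℤ) :
    Module.Finite R ((reducedComplex R L).homology n) :=
  Module.Finite.of_surjective _ (Subquotient.mk_surjective _ _)

instance charGroup.finite [IsNoetherianRing R] {U W : Type u} [AddCommGroup U] [Module R U]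
    [AddCommGroup W] [Module R W] [Module.Finite R U] [Module.Finite R W] (θ : U →ₗ[R] W) :
    ∀ s, Module.Finite R (charGroup θ s)
  | .inSigma => inferInstanceAs (Module.Finite R (W ⧸ LinearMap.range θ))
  | .inOmega => inferInstanceAs (Module.Finite R (LinearMap.ker θ))
  | .neither => inferInstanceAs (Module.Finite R (LinearMap.range θ))

theorem IsSplitHom.charGroup_free {U W : Type u} [AddCommGroup U] [Module R U]
    [AddCommGroup W] [Module R W] {θ : U →ₗ[R] W} (hθ : IsSplitHom θ) :
    ∀ s, Module.Free R (charGroup θ s)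
  | .inSigma => hθ.free_coker
  | .inOmega => hθ.free_ker
  | .neither => hθ.free_range

/-- The homology groups of the pair are the models needed by `exists_normalFamily`. Finiteness of
the generators comes out of the construction, and the retraction is stated for an arbitrary proof of
it because `normalPair` depends on it. -/
theorem exists_simplicialPair_retract [IsDomain R] [IsPrincipalIdealRing R] [Finite V]
    (hsplit : ∀ n, IsSplitHom (Subcomplex.homologyMap (reducedComplex_mono R h) n)) :
    Finite (SimplicialGen R h) ∧ ∀ _ : Finite (SimplicialGen R h),
      Nonempty (BasedRetract (simplicialPair R L' L)
        (normalPair R (SimplicialGen R h) Sigma.fst fun g => g.2.1)) := by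
  have hfree : ∀ s n, Module.Free R (charGroup
    (Subcomplex.homologyMap (reducedComplex_mono R h) (n - 1)) s) := fun s n =>
      (hsplit (n - 1)).charGroup_free s
  have hF := simplicialBoundary_supported (R := R) L
  have hE := simplicialBoundary_supported (R := R) L'
  have homE : IsHomogeneousSubmodule simplexDeg (Finsupp.supported R R {s | s ∈ L'}) :=
    isHomogeneousSubmodule_supported _
  have homF : IsHomogeneousSubmodule simplexDeg (Finsupp.supported R R {s | s ∈ L}) :=
    isHomogeneousSubmodule_supported _
  have homK := isHomogeneousSubmodule_ker (R := R) (simplicialBoundary_deg (V := V))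
  have dF_le : (Finsupp.supported R R {s | s ∈ L}).map (simplicialBoundary R V) ≤
      LinearMap.ker (simplicialBoundary R V) := by
    rintro _ ⟨x, -, rfl⟩
    exact simplicialBoundary_simplicialBoundary x
  obtain ⟨J, J', F, hkdeg⟩ := exists_normalFamily (deg := simplexDeg)
    simplicialBoundary_simplicialBoundary simplicialBoundary_deg
    (fun s hs => h hs : {s | s ∈ L'} ⊆ {s | s ∈ L}) rfl rfl hE hF
    (fun s n => charGroup (Subcomplex.homologyMap (reducedComplex_mono R h) (n - 1)) s)
    -- Kernel of the map on homology: cycles of `L'` that bound in `L`, modulo boundaries in `L'`.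
    (fun n => LinearMap.codRestrict (LinearMap.ker _) (homologyClass R L' n ∘ₗ
        Submodule.inclusion (inf_le_inf_right _ (inf_le_inf_left _ dF_le))) fun x => by
      rw [LinearMap.mem_ker, LinearMap.comp_apply, homologyMap_homologyClass h,
        homologyClass_eq_zero]
      exact x.2.1.2)
    (by
      rintro n ⟨y, hy⟩
      obtain ⟨x, rfl⟩ := homologyClass_surjective L' n y
      rw [LinearMap.mem_ker, homologyMap_homologyClass h, homologyClass_eq_zero] at hy
      exact ⟨⟨x.1, ⟨x.2.1.1, hy⟩, x.2.2⟩, rfl⟩)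
    (fun n x => by
      refine (Submodule.coe_eq_zero (p := LinearMap.ker _)).symm.trans ?_
      exact homologyClass_eq_zero)
    -- Image: cycles of `L'` modulo those that bound in `L`.
    (fun n => (LinearMap.rangeRestrict _) ∘ₗ (homologyClass R L' n))
    (fun n => (LinearMap.surjective_rangeRestrict _).comp (homologyClass_surjective L' n))
    (fun n x => by
      refine (Submodule.coe_eq_zero (p := LinearMap.range _)).symm.trans ?_
      change Subcomplex.homologyMap (reducedComplex_mono R h) (n - 1)
        (homologyClass R L' n x) = 0 ↔ _
      rw [homologyMap_homologyClass h, homologyClass_eq_zero]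
      exact ⟨fun hx => ⟨x.2.1.1, hx⟩, fun hx => hx.2⟩)
    -- Cokernel: cycles of `L` modulo cycles of `L'` and boundaries in `L`.
    (fun n => (Submodule.mkQ _) ∘ₗ (homologyClass R L n))
    (fun n => (Submodule.mkQ_surjective _).comp (homologyClass_surjective L n))
    (fun n x => by
      refine (Submodule.Quotient.mk_eq_zero _).trans ⟨?_, fun hx => ?_⟩
      · rintro ⟨y, hy⟩
        obtain ⟨y, rfl⟩ := homologyClass_surjective L' n y
        rw [homologyMap_homologyClass h, eq_comm, ← sub_eq_zero, ← map_sub, homologyClass_eq_zero]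
          at hy
        rw [← add_sub_cancel y.1 x.1]
        exact Submodule.add_mem_sup
          ⟨y.2.1.1, supported_mono_of_le h y.2.1.1, y.2.1.2⟩ hy
      · obtain ⟨a, ha, b, hb, e⟩ := Submodule.mem_sup.1 hx
        -- The summands `a` and `b` need not be homogeneous, so both are projected to degree `n`.
        have ha1 := (homE.inf (homF.inf homK)) n a ha
        have hb1 := homF.map simplicialBoundary_deg n b hb
        have e1 : degProj simplexDeg R n a + degProj simplexDeg R n b = x.1 := by
          rw [← map_add, e, degProj_of_mem x.2.2]
        refine ⟨homologyClass R L' n ⟨degProj simplexDeg R n a, ⟨ha1.1, ha1.2.2⟩,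
          degProj_mem _ _⟩, ?_⟩
        rw [homologyMap_homologyClass h, eq_comm, ← sub_eq_zero, ← map_sub, homologyClass_eq_zero]
        change x.1 - degProj simplexDeg R n a ∈ _
        rw [← e1, add_sub_cancel_left]
        exact hb1)
  have hfin : Finite (SimplicialGen R h) := F.finite_gen
  refine ⟨hfin, fun _ => ?_⟩
  have e : (fun g : SimplicialGen R h => F.kdeg g.1 g.2) = fun g => g.2.1 :=
    funext fun g => hkdeg _ _
  rw [← e]
  exact ⟨F.retract simplicialBoundary_deg hE⟩

end SimplicialPair

/-! ### Direct sums of based complexes -/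

section Sigma

variable {R : Type u} [CommRing R] {ι : Type} [DecidableEq ι]

theorem Matrix.blockDiagonal'_ne_zero {m n : ι → Type} {M : ∀ i, Matrix (m i) (n i) R}
    {y : Σ i, m i} {x : Σ i, n i} (h : Matrix.blockDiagonal' M y x ≠ 0) :
    ∃ i a b, y = ⟨i, a⟩ ∧ x = ⟨i, b⟩ ∧ M i a b ≠ 0 := by
  obtain ⟨i, a⟩ := y
  obtain ⟨j, b⟩ := x
  by_cases hij : i = j
  · subst hij
    rw [Matrix.blockDiagonal'_apply_eq] at h
    exact ⟨i, a, b, rfl, rfl, h⟩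
  · exact absurd (Matrix.blockDiagonal'_apply_ne M a b hij) h

variable [Fintype ι]

/-- The direct sum of a family of based complexes. -/
def BasedPair.sigma (P : ι → BasedPair R) : BasedPair R where
  B := Σ i, (P i).B
  fintype := inferInstance
  decEq := inferInstance
  deg x := (P x.1).deg x.2
  low x := (P x.1).low x.2
  d := Matrix.blockDiagonal' fun i => (P i).d
  d_deg x y h := by
    obtain ⟨i, a, b, rfl, rfl, h'⟩ := Matrix.blockDiagonal'_ne_zero h
    exact (P i).d_deg b a h'
  d_low x y h := by
    obtain ⟨i, a, b, rfl, rfl, h'⟩ := Matrix.blockDiagonal'_ne_zero h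
    exact (P i).d_low b a h'

/-- The direct sum of a family of retractions. -/
def BasedRetract.sigma {P Q : ι → BasedPair R} (E : ∀ i, BasedRetract (P i) (Q i)) :
    BasedRetract (BasedPair.sigma P) (BasedPair.sigma Q) where
  φ := Matrix.blockDiagonal' fun i => (E i).φ
  ψ := Matrix.blockDiagonal' fun i => (E i).ψ
  h := Matrix.blockDiagonal' fun i => (E i).h
  φ_supp x y h := by
    obtain ⟨i, a, b, rfl, rfl, h'⟩ := Matrix.blockDiagonal'_ne_zero h
    exact (E i).φ_supp b a h'
  ψ_supp x y h := by
    obtain ⟨i, a, b, rfl, rfl, h'⟩ := Matrix.blockDiagonal'_ne_zero h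
    exact (E i).ψ_supp b a h'
  h_supp x y h := by
    obtain ⟨i, a, b, rfl, rfl, h'⟩ := Matrix.blockDiagonal'_ne_zero h
    exact (E i).h_supp b a h'
  d_φ := (Matrix.blockDiagonal'_mul (fun i => (P i).d) fun i => (E i).φ).symm.trans
    ((congrArg _ (funext fun i => (E i).d_φ)).trans
      (Matrix.blockDiagonal'_mul (fun i => (E i).φ) fun i => (Q i).d))
  d_ψ := (Matrix.blockDiagonal'_mul (fun i => (Q i).d) fun i => (E i).ψ).symm.trans
    ((congrArg _ (funext fun i => (E i).d_ψ)).trans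
      (Matrix.blockDiagonal'_mul (fun i => (E i).ψ) fun i => (P i).d))
  ψ_φ := (Matrix.blockDiagonal'_mul (fun i => (E i).ψ) fun i => (E i).φ).symm.trans
    ((congrArg _ (funext fun i => (E i).ψ_φ)).trans Matrix.blockDiagonal'_one)
  homotopy := by
    have e1 := Matrix.blockDiagonal'_mul (fun i => (E i).φ) fun i => (E i).ψ
    have e2 := Matrix.blockDiagonal'_mul (fun i => (P i).d) fun i => (E i).h
    have e3 := Matrix.blockDiagonal'_mul (fun i => (E i).h) fun i => (P i).d
    have e4 : (Matrix.blockDiagonal' fun i => (E i).φ * (E i).ψ) +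
        (Matrix.blockDiagonal' fun i => (P i).d * (E i).h) +
        (Matrix.blockDiagonal' fun i => (E i).h * (P i).d) = 1 := by
      rw [← Matrix.blockDiagonal'_add, ← Matrix.blockDiagonal'_add, ← Matrix.blockDiagonal'_one]
      exact congrArg _ (funext fun i => (E i).homotopy)
    rw [e1, e2, e3] at e4
    exact e4

/-- Relabelling the basis of the target of a retraction. -/
def BasedRetract.reindex {P Q Q' : BasedPair R} (E : BasedRetract P Q) (e : Q'.B ≃ Q.B)
    (hdeg : ∀ x, Q.deg (e x) = Q'.deg x) (hlow : ∀ x, Q.low (e x) ↔ Q'.low x)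
    (hd : ∀ y x, Q.d (e y) (e x) = Q'.d y x) : BasedRetract P Q' where
  φ := E.φ.submatrix id e
  ψ := E.ψ.submatrix e id
  h := E.h
  φ_supp x y h := by
    rw [← hdeg, ← hlow]
    exact E.φ_supp _ _ h
  ψ_supp x y h := by
    rw [← hdeg, ← hlow]
    exact E.ψ_supp _ _ h
  h_supp := E.h_supp
  d_φ := by
    have e1 : Q'.d = Q.d.submatrix e e := by
      ext y x
      exact (hd y x).symm
    rw [e1, Matrix.submatrix_mul_equiv, ← E.d_φ]
    rfl
  d_ψ := by
    have e1 : Q'.d = Q.d.submatrix e e := by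
      ext y x
      exact (hd y x).symm
    rw [e1, Matrix.submatrix_mul_equiv, E.d_ψ]
    rfl
  ψ_φ := by
    have : E.ψ.submatrix e id * E.φ.submatrix id e = (E.ψ * E.φ).submatrix e e := rfl
    rw [this, E.ψ_φ, Matrix.submatrix_one_equiv]
  homotopy := by
    rw [Matrix.submatrix_mul_equiv, Matrix.submatrix_id_id]
    exact E.homotopy

/-- The basis of a direct sum of normal forms. -/
def NormalBasis.sigmaEquiv {G : ι → Type} (kind : ∀ i, G i → PointIndex) :
    NormalBasis (Σ i, G i) (fun g => kind g.1 g.2) ≃ Σ i, NormalBasis (G i) (kind i) where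
  toFun x := ⟨x.gen.1, x.gen.2, x.up, x.kind_gen⟩
  invFun x := ⟨⟨x.1, x.2.gen⟩, x.2.up, x.2.kind_gen⟩
  left_inv _ := rfl
  right_inv _ := rfl

/-- A direct sum of complexes that retract to normal forms retracts to a normal form. -/
noncomputable def BasedRetract.sigmaNormal {P : ι → BasedPair R} {G : ι → Type} [∀ i, Finite (G i)]
    {kind : ∀ i, G i → PointIndex} {deg : ∀ i, G i → ℤ}
    (E : ∀ i, BasedRetract (P i) (normalPair R (G i) (kind i) (deg i))) :
    BasedRetract (BasedPair.sigma P)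
      (normalPair R (Σ i, G i) (fun g => kind g.1 g.2) (fun g => deg g.1 g.2)) :=
  (BasedRetract.sigma E).reindex (NormalBasis.sigmaEquiv kind) (fun _ => rfl) (fun _ => Iff.rfl)
    (by
      rintro ⟨⟨i, g⟩, b, h⟩ ⟨⟨i', g'⟩, b', h'⟩
      by_cases hi : i = i'
      · subst hi
        refine (Matrix.blockDiagonal'_apply_eq
          (fun i => (normalPair R (G i) (kind i) (deg i)).d) _ _ _).trans ?_
        refine if_congr (and_congr_right fun _ => ?_) rfl rfl
        rw [NormalBasis.ext_iff, NormalBasis.ext_iff]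
        simp [NormalBasis.lower]
      · refine (Matrix.blockDiagonal'_apply_ne
          (fun i => (normalPair R (G i) (kind i) (deg i)).d) _ _ hi).trans (Eq.symm (if_neg ?_))
        rintro ⟨-, h⟩
        exact hi (congrArg (fun x => x.gen.1) h))

end Sigma

/-! ### The sum over the links of one factor -/

section Block

variable {R : Type u} [CommRing R] {V : Type} [LinearOrder V] [Finite V]

/-- The direct sum of the filtered complexes of the links `A_{σ,ω} ⊆ X_{σ,ω}`, for `(σ, ω) ∈ S`. -/
noncomputable def blockPair (R : Type u) [CommRing R] (A X : SComplex V)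
    (S : Set (Finset V × Finset V)) : BasedPair R :=
  @BasedPair.sigma R _ S (Classical.decEq _) (Fintype.ofFinite _) fun p =>
    simplicialPair R (A.link p.1.1 p.1.2) (X.link p.1.1 p.1.2)

namespace blockPair

variable {A X : SComplex V} {S : Set (Finset V × Finset V)}

/-- The index of a basis element. -/
def index (x : (blockPair R A X S).B) : Finset V × Finset V :=
  (show Σ p : S, {s // s ∈ X.link p.1.1 p.1.2} from x).1.1

/-- The simplex of a basis element. -/
def simplex (x : (blockPair R A X S).B) : Finset V :=
  (show Σ p : S, {s // s ∈ X.link p.1.1 p.1.2} from x).2.1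

/-- The basis element with the given index and simplex. -/
def mk (p : Finset V × Finset V) (hp : p ∈ S) (τ : Finset V) (hτ : τ ∈ X.link p.1 p.2) :
    (blockPair R A X S).B :=
  (⟨⟨p, hp⟩, ⟨τ, hτ⟩⟩ : Σ p : S, {s // s ∈ X.link p.1.1 p.1.2})

theorem index_mem (x : (blockPair R A X S).B) : index x ∈ S :=
  (show Σ p : S, {s // s ∈ X.link p.1.1 p.1.2} from x).1.2

theorem simplex_mem (x : (blockPair R A X S).B) : simplex x ∈ X.link (index x).1 (index x).2 :=
  (show Σ p : S, {s // s ∈ X.link p.1.1 p.1.2} from x).2.2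

theorem index_mk (p : Finset V × Finset V) (hp : p ∈ S) (τ : Finset V) (hτ : τ ∈ X.link p.1 p.2) :
    index (mk p hp τ hτ : (blockPair R A X S).B) = p := rfl

theorem simplex_mk (p : Finset V × Finset V) (hp : p ∈ S) (τ : Finset V)
    (hτ : τ ∈ X.link p.1 p.2) : simplex (mk p hp τ hτ : (blockPair R A X S).B) = τ := rfl

theorem ext {x y : (blockPair R A X S).B} (h1 : index x = index y) (h2 : simplex x = simplex y) :
    x = y := by
  obtain ⟨⟨p, hp⟩, ⟨τ, hτ⟩⟩ := x
  obtain ⟨⟨p', hp'⟩, ⟨τ', hτ'⟩⟩ := y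
  obtain rfl : p = p' := h1
  obtain rfl : τ = τ' := h2
  rfl

theorem low_iff (x : (blockPair R A X S).B) :
    (blockPair R A X S).low x ↔ simplex x ∈ A.link (index x).1 (index x).2 := Iff.rfl

/-- Removing a vertex of the simplex of a basis element. -/
def erase (x : (blockPair R A X S).B) (i : V) : (blockPair R A X S).B :=
  mk (index x) (index_mem x) ((simplex x).erase i)
    ((X.link _ _).lower (Finset.erase_subset _ _) (simplex_mem x))

theorem eq_erase_iff {x y : (blockPair R A X S).B} {i : V} :
    y = erase x i ↔ index y = index x ∧ simplex y = (simplex x).erase i :=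
  ⟨fun h => h ▸ ⟨rfl, rfl⟩, fun h => ext h.1 h.2⟩

theorem d_apply (y x : (blockPair R A X S).B) : (blockPair R A X S).d y x =
    ∑ i ∈ simplex x, if y = erase x i then
      (-1 : R) ^ ((simplex x).filter (· < i)).card else 0 := by
  obtain ⟨⟨p, hp⟩, ⟨τ, hτ⟩⟩ := x
  obtain ⟨⟨p', hp'⟩, ⟨τ', hτ'⟩⟩ := y
  by_cases h : p' = p
  · subst h
    let _ : DecidableEq S := Classical.decEq _
    refine (Matrix.blockDiagonal'_apply_eq (fun p : S =>
      (simplicialPair R (A.link p.1.1 p.1.2) (X.link p.1.1 p.1.2)).d) _ _ _).trans ?_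
    have e : simplicialBoundary R V (Finsupp.single τ 1) τ' =
        ∑ i ∈ τ, Finsupp.single (τ.erase i) ((-1 : R) ^ (τ.filter (· < i)).card) τ' := by
      rw [simplicialBoundary, altBoundary, Finsupp.linearCombination_single, one_smul,
        Finsupp.finsetSum_apply]
    refine Eq.trans e (Finset.sum_congr rfl fun i _ => (Finsupp.single_apply).trans ?_)
    have hiff := eq_erase_iff (x := (mk p' hp τ hτ : (blockPair R A X S).B))
      (y := mk p' hp' τ' hτ') (i := i)
    by_cases hi : τ.erase i = τ'
    · exact (if_pos hi).trans (if_pos (hiff.2 ⟨rfl, hi.symm⟩)).symm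
    · exact (if_neg hi).trans (if_neg fun h => hi (hiff.1 h).2.symm).symm
  · let _ : DecidableEq S := Classical.decEq _
    refine (Matrix.blockDiagonal'_apply_ne (fun p : S =>
      (simplicialPair R (A.link p.1.1 p.1.2) (X.link p.1.1 p.1.2)).d) _ _
      (fun h' => h (congrArg Subtype.val h'))).trans ?_
    refine (Finset.sum_eq_zero fun i _ => if_neg fun h' => h ?_).symm
    exact congrArg index h'

theorem sum_d_smul {M : Type*} [AddCommGroup M] [Module R M] (x : (blockPair R A X S).B)
    (f : (blockPair R A X S).B → M) :
    ∑ y, (blockPair R A X S).d y x • f y =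
      ∑ i ∈ simplex x, (-1 : R) ^ ((simplex x).filter (· < i)).card • f (erase x i) := by
  simp only [d_apply, Finset.sum_smul]
  rw [Finset.sum_comm]
  refine Finset.sum_congr rfl fun i _ => ?_
  simp only [ite_smul, zero_smul]
  rw [Finset.sum_ite_eq' Finset.univ, if_pos (Finset.mem_univ _)]

/-- The word of a basis element. -/
def word (x : (blockPair R A X S).B) (i : V) : Letter :=
  if i ∈ (index x).1 then .α else if i ∈ simplex x then .β else if i ∈ (index x).2 then .γ else .η

theorem word_eq_alpha (x : (blockPair R A X S).B) (i : V) : word x i = .α ↔ i ∈ (index x).1 := by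
  rw [word]
  split_ifs <;> simp [*]

theorem word_eq_beta (hS : S ⊆ totalIndex V) (x : (blockPair R A X S).B) (i : V) :
    word x i = .β ↔ i ∈ simplex x := by
  have h1 : i ∈ (index x).1 → i ∉ (index x).2 := fun hi =>
    Finset.disjoint_left.1 (hS (index_mem x)) hi
  have h2 : i ∈ simplex x → i ∈ (index x).2 := fun hi => (simplex_mem x).1 hi
  rw [word]
  split_ifs <;> simp_all

theorem word_eq_beta_or_gamma (hS : S ⊆ totalIndex V) (x : (blockPair R A X S).B) (i : V) :
    word x i = .β ∨ word x i = .γ ↔ i ∈ (index x).2 := by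
  have h1 : i ∈ (index x).1 → i ∉ (index x).2 := fun hi =>
    Finset.disjoint_left.1 (hS (index_mem x)) hi
  have h2 : i ∈ simplex x → i ∈ (index x).2 := fun hi => (simplex_mem x).1 hi
  rw [word]
  split_ifs <;> simp_all

/-- A vertex of the simplex lies in `ω`, hence not in `σ`; after its removal the letter there is
`γ`. -/
theorem word_erase (hS : S ⊆ totalIndex V) (x : (blockPair R A X S).B) {i : V}
    (hi : i ∈ simplex x) : word (erase x i) = Function.update (word x) i .γ := by
  have h2 : i ∈ (index x).2 := (simplex_mem x).1 hi
  have h1 : i ∉ (index x).1 := Finset.disjoint_right.1 (hS (index_mem x)) h2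
  funext j
  have e1 : index (erase x i) = index x := rfl
  have e2 : simplex (erase x i) = (simplex x).erase i := rfl
  rw [word, e1, e2]
  by_cases hj : j = i
  · subst hj
    simp [h1, h2]
  · rw [Function.update_of_ne hj, word]
    simp [hj]

end blockPair

end Block

/-! ### The total complex of a polyhedral join as a tensor product over `K` -/

section Join

variable {m : ℕ} {n : Fin m → ℕ}

theorem mem_blockPart {σ : Finset (JoinVertex n)} {k : Fin m} {i : Fin (n k)} :
    i ∈ blockPart σ k ↔ toLex (⟨k, i⟩ : Σ k : Fin m, Fin (n k)) ∈ σ := by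
  simp [blockPart]

theorem sum_blockPart {M : Type*} [AddCommMonoid M] (s : Finset (JoinVertex n))
    (f : JoinVertex n → M) :
    ∑ v ∈ s, f v = ∑ k, ∑ i ∈ blockPart s k, f (toLex ⟨k, i⟩) := by
  rw [Finset.sum_sigma']
  refine Finset.sum_bij' (fun v _ => ofLex v) (fun v _ => toLex v) ?_ ?_ (fun _ _ => rfl)
    (fun _ _ => rfl) (fun _ _ => rfl)
  · intro v hv
    exact Finset.mem_sigma.2 ⟨Finset.mem_univ _, mem_blockPart.2 hv⟩
  · intro v hv
    exact mem_blockPart.1 (Finset.mem_sigma.1 hv).2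

theorem card_eq_sum_blockPart (s : Finset (JoinVertex n)) :
    s.card = ∑ k, (blockPart s k).card := by
  simp only [Finset.card_eq_sum_ones]
  exact sum_blockPart s _

/-- In the lexicographic order the earlier vertices are all those of earlier blocks and the earlier
ones of the same block. This is the compatibility of signs between the tensor differential and the
word differential. -/
theorem card_filter_lt (s : Finset (JoinVertex n)) (k : Fin m) (i : Fin (n k)) :
    (s.filter (· < toLex ⟨k, i⟩)).card =
      ∑ j with j < k, (blockPart s j).card + ((blockPart s k).filter (· < i)).card := by
  have h1 : ∀ j, blockPart (s.filter (· < toLex ⟨k, i⟩)) j =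
      if j < k then blockPart s j else
        (blockPart s j).filter fun l => toLex (⟨j, l⟩ : Σ k : Fin m, Fin (n k)) < toLex ⟨k, i⟩ := by
    intro j
    split_ifs with hj
    · ext l
      rw [mem_blockPart, mem_blockPart, Finset.mem_filter]
      exact and_iff_left (Sigma.Lex.lt_def.2 (Or.inl hj))
    · ext l
      rw [mem_blockPart, Finset.mem_filter, Finset.mem_filter, mem_blockPart]
  have h2 : ∀ j, (blockPart (s.filter (· < toLex ⟨k, i⟩)) j).card =
      (if j < k then (blockPart s j).card else 0) +
        if j = k then ((blockPart s k).filter (· < i)).card else 0 := by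
    intro j
    rw [h1]
    split_ifs with h3 h4 h4
    · exact absurd h4 h3.ne
    · rw [add_zero]
    · subst h4
      rw [zero_add]
      congr 1
      refine Finset.filter_congr fun l _ => ?_
      rw [Sigma.Lex.lt_def]
      constructor
      · rintro (h5 | ⟨_, h5⟩)
        · exact absurd h5 (lt_irrefl j)
        · exact h5
      · exact fun h5 => Or.inr ⟨rfl, h5⟩
    · rw [add_zero, Finset.card_eq_zero, Finset.filter_eq_empty_iff]
      intro l _ h5
      rcases Sigma.Lex.lt_def.1 h5 with h6 | ⟨h6, -⟩
      · exact h3 h6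
      · exact h4 h6
  rw [card_eq_sum_blockPart, Finset.sum_congr rfl fun j _ => h2 j, Finset.sum_add_distrib,
    Finset.sum_filter]
  simp

variable {R : Type u} [CommRing R] {X A : (k : Fin m) → SComplex (Fin (n k))}
  {S : (k : Fin m) → Set (Finset (Fin (n k)) × Finset (Fin (n k)))}

/-- The word of a basis element of the tensor product of the blocks. -/
def joinWord (b : ∀ k, (blockPair R (A k) (X k) (S k)).B) (v : JoinVertex n) : Letter :=
  blockPair.word (b (ofLex v).1) (ofLex v).2

theorem blockPart_betaSet_joinWord (hS : ∀ k, S k ⊆ totalIndex (Fin (n k)))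
    (b : ∀ k, (blockPair R (A k) (X k) (S k)).B) (k : Fin m) :
    blockPart (betaSet (joinWord b)) k = blockPair.simplex (b k) := by
  ext i
  rw [mem_blockPart, mem_betaSet]
  exact blockPair.word_eq_beta (hS k) (b k) i

theorem indexPart_wordIndex_joinWord (hS : ∀ k, S k ⊆ totalIndex (Fin (n k)))
    (b : ∀ k, (blockPair R (A k) (X k) (S k)).B) (k : Fin m) :
    indexPart (wordIndex (joinWord b)) k = blockPair.index (b k) := by
  refine Prod.ext (Finset.ext fun i => ?_) (Finset.ext fun i => ?_)
  · refine mem_blockPart.trans (mem_wordIndex_fst.trans ?_)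
    exact blockPair.word_eq_alpha (b k) i
  · refine mem_blockPart.trans (mem_wordIndex_snd.trans ?_)
    exact blockPair.word_eq_beta_or_gamma (hS k) (b k) i

theorem joinWord_injective (hS : ∀ k, S k ⊆ totalIndex (Fin (n k))) :
    Function.Injective (joinWord (R := R) (A := A) (X := X) (S := S)) := by
  intro b b' h
  funext k
  refine blockPair.ext ?_ ?_
  · rw [← indexPart_wordIndex_joinWord hS, h, indexPart_wordIndex_joinWord hS]
  · rw [← blockPart_betaSet_joinWord hS, h, blockPart_betaSet_joinWord hS]

theorem blockPart_faceSet (w : JoinVertex n → Letter) (k : Fin m) :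
    blockPart (faceSet w) k = blockPart (wordIndex w).1 k ∪ blockPart (betaSet w) k := by
  ext i
  rw [Finset.mem_union, mem_blockPart, mem_blockPart, mem_blockPart, mem_faceSet,
    mem_wordIndex_fst, mem_betaSet]

theorem blockPart_faceSet_joinWord (hS : ∀ k, S k ⊆ totalIndex (Fin (n k)))
    (b : ∀ k, (blockPair R (A k) (X k) (S k)).B) (k : Fin m) :
    blockPart (faceSet (joinWord b)) k =
      (blockPair.index (b k)).1 ∪ blockPair.simplex (b k) := by
  rw [blockPart_faceSet, blockPart_betaSet_joinWord hS,
    ← indexPart_wordIndex_joinWord hS]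
  rfl

/-- The condition at the blocks of `τ` is automatic, since basis elements come from links in `X k`;
the one at the other blocks is membership in the subcomplex. -/
theorem faceSet_joinWord_mem_polyhedralJoin (hS : ∀ k, S k ⊆ totalIndex (Fin (n k)))
    (K : SComplex (Fin m)) (b : ∀ k, (blockPair R (A k) (X k) (S k)).B) :
    faceSet (joinWord b) ∈ polyhedralJoin K X A ↔
      ∃ τ ∈ K, ∀ k, k ∉ τ → (blockPair R (A k) (X k) (S k)).low (b k) := by
  refine exists_congr fun τ => and_congr_right fun _ => forall_congr' fun k => ?_
  rw [blockPart_faceSet_joinWord hS, blockPair.low_iff]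
  have h := blockPair.simplex_mem (b k)
  split_ifs with hk
  · exact ⟨fun _ hk' => absurd hk hk', fun _ => h.2⟩
  · exact ⟨fun h' _ => ⟨h.1, h'⟩, fun h' => (h' hk).2⟩

theorem mem_joinBasis_iff_joinWord (hS : ∀ k, S k ⊆ totalIndex (Fin (n k)))
    (K : SComplex (Fin m)) (b : ∀ k, (blockPair R (A k) (X k) (S k)).B) (d : ℤ) :
    b ∈ BasedPair.joinBasis K (fun k => blockPair R (A k) (X k) (S k)) d ↔
      faceSet (joinWord b) ∈ polyhedralJoin K X A ∧ ((betaSet (joinWord b)).card : ℤ) = d := by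
  rw [faceSet_joinWord_mem_polyhedralJoin hS, card_eq_sum_blockPart, Nat.cast_sum]
  simp only [blockPart_betaSet_joinWord hS]
  rfl

/-- Since `A k ≤ X k`, every block of the face set lies in `X k`; the positions of `β` in a block
then form a simplex of the link at the index of that block. -/
theorem exists_joinWord (hAX : ∀ k, A k ≤ X k) {K : SComplex (Fin m)} {w : JoinVertex n → Letter}
    (h1 : faceSet w ∈ polyhedralJoin K X A) (h2 : wordIndex w ∈ joinIndex S) :
    ∃ b : ∀ k, (blockPair R (A k) (X k) (S k)).B, joinWord b = w := by
  obtain ⟨τ, -, hτ⟩ := h1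
  have hX : ∀ k, blockPart (faceSet w) k ∈ X k := fun k => by
    have := hτ k
    split_ifs at this
    · exact this
    · exact hAX k this
  have hmem : ∀ k, blockPart (betaSet w) k ∈
      (X k).link (indexPart (wordIndex w) k).1 (indexPart (wordIndex w) k).2 := fun k => by
    refine ⟨fun i hi => ?_, ?_⟩
    · rw [mem_blockPart, mem_betaSet] at hi
      exact mem_blockPart.2 (mem_wordIndex_snd.2 (Or.inl hi))
    · have := hX k
      rw [blockPart_faceSet] at this
      exact this
  refine ⟨fun k => blockPair.mk (indexPart (wordIndex w) k) (h2 k) (blockPart (betaSet w) k)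
    (hmem k), ?_⟩
  funext v
  have e1 : (ofLex v).2 ∈ (indexPart (wordIndex w) (ofLex v).1).1 ↔ w v = .α :=
    mem_blockPart.trans mem_wordIndex_fst
  have e2 : (ofLex v).2 ∈ blockPart (betaSet w) (ofLex v).1 ↔ w v = .β :=
    mem_blockPart.trans mem_betaSet
  have e3 : (ofLex v).2 ∈ (indexPart (wordIndex w) (ofLex v).1).2 ↔ w v = .β ∨ w v = .γ :=
    mem_blockPart.trans mem_wordIndex_snd
  rw [joinWord, blockPair.word, blockPair.index_mk, blockPair.simplex_mk]
  simp only [e1, e2, e3]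
  cases w v <;> simp

theorem joinWord_update_erase (hS : ∀ k, S k ⊆ totalIndex (Fin (n k)))
    (b : ∀ k, (blockPair R (A k) (X k) (S k)).B) (k : Fin m) {i : Fin (n k)}
    (hi : i ∈ blockPair.simplex (b k)) :
    joinWord (Function.update b k (blockPair.erase (b k) i)) =
      Function.update (joinWord b) (toLex ⟨k, i⟩) .γ := by
  funext v
  obtain ⟨⟨j, l⟩, rfl⟩ := toLex.surjective v
  by_cases hj : j = k
  · subst hj
    change blockPair.word (Function.update b j (blockPair.erase (b j) i) j) l = _
    rw [Function.update_self, blockPair.word_erase (hS j) _ hi]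
    by_cases hl : l = i
    · subst hl
      exact (Function.update_self l .γ (blockPair.word (b j))).trans
        (Function.update_self (toLex ⟨j, l⟩ : JoinVertex n) .γ (joinWord b)).symm
    · rw [Function.update_of_ne hl, Function.update_of_ne]
      · rfl
      · intro h
        exact hl (by simpa using toLex.injective h)
  · change blockPair.word (Function.update b k (blockPair.erase (b k) i) j) l = _
    rw [Function.update_of_ne hj, Function.update_of_ne]
    · rfl
    · intro h
      exact hj (congrArg (fun v : JoinVertex n => (ofLex v).1) h)

/-- The linear map to the words of the polyhedral join. -/
noncomputable def toJoinWords :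
    ((∀ k, (blockPair R (A k) (X k) (S k)).B) → R) →ₗ[R] ((JoinVertex n → Letter) →₀ R) :=
  Fintype.linearCombination R fun b => Finsupp.single (joinWord b) 1

theorem toJoinWords_single (b : ∀ k, (blockPair R (A k) (X k) (S k)).B) :
    toJoinWords (Pi.single b (1 : R)) = Finsupp.single (joinWord b) 1 := by
  rw [toJoinWords, Fintype.linearCombination_apply_single, one_smul]

/-- No sign correction is needed here: the degree of a basis element is its number of letters `β`,
so the tensor sign counts those in earlier blocks and the simplicial sign those earlier in the same
block. -/
theorem toJoinWords_tensorD (hS : ∀ k, S k ⊆ totalIndex (Fin (n k)))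
    (x : (∀ k, (blockPair R (A k) (X k) (S k)).B) → R) :
    toJoinWords ((BasedPair.tensorD fun k => blockPair R (A k) (X k) (S k)).mulVecLin x) =
      wordBoundary R (JoinVertex n) (toJoinWords x) := by
  suffices h : toJoinWords ∘ₗ
      (BasedPair.tensorD fun k => blockPair R (A k) (X k) (S k)).mulVecLin =
      wordBoundary R (JoinVertex n) ∘ₗ toJoinWords from LinearMap.congr_fun h x
  refine (Pi.basisFun R _).ext fun b => ?_
  rw [Pi.basisFun_apply, LinearMap.comp_apply, LinearMap.comp_apply, toJoinWords_single,
    Matrix.mulVecLin_apply, BasedPair.tensorD_single, wordBoundary, altBoundary,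
    Finsupp.linearCombination_single, one_smul, sum_blockPart, map_sum]
  refine Finset.sum_congr rfl fun k _ => ?_
  rw [blockPair.sum_d_smul, blockPart_betaSet_joinWord hS, Finset.smul_sum, map_sum]
  refine Finset.sum_congr rfl fun i hi => ?_
  rw [map_smul, map_smul, toJoinWords_single, joinWord_update_erase hS b k hi, card_filter_lt,
    Finsupp.smul_single, Finsupp.smul_single]
  simp only [blockPart_betaSet_joinWord hS]
  congr 1
  rw [pow_add, ← intSign_natCast, ← intSign_natCast, Nat.cast_sum, smul_eq_mul, smul_eq_mul, mul_one]
  rfl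

theorem toJoinWords_apply (hS : ∀ k, S k ⊆ totalIndex (Fin (n k)))
    (x : (∀ k, (blockPair R (A k) (X k) (S k)).B) → R)
    (b : ∀ k, (blockPair R (A k) (X k) (S k)).B) : toJoinWords x (joinWord b) = x b := by
  rw [toJoinWords, Fintype.linearCombination_apply, Finsupp.finsetSum_apply,
    Finset.sum_eq_single b]
  · simp
  · intro b' _ hne
    rw [Finsupp.smul_apply, Finsupp.single_eq_of_ne, smul_zero]
    intro h
    exact hne (joinWord_injective hS h).symm
  · intro h
    exact absurd (Finset.mem_univ _) h

theorem exists_of_toJoinWords_apply_ne_zero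
    {x : (∀ k, (blockPair R (A k) (X k) (S k)).B) → R} {w : JoinVertex n → Letter}
    (h : toJoinWords x w ≠ 0) : ∃ b, joinWord b = w ∧ x b ≠ 0 := by
  rw [toJoinWords, Fintype.linearCombination_apply, Finsupp.finsetSum_apply] at h
  obtain ⟨b, -, hb⟩ := Finset.exists_ne_zero_of_sum_ne_zero h
  rw [Finsupp.smul_apply] at hb
  refine ⟨b, ?_, left_ne_zero_of_smul hb⟩
  by_contra h1
  exact right_ne_zero_of_smul hb (Finsupp.single_eq_of_ne (Ne.symm h1))

theorem toJoinWords_mem (hS : ∀ k, S k ⊆ totalIndex (Fin (n k))) (K : SComplex (Fin m)) (d : ℤ)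
    {x : (∀ k, (blockPair R (A k) (X k) (S k)).B) → R}
    (hx : x ∈ supportedOn R
      (BasedPair.joinBasis K (fun k => blockPair R (A k) (X k) (S k)) d)) :
    toJoinWords x ∈ (totalComplex R (polyhedralJoin K X A) (joinIndex S)).C d := by
  rw [totalComplex, Finsupp.mem_supported]
  intro w hw
  obtain ⟨b, rfl, hb⟩ := exists_of_toJoinWords_apply_ne_zero (Finsupp.mem_support_iff.1 hw)
  obtain ⟨h1, h2⟩ := (mem_joinBasis_iff_joinWord hS K b d).1 (hx b hb)
  refine ⟨h1, fun k => ?_, h2⟩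
  rw [indexPart_wordIndex_joinWord hS]
  exact blockPair.index_mem (b k)

/-- The total complex of a polyhedral join is the tensor product of the blocks over `K`. -/
noncomputable def joinWordsRetract (hAX : ∀ k, A k ≤ X k)
    (hS : ∀ k, S k ⊆ totalIndex (Fin (n k))) (K : SComplex (Fin m)) :
    GradedRetract (BasedPair.joinDiff K fun k => blockPair R (A k) (X k) (S k))
      (totalComplex R (polyhedralJoin K X A) (joinIndex S)).diff :=
  GradedRetract.ofBijective
    (fun d => toJoinWords.restrict fun _ hx => toJoinWords_mem hS K d hx)
    (fun d => by
      constructor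
      · rw [injective_iff_map_eq_zero]
        rintro ⟨x, hx⟩ h
        refine Subtype.ext (funext fun b => ?_)
        have h1 : toJoinWords x = 0 := congrArg Subtype.val h
        have h2 := toJoinWords_apply hS x b
        rw [h1, Finsupp.zero_apply] at h2
        exact h2.symm
      · intro y
        refine ⟨⟨fun b => y.1 (joinWord b), fun b hb => ?_⟩, Subtype.ext (Finsupp.ext fun w => ?_)⟩
        · have := (Finsupp.mem_supported _ _).1 y.2 (Finsupp.mem_support_iff.2 hb)
          exact (mem_joinBasis_iff_joinWord hS K b d).2 ⟨this.1, this.2.2⟩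
        · change toJoinWords _ w = y.1 w
          by_cases hw : ∃ b : ∀ k, (blockPair R (A k) (X k) (S k)).B, joinWord b = w
          · obtain ⟨b, rfl⟩ := hw
            exact toJoinWords_apply hS _ b
          · trans 0
            · by_contra h
              obtain ⟨b, hb, -⟩ := exists_of_toJoinWords_apply_ne_zero h
              exact hw ⟨b, hb⟩
            · by_contra h
              have := (Finsupp.mem_supported _ _).1 y.2 (Finsupp.mem_support_iff.2 (Ne.symm h))
              exact hw (exists_joinWord hAX this.1 this.2.1))
    (fun i j hij => LinearMap.ext fun x => Subtype.ext (toJoinWords_tensorD hS x.1))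

end Join

/-! ### Splittings and extensions of linear maps -/

section Extension

variable {R : Type u} [CommRing R] {M N P : Type*} [AddCommGroup M] [Module R M]
  [AddCommGroup N] [Module R N] [AddCommGroup P] [Module R P]

theorem exists_equiv_ker_prod (f : M →ₗ[R] N) (hf : Function.Surjective f)
    [Module.Projective R N] : Nonempty (M ≃ₗ[R] LinearMap.ker f × N) := by
  obtain ⟨g, hg⟩ := f.exists_rightInverse_of_surjective (LinearMap.range_eq_top.2 hf)
  have hg' : ∀ y, f (g y) = y := LinearMap.congr_fun hg
  refine ⟨LinearEquiv.ofLinearMap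
    (LinearMap.prod (LinearMap.codRestrict _ (LinearMap.id - g ∘ₗ f) fun x => ?_) f)
    (LinearMap.coprod (LinearMap.ker f).subtype g) ?_ ?_⟩
  · rw [LinearMap.mem_ker, LinearMap.sub_apply, map_sub, LinearMap.comp_apply, hg',
      LinearMap.id_apply, sub_self]
  · ext x
    · simp
    · simp
    · simp [hg']
    · simp [hg']
  · ext x
    simp

/-- A section `g` of `f` onto its range exists by projectivity, and `id - g f` projects onto the
kernel. -/
theorem exists_extend_ker (f : M →ₗ[R] N) [Module.Projective R (LinearMap.range f)]
    (φ : LinearMap.ker f →ₗ[R] P) : ∃ ψ : M →ₗ[R] P, ∀ x : LinearMap.ker f, ψ x = φ x := by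
  obtain ⟨g, hg⟩ := f.rangeRestrict.exists_rightInverse_of_surjective
    (LinearMap.range_eq_top.2 f.surjective_rangeRestrict)
  have hg' : ∀ y, f (g y) = y := fun y => congrArg Subtype.val (LinearMap.congr_fun hg y)
  refine ⟨φ ∘ₗ LinearMap.codRestrict _ (LinearMap.id - g ∘ₗ f.rangeRestrict) fun x => ?_,
    fun x => ?_⟩
  · rw [LinearMap.mem_ker, LinearMap.sub_apply, map_sub, LinearMap.comp_apply, hg',
      LinearMap.id_apply, LinearMap.codRestrict_apply, sub_self]
  · rw [LinearMap.comp_apply]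
    congr 1
    refine Subtype.ext ?_
    have h0 : f.rangeRestrict x = 0 := Subtype.ext x.2
    rw [LinearMap.codRestrict_apply, LinearMap.sub_apply, LinearMap.comp_apply, h0, map_zero,
      sub_zero, LinearMap.id_apply]

theorem exists_extend (p : Submodule R M) [Module.Projective R (M ⧸ p)] (φ : p →ₗ[R] P) :
    ∃ ψ : M →ₗ[R] P, ∀ x : p, ψ x = φ x := by
  have : Module.Projective R (LinearMap.range p.mkQ) :=
    Module.Projective.of_equiv (LinearEquiv.ofTop (LinearMap.range p.mkQ) p.range_mkQ).symm
  obtain ⟨ψ, hψ⟩ := exists_extend_ker p.mkQ (φ ∘ₗ (LinearEquiv.ofEq _ _ p.ker_mkQ).toLinearMap)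
  exact ⟨ψ, fun x => hψ ⟨x.1, by rw [p.ker_mkQ]; exact x.2⟩⟩

theorem exists_factor_range (g : M →ₗ[R] N) (φ : M →ₗ[R] P) (h : ∀ x, g x = 0 → φ x = 0) :
    ∃ ψ : LinearMap.range g →ₗ[R] P, ∀ x, ψ ⟨g x, ⟨x, rfl⟩⟩ = φ x := by
  have hle : LinearMap.ker g ≤ LinearMap.ker φ := fun x hx => h x hx
  refine ⟨Submodule.liftQ (LinearMap.ker g) φ hle ∘ₗ g.quotKerEquivRange.symm.toLinearMap,
    fun x => ?_⟩
  have e : g.quotKerEquivRange.symm ⟨g x, ⟨x, rfl⟩⟩ = Submodule.Quotient.mk x := by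
    rw [LinearEquiv.symm_apply_eq]
    rfl
  rw [LinearMap.comp_apply, LinearEquiv.coe_coe, e]
  rfl

/-- The map from a subquotient induced by a map vanishing on the denominator. -/
def Subquotient.lift {Z B : Submodule R M} (f : Z →ₗ[R] N) (h : ∀ z : Z, z.1 ∈ B → f z = 0) :
    Subquotient Z B →ₗ[R] N :=
  Submodule.liftQ _ f fun z hz => h z hz

end Extension

/-! ### Evaluation of cohomology on homology -/

section Kronecker

variable {R : Type u} [CommRing R] {M₁ M₂ M₃ M₄ : Type*} [AddCommGroup M₁] [Module R M₁]
  [AddCommGroup M₂] [Module R M₂] [AddCommGroup M₃] [Module R M₃] [AddCommGroup M₄] [Module R M₄]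

/-- The evaluation of cohomology classes on homology classes. -/
def kroneckerMap (f : M₁ →ₗ[R] M₂) (g : M₂ →ₗ[R] M₃) :
    midCohomology f g →ₗ[R] Module.Dual R (midHomology f g) :=
  Subquotient.lift
    { toFun := fun φ => Subquotient.lift (φ.1 ∘ₗ (LinearMap.ker g).subtype) (by
        rintro z ⟨x, hx⟩
        rw [LinearMap.comp_apply, Submodule.subtype_apply, ← hx]
        exact LinearMap.congr_fun (LinearMap.mem_ker.1 φ.2) x)
      map_add' := fun φ ψ => LinearMap.ext fun x => by
        obtain ⟨x, rfl⟩ := Subquotient.mk_surjective _ _ x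
        rfl
      map_smul' := fun r φ => LinearMap.ext fun x => by
        obtain ⟨x, rfl⟩ := Subquotient.mk_surjective _ _ x
        rfl }
    (by
      rintro ⟨φ, hφ⟩ ⟨ψ, rfl⟩
      refine LinearMap.ext fun x => ?_
      obtain ⟨x, rfl⟩ := Subquotient.mk_surjective _ _ x
      change ψ (g x) = 0
      rw [LinearMap.mem_ker.1 x.2, map_zero])

/-- The universal coefficient theorem without its `Ext` term, which vanishes because the homology at
`M₃`, one degree below, is projective. -/
theorem kroneckerMap_bijective {f : M₁ →ₗ[R] M₂} {g : M₂ →ₗ[R] M₃} {h : M₃ →ₗ[R] M₄}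
    (hgf : ∀ x, g (f x) = 0) (hhg : ∀ x, h (g x) = 0)
    [Module.Projective R (LinearMap.range g)] [Module.Projective R (LinearMap.range h)]
    [hH : Module.Projective R (midHomology g h)] : Function.Bijective (kroneckerMap f g) := by
  constructor
  · rw [injective_iff_map_eq_zero]
    intro y hy
    obtain ⟨⟨φ, hφ⟩, rfl⟩ := Subquotient.mk_surjective _ _ y
    have h1 : ∀ x, g x = 0 → φ x = 0 := fun x hx =>
      LinearMap.congr_fun hy (Subquotient.mk _ _ ⟨x, hx⟩)
    obtain ⟨φ₁, hφ₁⟩ := exists_factor_range g φ h1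
    have : Module.Projective R (LinearMap.ker h ⧸ (LinearMap.range g).submoduleOf (LinearMap.ker h)) :=
      hH
    -- A cocycle vanishing on cycles is a functional on the range of `g`. It extends to the kernel
    -- of `h` because the homology there is projective, then to `M₃` because the range of `h` is
    -- projective.
    obtain ⟨φ₂, hφ₂⟩ := exists_extend ((LinearMap.range g).submoduleOf (LinearMap.ker h))
      (φ₁ ∘ₗ LinearMap.codRestrict _ ((LinearMap.ker h).subtype ∘ₗ Submodule.subtype _)
        fun x => x.2)
    obtain ⟨φ₃, hφ₃⟩ := exists_extend_ker h φ₂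
    refine Subquotient.mk_eq_zero.2 ⟨φ₃, LinearMap.ext fun x => ?_⟩
    change φ₃ (g x) = φ x
    exact (hφ₃ ⟨g x, hhg x⟩).trans ((hφ₂ ⟨⟨g x, hhg x⟩, ⟨x, rfl⟩⟩).trans (hφ₁ x))
  · intro y
    -- A functional on homology, seen on cycles, extends to all chains; vanishing on boundaries
    -- makes it a cocycle.
    obtain ⟨φ, hφ⟩ := exists_extend_ker g (y ∘ₗ Subquotient.mk _ _)
    refine ⟨Subquotient.mk _ _ ⟨φ, LinearMap.mem_ker.2 (LinearMap.ext fun x => ?_)⟩,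
      LinearMap.ext fun x => ?_⟩
    · refine (hφ ⟨f x, hgf x⟩).trans ?_
      refine (congrArg y (Subquotient.mk_eq_zero.2 ⟨x, rfl⟩)).trans (map_zero y)
    · obtain ⟨x, rfl⟩ := Subquotient.mk_surjective _ _ x
      exact hφ x

variable {C : ℤ → Type*} [∀ n, AddCommGroup (C n)] [∀ n, Module R (C n)]

/-- The evaluation of cohomology classes on homology classes. -/
def GradedDiff.kronecker (δ : GradedDiff R C) (n : ℤ) :
    δ.cohomology n →ₗ[R] Module.Dual R (δ.homology n) :=
  kroneckerMap _ _

theorem GradedDiff.kronecker_bijective (δ : GradedDiff R C)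
    (hδ : ∀ i j k hij hjk x, δ j k hjk (δ i j hij x) = 0)
    (hrange : ∀ i j hij, Module.Projective R (LinearMap.range (δ i j hij))) (n : ℤ)
    (hH : Module.Projective R (δ.homology (n - 1))) : Function.Bijective (δ.kronecker n) := by
  obtain ⟨e⟩ := δ.homology_equiv_mid (i := n) (j := n - 1) (k := n - 1 - 1) (n := n - 1)
    (by omega) (by omega) rfl
  have : Module.Projective R (midHomology (δ n (n - 1) (by omega))
      (δ (n - 1) (n - 1 - 1) (by omega))) := Module.Projective.of_equiv e.symm
  exact kroneckerMap_bijective (h := δ (n - 1) (n - 1 - 1) _) (fun x => hδ _ _ _ rfl _ x)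
    (fun x => hδ _ _ _ _ _ x)

end Kronecker

/-! ### Character groups and duality -/

section CharGroups

variable {R : Type u} [CommRing R] {U W U' W' : Type u} [AddCommGroup U] [Module R U]
  [AddCommGroup W] [Module R W] [AddCommGroup U'] [Module R U'] [AddCommGroup W'] [Module R W']

theorem IsSplitHom.free_domain {θ : U →ₗ[R] W} (hθ : IsSplitHom θ) : Module.Free R U := by
  have := hθ.free_ker
  have := hθ.free_range
  obtain ⟨e⟩ := exists_equiv_ker_prod θ.rangeRestrict θ.surjective_rangeRestrict
  rw [LinearMap.ker_rangeRestrict] at e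
  exact Module.Free.of_equiv e.symm

theorem IsSplitHom.free_codomain {θ : U →ₗ[R] W} (hθ : IsSplitHom θ) : Module.Free R W := by
  have := hθ.free_coker
  have := hθ.free_range
  obtain ⟨e⟩ := exists_equiv_ker_prod (LinearMap.range θ).mkQ (Submodule.mkQ_surjective _)
  rw [Submodule.ker_mkQ] at e
  exact Module.Free.of_equiv e.symm

theorem mem_range_dualMap {θ : U →ₗ[R] W} (hθ : IsSplitHom θ) (φ : Module.Dual R U) :
    φ ∈ LinearMap.range θ.dualMap ↔ ∀ x, θ x = 0 → φ x = 0 := by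
  constructor
  · rintro ⟨ψ, rfl⟩ x hx
    rw [LinearMap.dualMap_apply, hx, map_zero]
  · intro h
    have := hθ.free_coker
    obtain ⟨χ, hχ⟩ := exists_factor_range θ φ h
    obtain ⟨ψ, hψ⟩ := exists_extend (LinearMap.range θ) χ
    exact ⟨ψ, LinearMap.ext fun x => (hψ ⟨θ x, ⟨x, rfl⟩⟩).trans (hχ x)⟩

/-- The kernel of the transpose annihilates the range of `θ`, so it is the dual of the cokernel. The
range of the transpose consists of the functionals vanishing on the kernel of `θ`: these are the
functionals on the range, and dividing by them leaves the functionals on the kernel. -/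
theorem cocharGroup_dualMap {θ : U →ₗ[R] W} (hθ : IsSplitHom θ) (s : PointIndex) :
    Nonempty (cocharGroup θ.dualMap s ≃ₗ[R] Module.Dual R (charGroup θ s)) := by
  cases s with
  | inSigma =>
    exact ⟨(LinearEquiv.ofEq _ _ (LinearMap.ker_dualMap_eq_dualAnnihilator_range θ)).trans
      (Submodule.dualQuotEquivDualAnnihilator _).symm⟩
  | inOmega =>
    have := hθ.free_range
    let res : Module.Dual R U →ₗ[R] Module.Dual R (LinearMap.ker θ) :=
      (LinearMap.ker θ).subtype.dualMap
    have h1 : LinearMap.range θ.dualMap = LinearMap.ker res := by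
      ext φ
      rw [mem_range_dualMap hθ, LinearMap.mem_ker]
      exact ⟨fun h => LinearMap.ext fun x => h x.1 x.2, fun h x hx => LinearMap.congr_fun h ⟨x, hx⟩⟩
    have h2 : Function.Surjective res := fun φ => by
      obtain ⟨ψ, hψ⟩ := exists_extend_ker θ φ
      exact ⟨ψ, LinearMap.ext hψ⟩
    exact ⟨(Submodule.quotEquivOfEq _ _ h1).trans (res.quotKerEquivOfSurjective h2)⟩
  | neither =>
    have h1 : LinearMap.range θ.dualMap = LinearMap.range θ.rangeRestrict.dualMap := by
      have := hθ.free_coker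
      ext φ
      constructor
      · rintro ⟨ψ, rfl⟩
        exact ⟨ψ ∘ₗ (LinearMap.range θ).subtype, rfl⟩
      · rintro ⟨ψ, rfl⟩
        obtain ⟨χ, hχ⟩ := exists_extend (LinearMap.range θ) ψ
        exact ⟨χ, LinearMap.ext fun x => hχ (θ.rangeRestrict x)⟩
    have h2 : Function.Injective θ.rangeRestrict.dualMap :=
      LinearMap.dualMap_injective_of_surjective θ.surjective_rangeRestrict
    exact ⟨(LinearEquiv.ofEq _ _ h1).trans (LinearEquiv.ofInjective _ h2).symm⟩

theorem cocharGroup_congr {θ : W →ₗ[R] U} {θ' : W' →ₗ[R] U'} (e : W ≃ₗ[R] W') (e' : U ≃ₗ[R] U')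
    (h : ∀ x, e' (θ x) = θ' (e x)) (s : PointIndex) :
    Nonempty (cocharGroup θ s ≃ₗ[R] cocharGroup θ' s) := by
  have hr : (LinearMap.range θ).map (e' : U →ₗ[R] U') = LinearMap.range θ' := by
    ext y
    constructor
    · rintro ⟨_, ⟨x, rfl⟩, rfl⟩
      exact ⟨e x, (h x).symm⟩
    · rintro ⟨x, rfl⟩
      refine ⟨_, ⟨e.symm x, rfl⟩, ?_⟩
      exact (h _).trans (by rw [e.apply_symm_apply])
  cases s with
  | inSigma =>
    have hk : (LinearMap.ker θ).map (e : W →ₗ[R] W') = LinearMap.ker θ' := by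
      ext y
      constructor
      · rintro ⟨x, hx, rfl⟩
        refine LinearMap.mem_ker.2 ((h x).symm.trans ?_)
        rw [LinearMap.mem_ker.1 hx, map_zero]
      · intro hy
        refine ⟨e.symm y, LinearMap.mem_ker.2 (e'.injective ?_), e.apply_symm_apply y⟩
        rw [h, e.apply_symm_apply, LinearMap.mem_ker.1 hy, map_zero]
    exact ⟨(e.submoduleMap _).trans (LinearEquiv.ofEq _ _ hk)⟩
  | inOmega => exact ⟨Submodule.Quotient.equiv _ _ e' hr⟩
  | neither => exact ⟨(e'.submoduleMap _).trans (LinearEquiv.ofEq _ _ hr)⟩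

end CharGroups

/-! ### Duality for the pairs of links -/

section Reduced

variable {R : Type u} [CommRing R] [IsDomain R] [IsPrincipalIdealRing R] {V : Type}
  [LinearOrder V] [Finite V]

theorem free_submodule {M : Type*} [AddCommGroup M] [Module R M] [Module.Free R M]
    [Module.Finite R M] (q : Submodule R M) : Module.Free R q := by
  obtain ⟨n, b⟩ := Submodule.basisOfPid (Module.Free.chooseBasis R M) q
  exact Module.Free.of_basis b

theorem reducedComplex_kronecker_bijective (L : SComplex V) (n : ℤ)
    (hfree : Module.Free R ((reducedComplex R L).homology (n - 1))) :
    Function.Bijective (GradedDiff.kronecker (reducedComplex R L).diff n) := by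
  have hr : ∀ i j hij, Module.Free R (LinearMap.range ((reducedComplex R L).diff i j hij)) :=
    fun i j hij => by
      have : Module.Free R ((reducedComplex R L).C j) :=
        free_submodule (M := Finset V →₀ R) _
      exact free_submodule (M := (reducedComplex R L).C j) _
  refine GradedDiff.kronecker_bijective _
    (fun i j k hij hjk x => Subtype.ext ((reducedComplex R L).d_d _ x.1 x.2))
    (fun i j hij => ?_) n ?_
  · have := hr i j hij
    infer_instance
  · have : Module.Projective R ((reducedComplex R L).homology (n - 1)) := inferInstance
    exact this

/-- Evaluation identifies `ι°` with the transpose of `ι`. Because of the suspension this happens in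
degree `n - 1`, and bijectivity there uses freeness of the homology in degree `n - 2`. -/
theorem pairCohomology_equiv_dual {X A : SComplex V} (h : A ≤ X) (p : Finset V × Finset V)
    (hsplit : ∀ n, IsSplitHom (linkMap R h p n)) (s : PointIndex) (n : ℤ) :
    Nonempty (pairCohomology R h s p n ≃ₗ[R] Module.Dual R (pairHomology R h s p n)) := by
  have bX := reducedComplex_kronecker_bijective (X.link p.1 p.2) (n - 1)
    (hsplit (n - 1 - 1)).free_codomain
  have bA := reducedComplex_kronecker_bijective (A.link p.1 p.2) (n - 1)
    (hsplit (n - 1 - 1)).free_domain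
  obtain ⟨e1⟩ := cocharGroup_congr (θ := colinkMap R h p (n - 1))
    (θ' := (linkMap R h p (n - 1)).dualMap)
    (LinearEquiv.ofBijective _ bX) (LinearEquiv.ofBijective _ bA) (fun x => by
      obtain ⟨x, rfl⟩ := Subquotient.mk_surjective _ _ x
      refine LinearMap.ext fun y => ?_
      obtain ⟨y, rfl⟩ := Subquotient.mk_surjective _ _ y
      rfl) s
  obtain ⟨e2⟩ := cocharGroup_dualMap (hsplit (n - 1)) s
  exact ⟨e1.trans e2⟩

end Reduced

/-! ### Diagonal tensor products as products of copies -/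

section DiagonalTensor

variable {R : Type u} [CommRing R] {I : Type} {J : Set I} {P Q : I → ℤ → Type u}
  [∀ a i, AddCommGroup (P a i)] [∀ a i, Module R (P a i)]
  [∀ a i, AddCommGroup (Q a i)] [∀ a i, Module R (Q a i)]

/-- A diagonal tensor product with modules that have bases is a product of copies of the other
factors. -/
theorem diagonalTensor_equiv_pi {C : Type} [Finite C] (α : C → I) (δ : C → ℤ) (hα : ∀ c, α c ∈ J)
    (b : ∀ a ∈ J, ∀ l, Nonempty (Module.Basis {c // α c = a ∧ δ c = l} R (Q a l))) (d : ℤ) :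
    Nonempty (diagonalTensor R J P Q d ≃ₗ[R] ∀ c, P (α c) (d - δ c)) := by
  classical
  have := Fintype.ofFinite C
  let B (x : Σ _ : J, {p : ℤ × ℤ // p.1 + p.2 = d}) : Type :=
    {c // α c = x.1.1 ∧ δ c = x.2.1.2}
  -- Each `c` occurs exactly once, at `a = α c` and in bidegree `(d - δ c, δ c)`.
  let e : (Σ x, B x) ≃ C :=
    { toFun := fun x => x.2.1
      invFun := fun c => ⟨⟨⟨α c, hα c⟩, ⟨(d - δ c, δ c), sub_add_cancel _ _⟩⟩, ⟨c, rfl, rfl⟩⟩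
      left_inv := by
        rintro ⟨⟨⟨a, ha⟩, ⟨⟨i, l⟩, hil⟩⟩, ⟨c, h1, h2⟩⟩
        dsimp only at h1 h2 hil
        subst h1 h2
        obtain rfl : i = d - δ c := by omega
        rfl
      right_inv := fun c => rfl }
  have e1 : ∀ (a : J) (p : {p : ℤ × ℤ // p.1 + p.2 = d}),
      Nonempty (P a.1 p.1.1 ⊗[R] Q a.1 p.1.2 ≃ₗ[R] ⨁ _ : B ⟨a, p⟩, P a.1 p.1.1) := fun a p => by
    obtain ⟨b⟩ := b a.1 a.2 p.1.2
    exact ⟨(TensorProduct.equivFinsuppOfBasisRight b).trans (finsuppLEquivDirectSum R _ _)⟩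
  let e1' := fun a p => Classical.choice (e1 a p)
  let e2 : diagonalTensor R J P Q d ≃ₗ[R]
      ⨁ a : J, ⨁ p : {p : ℤ × ℤ // p.1 + p.2 = d}, ⨁ _ : B ⟨a, p⟩, P a.1 p.1.1 :=
    DirectSum.congrLinearEquiv fun a => DirectSum.congrLinearEquiv fun p => e1' a p
  let e3 := DirectSum.sigmaLcurryEquiv R (ι := J) (α := fun _ => {p : ℤ × ℤ // p.1 + p.2 = d})
    (δ := fun a p => ⨁ _ : B ⟨a, p⟩, P a.1 p.1.1)
  let e4 := DirectSum.sigmaLcurryEquiv R (ι := Σ _ : J, {p : ℤ × ℤ // p.1 + p.2 = d}) (α := B)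
    (δ := fun x _ => P x.1.1 x.2.1.1)
  let e5 := DirectSum.lequivCongrLeft R (M := fun x : Σ x, B x => P x.1.1.1 x.1.2.1.1) e
  exact ⟨e2.trans (e3.symm.trans (e4.symm.trans (e5.trans
    (DirectSum.linearEquivFunOnFintype R C _))))⟩

end DiagonalTensor

/-! ### Families of generators as bases of tensor products -/

section JointBasis

variable {R : Type u} [CommRing R] {m : ℕ} {n : Fin m → ℕ}
  {S : (k : Fin m) → Set (Finset (Fin (n k)) × Finset (Fin (n k)))}
  {rk : ∀ k, PointIndex → Finset (Fin (n k)) × Finset (Fin (n k)) → ℤ → ℕ}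

/-- The generators of a block. -/
abbrev BlockGen (S : (k : Fin m) → Set (Finset (Fin (n k)) × Finset (Fin (n k))))
    (rk : ∀ k, PointIndex → Finset (Fin (n k)) × Finset (Fin (n k)) → ℤ → ℕ) (k : Fin m) : Type :=
  Σ p : S k, Σ s : PointIndex, Σ j : ℤ, Fin (rk k s p.1 j)

theorem exists_indexPart (p : ∀ k, Finset (Fin (n k)) × Finset (Fin (n k))) :
    ∃ q : Finset (JoinVertex n) × Finset (JoinVertex n), ∀ k, indexPart q k = p k := by
  refine ⟨(Finset.univ.filter fun v => (ofLex v).2 ∈ (p (ofLex v).1).1,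
    Finset.univ.filter fun v => (ofLex v).2 ∈ (p (ofLex v).1).2), fun k => Prod.ext ?_ ?_⟩ <;>
  · ext i
    exact mem_blockPart.trans (Finset.mem_filter.trans (and_iff_right (Finset.mem_univ _)))

theorem indexPart_injective :
    Function.Injective (indexPart : Finset (JoinVertex n) × Finset (JoinVertex n) → _) := by
  intro q q' h
  refine Prod.ext (Finset.ext fun v => ?_) (Finset.ext fun v => ?_)
  · have := congrArg Prod.fst (congrFun h (ofLex v).1)
    exact mem_blockPart.symm.trans ((Finset.ext_iff.1 this (ofLex v).2).trans mem_blockPart)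
  · have := congrArg Prod.snd (congrFun h (ofLex v).1)
    exact mem_blockPart.symm.trans ((Finset.ext_iff.1 this (ofLex v).2).trans mem_blockPart)

theorem kindIndex_eq_iff {a : Finset (Fin m) × Finset (Fin m)} (ha : a ∈ totalIndex (Fin m))
    {s : Fin m → PointIndex} : kindIndex s = a ↔ ∀ k, s k = pointIndex a k := by
  constructor
  · rintro rfl k
    rw [pointIndex_kindIndex]
  · intro h
    rw [funext h, kindIndex_pointIndex ha]

/-- The families of generators of given index and degree. -/
abbrev GenOver (S : (k : Fin m) → Set (Finset (Fin (n k)) × Finset (Fin (n k))))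
    (rk : ∀ k, PointIndex → Finset (Fin (n k)) × Finset (Fin (n k)) → ℤ → ℕ)
    (a : Finset (Fin m) × Finset (Fin m)) (l : ℤ) : Type :=
  {c : ∀ k, BlockGen S rk k // (kindIndex fun k => (c k).2.1) = a ∧ ∑ k, (c k).2.2.1 = l}

/-- The kinds of a family in `GenOver` are forced by `a`, so such a family amounts to its degrees,
block indices and positions. Here the block index is chosen inside each factor. -/
theorem factor_genOver_equiv {a : Finset (Fin m) × Finset (Fin m)} (ha : a ∈ totalIndex (Fin m))
    (l : ℤ) : Nonempty ((Σ j : {j : Fin m → ℤ // ∑ k, j k = l}, ∀ k, Σ p : S k,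
      Fin (rk k (pointIndex a k) p.1 (j.1 k))) ≃ GenOver S rk a l) := by
  refine ⟨Equiv.ofBijective (fun x => ⟨fun k => ⟨(x.2 k).1, pointIndex a k, x.1.1 k, (x.2 k).2⟩,
    kindIndex_pointIndex ha, x.1.2⟩) ⟨?_, ?_⟩⟩
  · rintro ⟨⟨j, hj⟩, x⟩ ⟨⟨j', hj'⟩, x'⟩ h
    have h1 := fun k => congrFun (congrArg Subtype.val h) k
    obtain rfl : j = j' := funext fun k => congrArg (fun y => y.2.2.1) (h1 k)
    obtain rfl : x = x' := funext fun k => by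
      have h2 := h1 k
      dsimp only at h2
      generalize x k = y at h2 ⊢
      generalize x' k = y' at h2 ⊢
      obtain ⟨p, i⟩ := y
      obtain ⟨p', i'⟩ := y'
      obtain rfl : p = p' := congrArg Sigma.fst h2
      simpa using h2
    rfl
  · rintro ⟨c, h1, h2⟩
    rw [kindIndex_eq_iff ha] at h1
    have h3 : ∀ k, ∃ x : Σ p : S k, Fin (rk k (pointIndex a k) p.1 (c k).2.2.1),
        (⟨x.1, pointIndex a k, (c k).2.2.1, x.2⟩ : BlockGen S rk k) = c k := fun k => by
      have h4 := h1 k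
      generalize c k = y at h4 ⊢
      obtain ⟨p, s, j, i⟩ := y
      change s = _ at h4
      subst h4
      exact ⟨⟨p, i⟩, rfl⟩
    choose x hx using h3
    exact ⟨⟨⟨fun k => (c k).2.2.1, h2⟩, x⟩, Subtype.ext (funext hx)⟩

/-- As in `factor_genOver_equiv`, except that all block indices are recorded at once by one index of
the join; `indexPart` is a bijection onto families of block indices. -/
theorem joint_genOver_equiv {a : Finset (Fin m) × Finset (Fin m)} (ha : a ∈ totalIndex (Fin m))
    (l : ℤ) : Nonempty ((Σ q : joinIndex S, Σ j : {j : Fin m → ℤ // ∑ k, j k = l}, ∀ k,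
      Fin (rk k (pointIndex a k) (indexPart q.1 k) (j.1 k))) ≃ GenOver S rk a l) := by
  refine ⟨Equiv.ofBijective (fun x => ⟨fun k => ⟨⟨indexPart x.1.1 k, x.1.2 k⟩, pointIndex a k,
    x.2.1.1 k, x.2.2 k⟩, kindIndex_pointIndex ha, x.2.1.2⟩) ⟨?_, ?_⟩⟩
  · rintro ⟨⟨q, hq⟩, ⟨j, hj⟩, x⟩ ⟨⟨q', hq'⟩, ⟨j', hj'⟩, x'⟩ h
    have h1 := fun k => congrFun (congrArg Subtype.val h) k
    obtain rfl : q = q' := indexPart_injective (funext fun k => congrArg (fun y => y.1.1) (h1 k))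
    obtain rfl : j = j' := funext fun k => congrArg (fun y => y.2.2.1) (h1 k)
    obtain rfl : x = x' := funext fun k => by simpa using h1 k
    rfl
  · rintro ⟨c, h1, h2⟩
    rw [kindIndex_eq_iff ha] at h1
    obtain ⟨q, hq⟩ := exists_indexPart fun k => (c k).1.1
    have hqS : ∀ k, indexPart q k ∈ S k := fun k => hq k ▸ (c k).1.2
    have h3 : ∀ k, ∃ x : Fin (rk k (pointIndex a k) (indexPart q k) (c k).2.2.1),
        (⟨⟨indexPart q k, hqS k⟩, pointIndex a k, (c k).2.2.1, x⟩ :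
          BlockGen S rk k) = c k := fun k => by
      have h4 := h1 k
      have h5 := hq k
      generalize c k = y at h4 h5 ⊢
      obtain ⟨⟨p, hp⟩, s, j, i⟩ := y
      change s = _ at h4
      change _ = p at h5
      subst h4 h5
      exact ⟨i, rfl⟩
    choose x hx using h3
    exact ⟨⟨⟨q, hqS⟩, ⟨fun k => (c k).2.2.1, h2⟩, x⟩,
      Subtype.ext (funext hx)⟩

variable {N : ∀ k, PointIndex → Finset (Fin (n k)) × Finset (Fin (n k)) → ℤ → Type u}
  [∀ k s p j, AddCommGroup (N k s p j)] [∀ k s p j, Module R (N k s p j)]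

theorem exists_factor_basis
    (b : ∀ k s, ∀ p ∈ S k, ∀ j, Nonempty (Module.Basis (Fin (rk k s p j)) R (N k s p j)))
    {a : Finset (Fin m) × Finset (Fin m)} (ha : a ∈ totalIndex (Fin m)) (l : ℤ) :
    Nonempty (Module.Basis (GenOver S rk a l) R
      (gradedTensor R (fun k j => ⨁ p : S k, N k (pointIndex a k) p.1 j) l)) := by
  obtain ⟨e⟩ := factor_genOver_equiv (S := S) (rk := rk) ha l
  let b' := fun k s (p : S k) j => Classical.choice (b k s p.1 p.2 j)
  exact ⟨(DFinsupp.basis fun j : {j : Fin m → ℤ // ∑ k, j k = l} => Basis.piTensorProduct fun k =>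
    DFinsupp.basis fun p : S k => b' k (pointIndex a k) p (j.1 k)).reindex e⟩

theorem exists_joint_basis
    (b : ∀ k s, ∀ p ∈ S k, ∀ j, Nonempty (Module.Basis (Fin (rk k s p j)) R (N k s p j)))
    {a : Finset (Fin m) × Finset (Fin m)} (ha : a ∈ totalIndex (Fin m)) (l : ℤ) :
    Nonempty (Module.Basis (GenOver S rk a l) R
      (⨁ q : joinIndex S, gradedTensor R (fun k j => N k (pointIndex a k) (indexPart q.1 k) j) l)) := by
  obtain ⟨e⟩ := joint_genOver_equiv (S := S) (rk := rk) ha l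
  let b' := fun k s (p : S k) j => Classical.choice (b k s p.1 p.2 j)
  exact ⟨(DFinsupp.basis fun q : joinIndex S =>
    DFinsupp.basis fun j : {j : Fin m → ℤ // ∑ k, j k = l} => Basis.piTensorProduct fun k =>
      b' k (pointIndex a k) ⟨indexPart q.1 k, q.2 k⟩ (j.1 k)).reindex e⟩

end JointBasis

/-! ### The total complex as a sum of suspended link complexes -/

section Links

variable {R : Type u} [CommRing R] {V : Type} [LinearOrder V]

/-- The word with index `(σ, ω)` whose letters `β` stand at the positions in `τ`. -/
def linkWord (p : Finset V × Finset V) (τ : Finset V) (i : V) : Letter :=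
  if i ∈ p.1 then .α else if i ∈ τ then .β else if i ∈ p.2 then .γ else .η

variable {p : Finset V × Finset V} {τ : Finset V}

theorem linkWord_eq_alpha {i : V} : linkWord p τ i = .α ↔ i ∈ p.1 := by
  rw [linkWord]
  split_ifs <;> simp [*]

theorem linkWord_eq_beta (hp : p ∈ totalIndex V) (hτ : τ ⊆ p.2) {i : V} :
    linkWord p τ i = .β ↔ i ∈ τ := by
  have h1 : i ∈ p.1 → i ∉ p.2 := fun hi => Finset.disjoint_left.1 hp hi
  have h2 : i ∈ τ → i ∈ p.2 := fun hi => hτ hi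
  rw [linkWord]
  split_ifs <;> simp_all

theorem linkWord_eq_beta_or_gamma (hp : p ∈ totalIndex V) (hτ : τ ⊆ p.2) {i : V} :
    linkWord p τ i = .β ∨ linkWord p τ i = .γ ↔ i ∈ p.2 := by
  have h1 : i ∈ p.1 → i ∉ p.2 := fun hi => Finset.disjoint_left.1 hp hi
  have h2 : i ∈ τ → i ∈ p.2 := fun hi => hτ hi
  rw [linkWord]
  split_ifs <;> simp_all

theorem linkWord_erase (hp : p ∈ totalIndex V) (hτ : τ ⊆ p.2) {i : V} (hi : i ∈ τ) :
    linkWord p (τ.erase i) = Function.update (linkWord p τ) i .γ := by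
  have h2 : i ∈ p.2 := hτ hi
  have h1 : i ∉ p.1 := Finset.disjoint_right.1 hp h2
  funext j
  by_cases hj : j = i
  · subst hj
    simp [linkWord, h1, h2]
  · simp [linkWord, hj]

variable {A : SComplex V} {S : Set (Finset V × Finset V)}

theorem supported_of_mem_C {p : Finset V × Finset V} {n : ℤ} {x : Finset V →₀ R}
    (hx : x ∈ (reducedComplex R (A.link p.1 p.2)).C n) :
    x ∈ Finsupp.supported R R {τ | τ ⊆ p.2} :=
  Finsupp.supported_mono (fun _ h => h.1.1) hx

variable [Fintype V]

theorem betaSet_linkWord (hp : p ∈ totalIndex V) (hτ : τ ⊆ p.2) :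
    betaSet (linkWord p τ) = τ :=
  Finset.ext fun _ => mem_betaSet.trans (linkWord_eq_beta hp hτ)

theorem wordIndex_linkWord (hp : p ∈ totalIndex V) (hτ : τ ⊆ p.2) :
    wordIndex (linkWord p τ) = p :=
  Prod.ext (Finset.ext fun _ => mem_wordIndex_fst.trans linkWord_eq_alpha)
    (Finset.ext fun _ => mem_wordIndex_snd.trans (linkWord_eq_beta_or_gamma hp hτ))

theorem faceSet_eq_union (w : V → Letter) : faceSet w = (wordIndex w).1 ∪ betaSet w := by
  ext i
  rw [Finset.mem_union, mem_faceSet, mem_wordIndex_fst, mem_betaSet]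

theorem faceSet_linkWord (hp : p ∈ totalIndex V) (hτ : τ ⊆ p.2) :
    faceSet (linkWord p τ) = p.1 ∪ τ := by
  rw [faceSet_eq_union, wordIndex_linkWord hp hτ, betaSet_linkWord hp hτ]

theorem linkWord_wordIndex (w : V → Letter) : linkWord (wordIndex w) (betaSet w) = w := by
  funext i
  rw [linkWord]
  simp only [mem_wordIndex_fst, mem_wordIndex_snd, mem_betaSet]
  cases w i <;> simp

theorem betaSet_subset (w : V → Letter) : betaSet w ⊆ (wordIndex w).2 := fun _ hi =>
  mem_wordIndex_snd.2 (Or.inl (mem_betaSet.1 hi))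

/-- The chains of the links, as linear combinations of words. -/
noncomputable def linkWords (R : Type u) [CommRing R] (S : Set (Finset V × Finset V)) :
    (S → (Finset V →₀ R)) →ₗ[R] ((V → Letter) →₀ R) := by
  classical exact (LinearMap.lsum R _ R) fun p : S => Finsupp.lmapDomain R R (linkWord p.1)

theorem linkWords_apply [Fintype S] (x : S → (Finset V →₀ R)) :
    linkWords R S x = ∑ p, Finsupp.mapDomain (linkWord p.1) (x p) := by
  rw [linkWords, LinearMap.lsum_apply, LinearMap.sum_apply]
  congr!

/-- The letters `β` of the word stand at the vertices of the simplex, in the same order, so the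
signs agree. -/
theorem wordBoundary_mapDomain (hp : p ∈ totalIndex V) {x : Finset V →₀ R}
    (hx : x ∈ Finsupp.supported R R {τ | τ ⊆ p.2}) :
    wordBoundary R V (Finsupp.mapDomain (linkWord p) x) =
      Finsupp.mapDomain (linkWord p) (simplicialBoundary R V x) := by
  rw [Finsupp.supported_eq_span_single] at hx
  induction hx using Submodule.span_induction with
  | mem x h =>
    obtain ⟨τ, hτ, rfl⟩ := h
    rw [Finsupp.mapDomain_single, wordBoundary, simplicialBoundary, altBoundary, altBoundary,
      Finsupp.linearCombination_single, Finsupp.linearCombination_single, one_smul, one_smul,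
      betaSet_linkWord hp hτ, Finsupp.mapDomain_finsetSum]
    refine Finset.sum_congr rfl fun i hi => ?_
    rw [Finsupp.mapDomain_single, linkWord_erase hp hτ hi]
  | zero => simp
  | add x y _ _ h1 h2 => simp only [map_add, Finsupp.mapDomain_add, h1, h2]
  | smul r x _ h => simp only [map_smul, Finsupp.mapDomain_smul, h]

/-- A word recovers its index and its simplex, so exactly one summand contributes. -/
theorem linkWords_apply_linkWord (hS : S ⊆ totalIndex V) {x : S → (Finset V →₀ R)}
    (hx : ∀ p, x p ∈ Finsupp.supported R R {τ | τ ⊆ p.1.2}) (p : S) {τ : Finset V}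
    (hτ : τ ⊆ p.1.2) : linkWords R S x (linkWord p.1 τ) = x p τ := by
  classical
  have := Fintype.ofFinite S
  rw [linkWords_apply, Finsupp.finsetSum_apply, Finset.sum_eq_single p]
  · rw [Finsupp.mapDomain, Finsupp.sum_apply, Finsupp.sum, Finset.sum_eq_single τ]
    · simp
    · intro τ' hτ' hne
      rw [Finsupp.single_eq_of_ne]
      intro h
      have h1 := betaSet_linkWord (hS p.2) hτ
      rw [h, betaSet_linkWord (hS p.2) ((Finsupp.mem_supported _ _).1 (hx p) hτ')] at h1
      exact hne h1
    · intro h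
      rw [Finsupp.notMem_support_iff.1 h, Finsupp.single_zero, Finsupp.zero_apply]
  · intro p' _ hne
    by_contra h0
    have h1 := Finsupp.mapDomain_support (Finsupp.mem_support_iff.2 h0)
    obtain ⟨τ', hτ', h2⟩ := Finset.mem_image.1 h1
    have h3 := wordIndex_linkWord (hS p.2) hτ
    rw [← h2, wordIndex_linkWord (hS p'.2) ((Finsupp.mem_supported _ _).1 (hx p') hτ')] at h3
    exact hne (Subtype.ext h3)
  · intro h
    exact absurd (Finset.mem_univ _) h

theorem linkWords_mem (hS : S ⊆ totalIndex V) {n : ℤ} {x : S → (Finset V →₀ R)}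
    (hx : ∀ p : S, x p ∈ (reducedComplex R (A.link p.1.1 p.1.2)).C (n - 1)) :
    linkWords R S x ∈ (totalComplex R A S).C n := by
  have := Fintype.ofFinite S
  rw [linkWords_apply]
  refine Submodule.sum_mem _ fun p _ => (Finsupp.mem_supported _ _).2 fun w hw => ?_
  classical
  obtain ⟨τ, hτ, rfl⟩ := Finset.mem_image.1 (Finsupp.mapDomain_support hw)
  obtain ⟨⟨h1, h2⟩, h3⟩ := (Finsupp.mem_supported _ _).1 (hx p) hτ
  refine ⟨?_, ?_, ?_⟩
  · rw [faceSet_linkWord (hS p.2) h1]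
    exact h2
  · rw [wordIndex_linkWord (hS p.2) h1]
    exact p.2
  · rw [betaSet_linkWord (hS p.2) h1, h3, sub_add_cancel]

/-- The total complex of `A` is the direct sum of the suspended complexes of the links. -/
noncomputable def linkWordsRetract (hS : S ⊆ totalIndex V) (A : SComplex V) :
    GradedRetract (GradedDiff.piShift
      (fun p : S => (reducedComplex R (A.link p.1.1 p.1.2)).diff) fun _ => 1)
      (totalComplex R A S).diff :=
  GradedRetract.ofBijective
    (fun n => LinearMap.codRestrict _ (linkWords R S ∘ₗ
        LinearMap.pi fun p => Submodule.subtype _ ∘ₗ LinearMap.proj p)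
      fun x => linkWords_mem hS fun p => (x p).2)
    (fun n => by
      constructor
      · rw [injective_iff_map_eq_zero]
        intro x h
        refine funext fun p => Subtype.ext (Finsupp.ext fun τ => ?_)
        have h1 : linkWords R S (fun p => (x p).1) = 0 := congrArg Subtype.val h
        by_contra h0
        have hτ : τ ⊆ p.1.2 := (Finsupp.mem_supported _ _).1 (supported_of_mem_C (x p).2)
          (Finsupp.mem_support_iff.2 h0)
        have h2 := linkWords_apply_linkWord hS (fun p => supported_of_mem_C (x p).2) p hτ
        rw [h1, Finsupp.zero_apply] at h2
        exact h0 h2.symm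
      · intro y
        classical
        -- Every word is `linkWord` of its own index and of its positions of `β`, so the
        -- coefficients of `y` at these words define the preimage.
        let z : S → (Finset V →₀ R) := fun p => Finsupp.equivFunOnFinite.symm fun τ =>
          if τ ⊆ p.1.2 then y.1 (linkWord p.1 τ) else 0
        have hz : ∀ p : S, ∀ τ ⊆ p.1.2, z p τ = y.1 (linkWord p.1 τ) := fun p τ hτ => if_pos hτ
        have hz' : ∀ p : S, z p ∈ (reducedComplex R (A.link p.1.1 p.1.2)).C (n - 1) := by
          refine fun p => (Finsupp.mem_supported _ _).2 fun τ hτ => ?_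
          have h0 : (if τ ⊆ p.1.2 then y.1 (linkWord p.1 τ) else 0) ≠ 0 :=
            Finsupp.mem_support_iff.1 hτ
          obtain ⟨h1, h2⟩ := ite_ne_right_iff.1 h0
          have h3 := (Finsupp.mem_supported _ _).1 y.2 (Finsupp.mem_support_iff.2 h2)
          obtain ⟨h4, h5, h6⟩ := h3
          rw [faceSet_linkWord (hS p.2) h1] at h4
          rw [betaSet_linkWord (hS p.2) h1] at h6
          exact ⟨⟨h1, h4⟩, by omega⟩
        refine ⟨fun p => ⟨z p, hz' p⟩, Subtype.ext (Finsupp.ext fun w => ?_)⟩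
        change linkWords R S z w = y.1 w
        by_cases hw : wordIndex w ∈ S
        · have h1 := linkWords_apply_linkWord hS (fun p => supported_of_mem_C (hz' p))
            ⟨wordIndex w, hw⟩ (betaSet_subset w)
          rw [hz _ _ (betaSet_subset w), linkWord_wordIndex] at h1
          exact h1
        · have h1 : linkWords R S z ∈ (totalComplex R A S).C n := linkWords_mem hS hz'
          trans 0
          · by_contra h
            exact hw ((Finsupp.mem_supported _ _).1 h1 (Finsupp.mem_support_iff.2 h)).2.1
          · by_contra h
            exact hw ((Finsupp.mem_supported _ _).1 y.2
              (Finsupp.mem_support_iff.2 (Ne.symm h))).2.1)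
    (fun i j hij => LinearMap.ext fun x => Subtype.ext (by
      have := Fintype.ofFinite S
      change linkWords R S (fun p => simplicialBoundary R V (x p).1) =
        wordBoundary R V (linkWords R S fun p => (x p).1)
      rw [linkWords_apply, linkWords_apply, map_sum]
      exact Finset.sum_congr rfl fun p _ =>
        (wordBoundary_mapDomain (hS p.2) (supported_of_mem_C (x p).2)).symm))

end Links

/-! ### Field coefficients -/

section Field

variable {R : Type u} [CommRing R] [IsDomain R] [IsPrincipalIdealRing R]

/-- Nonzero scalars are units, so the module is torsion-free, and a finite torsion-free module over
a principal ideal domain is free. -/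
theorem Module.Free.of_isField (hR : IsField R) (M : Type*) [AddCommGroup M] [Module R M]
    [Module.Finite R M] : Module.Free R M := by
  have : Module.IsTorsionFree R M := ⟨fun r hr => by
    obtain ⟨s, hs⟩ := hR.mul_inv_cancel hr.ne_zero
    exact (IsUnit.of_mul_eq_one s hs).isSMulRegular M⟩
  exact Module.free_of_finite_type_torsion_free'

theorem isSplitHom_of_isField (hR : IsField R) {U W : Type*} [AddCommGroup U] [Module R U]
    [AddCommGroup W] [Module R W] [Module.Finite R U] [Module.Finite R W] (θ : U →ₗ[R] W) :
    IsSplitHom θ :=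
  ⟨.of_isField hR _, .of_isField hR _, .of_isField hR _⟩

end Field

theorem rightIndex_subset_totalIndex {V : Type} : rightIndex V ⊆ totalIndex V := fun p hp => by
  have h : p.1 = ∅ := hp
  change Disjoint p.1 p.2
  rw [h]
  exact Finset.disjoint_empty_left _

/-! ### Both diagonal tensor products over families of generators -/

section GenericSplit

variable {R : Type u} [CommRing R] {m : ℕ} {n : Fin m → ℕ}
  {S : (k : Fin m) → Set (Finset (Fin (n k)) × Finset (Fin (n k)))}
  {rk : ∀ k, PointIndex → Finset (Fin (n k)) × Finset (Fin (n k)) → ℤ → ℕ}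
  (N : ∀ k, PointIndex → Finset (Fin (n k)) × Finset (Fin (n k)) → ℤ → Type u)
  [∀ k s p j, AddCommGroup (N k s p j)] [∀ k s p j, Module R (N k s p j)]
  (P : Finset (Fin m) × Finset (Fin m) → ℤ → Type u)
  [∀ a i, AddCommGroup (P a i)] [∀ a i, Module R (P a i)]
  {J : Set (Finset (Fin m) × Finset (Fin m))}

theorem diagonalTensor_joint_equiv_pi [∀ k, Finite (BlockGen S rk k)]
    (hJ : J ⊆ totalIndex (Fin m))
    (hc : ∀ c : ∀ k, BlockGen S rk k, (kindIndex fun k => (c k).2.1) ∈ J)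
    (b : ∀ k s, ∀ p ∈ S k, ∀ j, Nonempty (Module.Basis (Fin (rk k s p j)) R (N k s p j)))
    (d : ℤ) :
    Nonempty (diagonalTensor R J P (fun a l => ⨁ q : joinIndex S,
        gradedTensor R (fun k j => N k (pointIndex a k) (indexPart q.1 k) j) l) d ≃ₗ[R]
      ∀ c : ∀ k, BlockGen S rk k, P (kindIndex fun k => (c k).2.1) (d - ∑ k, (c k).2.2.1)) :=
  diagonalTensor_equiv_pi (fun c : ∀ k, BlockGen S rk k => kindIndex fun k => (c k).2.1)
    (fun c => ∑ k, (c k).2.2.1) hc (fun _ ha l => exists_joint_basis b (hJ ha) l) d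

theorem diagonalTensor_factor_equiv_pi [∀ k, Finite (BlockGen S rk k)]
    (hJ : J ⊆ totalIndex (Fin m))
    (hc : ∀ c : ∀ k, BlockGen S rk k, (kindIndex fun k => (c k).2.1) ∈ J)
    (b : ∀ k s, ∀ p ∈ S k, ∀ j, Nonempty (Module.Basis (Fin (rk k s p j)) R (N k s p j)))
    (d : ℤ) :
    Nonempty (diagonalTensor R J P
        (fun a l => gradedTensor R (fun k j => ⨁ p : S k, N k (pointIndex a k) p.1 j) l) d ≃ₗ[R]
      ∀ c : ∀ k, BlockGen S rk k, P (kindIndex fun k => (c k).2.1) (d - ∑ k, (c k).2.2.1)) :=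
  diagonalTensor_equiv_pi (fun c : ∀ k, BlockGen S rk k => kindIndex fun k => (c k).2.1)
    (fun c => ∑ k, (c k).2.2.1) hc (fun _ ha l => exists_factor_basis b (hJ ha) l) d

end GenericSplit

/-! ### Homology and cohomology of polyhedral joins -/

section Join

variable {R : Type u} [CommRing R] [IsDomain R] {m : ℕ} {n : Fin m → ℕ}
  {X A : (k : Fin m) → SComplex (Fin (n k))} (hAX : ∀ k, A k ≤ X k)
  {S : (k : Fin m) → Set (Finset (Fin (n k)) × Finset (Fin (n k)))}

/-- The ranks of the groups `H_j^{s;σ,ω}(X_k, A_k)`. -/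
noncomputable abbrev pairRank (R : Type u) [CommRing R] {X A : (k : Fin m) → SComplex (Fin (n k))}
    (hAX : ∀ k, A k ≤ X k) (k : Fin m) (s : PointIndex) (p : Finset (Fin (n k)) × Finset (Fin (n k)))
    (j : ℤ) : ℕ := Module.finrank R (pairHomology R (hAX k) s p j)

theorem pairRank_inSigma_eq_zero
    {k : Fin m} {p} {j : ℤ} (hp : Function.Surjective (linkMap R (hAX k) p (j - 1))) :
    pairRank R hAX k .inSigma p j = 0 := by
  have : Subsingleton (charGroup (linkMap R (hAX k) p (j - 1)) .inSigma) :=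
    Submodule.Quotient.subsingleton_iff.2 (LinearMap.range_eq_top.2 hp)
  exact Module.finrank_zero_of_subsingleton

/-- With surjective `ι` the cokernels have rank zero, so no generator has kind `inSigma` and the set
`σ` of the index is empty. -/
theorem kindIndex_mem_rightIndex
    (hepi : ∀ k, ∀ p ∈ S k, ∀ j : ℤ, Function.Surjective (linkMap R (hAX k) p j))
    (c : ∀ k, BlockGen S (pairRank R hAX) k) :
    (kindIndex fun k => (c k).2.1) ∈ rightIndex (Fin m) := by
  refine Finset.eq_empty_of_forall_notMem fun k hk => ?_
  rw [kindIndex, mem_wordIndex_fst] at hk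
  -- A generator of degree `j` comes from the map on homology in degree `j - 1`.
  have h := pairRank_inSigma_eq_zero hAX (hepi k _ (c k).1.2 ((c k).2.2.1 - 1))
  generalize c k = g at hk h
  obtain ⟨p, s, j, i⟩ := g
  cases s with
  | inSigma => exact Fin.elim0 (h ▸ i)
  | inOmega => simp [letterOf] at hk
  | neither => simp [letterOf] at hk

variable [IsPrincipalIdealRing R]

theorem finite_blockGen (hsplit : ∀ k, ∀ p ∈ S k, ∀ d, IsSplitHom (linkMap R (hAX k) p d))
    (k : Fin m) : Finite (BlockGen S (pairRank R hAX) k) := by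
  have : ∀ p : S k, Finite (SimplicialGen R (SComplex.link_mono (hAX k) p.1.1 p.1.2)) := fun p =>
    (exists_simplicialPair_retract _ (hsplit k p.1 p.2)).1
  exact inferInstanceAs (Finite (Σ p : S k,
    SimplicialGen R (SComplex.link_mono (hAX k) p.1.1 p.1.2)))

theorem exists_blockPair_retract
    (hsplit : ∀ k, ∀ p ∈ S k, ∀ d, IsSplitHom (linkMap R (hAX k) p d)) (k : Fin m)
    [hfin : Finite (BlockGen S (pairRank R hAX) k)] :
    Nonempty (BasedRetract (blockPair R (A k) (X k) (S k))
      (normalPair R (BlockGen S (pairRank R hAX) k) (fun g => g.2.1) fun g => g.2.2.1)) := by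
  have hfin : ∀ p : S k, Finite (SimplicialGen R (SComplex.link_mono (hAX k) p.1.1 p.1.2)) :=
    fun p => (exists_simplicialPair_retract _ (hsplit k p.1 p.2)).1
  let E := fun p : S k => Classical.choice
    ((exists_simplicialPair_retract _ (hsplit k p.1 p.2)).2 (hfin p))
  exact ⟨@BasedRetract.sigmaNormal R _ (S k) (Classical.decEq _) (Fintype.ofFinite _) _ _ hfin _ _ E⟩

/-- The homology and cohomology of a polyhedral join in terms of generators of the homology of the
pairs. -/
theorem polyhedralJoin_equiv_pi (hS : ∀ k, S k ⊆ totalIndex (Fin (n k)))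
    (hsplit : ∀ k, ∀ p ∈ S k, ∀ d, IsSplitHom (linkMap R (hAX k) p d)) (K : SComplex (Fin m))
    (d : ℤ) :
    Nonempty ((totalComplex R (polyhedralJoin K X A) (joinIndex S)).homology d ≃ₗ[R]
      ∀ c : ∀ k, BlockGen S (pairRank R hAX) k,
        (totalComplex R K {kindIndex fun k => (c k).2.1}).homology (d - ∑ k, (c k).2.2.1)) ∧
    Nonempty ((totalComplex R (polyhedralJoin K X A) (joinIndex S)).cohomology d ≃ₗ[R]
      ∀ c : ∀ k, BlockGen S (pairRank R hAX) k,
        (totalComplex R K {kindIndex fun k => (c k).2.1}).cohomology (d - ∑ k, (c k).2.2.1)) := by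
  have hfin := finite_blockGen hAX hsplit
  let E := fun k => Classical.choice (exists_blockPair_retract hAX hsplit k)
  let E1 := joinWordsRetract (R := R) hAX hS K
  let E2 := BasedRetract.joinRetract E K
  let E3 := normalPair.wordsRetract (R := R) (G := BlockGen S (pairRank R hAX))
    (kind := fun k g => g.2.1) (deg := fun k g => g.2.2.1) K
  constructor
  · obtain ⟨e1⟩ := E1.homology_equiv d
    obtain ⟨e2⟩ := E2.homology_equiv d
    obtain ⟨e3⟩ := E3.homology_equiv d
    obtain ⟨e4⟩ := GradedDiff.homology_piShift (fun c : ∀ k, BlockGen S (pairRank R hAX) k =>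
      (totalComplex R K {kindIndex fun k => (c k).2.1}).diff) (fun c => ∑ k, (c k).2.2.1) d
    exact ⟨e1.symm.trans (e2.trans (e3.trans e4))⟩
  · obtain ⟨e1⟩ := E1.cohomology_equiv d
    obtain ⟨e2⟩ := E2.cohomology_equiv d
    obtain ⟨e3⟩ := E3.cohomology_equiv d
    obtain ⟨e4⟩ := GradedDiff.cohomology_piShift (fun c : ∀ k, BlockGen S (pairRank R hAX) k =>
      (totalComplex R K {kindIndex fun k => (c k).2.1}).diff) (fun c => ∑ k, (c k).2.2.1) d
    exact ⟨e1.symm.trans (e2.trans (e3.trans e4))⟩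

theorem exists_pairHomology_basis
    (hsplit : ∀ k, ∀ p ∈ S k, ∀ d, IsSplitHom (linkMap R (hAX k) p d)) (k : Fin m) (s : PointIndex)
    (p) (hp : p ∈ S k) (j : ℤ) :
    Nonempty (Module.Basis (Fin (pairRank R hAX k s p j)) R (pairHomology R (hAX k) s p j)) := by
  have := (hsplit k p hp (j - 1)).charGroup_free s
  exact ⟨Module.finBasis R _⟩

theorem exists_pairCohomology_basis
    (hsplit : ∀ k, ∀ p ∈ S k, ∀ d, IsSplitHom (linkMap R (hAX k) p d)) (k : Fin m) (s : PointIndex)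
    (p) (hp : p ∈ S k) (j : ℤ) :
    Nonempty (Module.Basis (Fin (pairRank R hAX k s p j)) R (pairCohomology R (hAX k) s p j)) := by
  have := (hsplit k p hp (j - 1)).charGroup_free s
  obtain ⟨e⟩ := pairCohomology_equiv_dual (hAX k) p (hsplit k p hp) s j
  -- The dual basis has the same index set, so one set of generators serves homology and cohomology.
  exact ⟨((Module.finBasis R (pairHomology R (hAX k) s p j)).dualBasis).map e.symm⟩

/-- The homology of a polyhedral join as a diagonal tensor product with
the groups `H_*^{a;σ,ω}(X, A)`. -/
theorem polyhedralJoin_homology_equiv_joint (hS : ∀ k, S k ⊆ totalIndex (Fin (n k)))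
    (hsplit : ∀ k, ∀ p ∈ S k, ∀ d, IsSplitHom (linkMap R (hAX k) p d)) (K : SComplex (Fin m))
    {J : Set (Finset (Fin m) × Finset (Fin m))} (hJ : J ⊆ totalIndex (Fin m))
    (hc : ∀ c : ∀ k, BlockGen S (pairRank R hAX) k, (kindIndex fun k => (c k).2.1) ∈ J) (d : ℤ) :
    Nonempty ((totalComplex R (polyhedralJoin K X A) (joinIndex S)).homology d ≃ₗ[R]
      diagonalTensor R J (fun a i => (totalComplex R K {a}).homology i)
        (jointHomology R hAX S) d) :=
  have := finite_blockGen hAX hsplit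
  (polyhedralJoin_equiv_pi hAX hS hsplit K d).1.map2 (fun e f => e.trans f.symm)
    (diagonalTensor_joint_equiv_pi (fun k s p j => pairHomology R (hAX k) s p j)
      (fun a i => (totalComplex R K {a}).homology i) hJ hc
      (exists_pairHomology_basis hAX hsplit) d)

/-- The homology of a polyhedral join as a diagonal tensor product with
the tensor products `⊗_k H_*^{a_k;S_k}(X_k, A_k)`. -/
theorem polyhedralJoin_homology_equiv_factor (hS : ∀ k, S k ⊆ totalIndex (Fin (n k)))
    (hsplit : ∀ k, ∀ p ∈ S k, ∀ d, IsSplitHom (linkMap R (hAX k) p d)) (K : SComplex (Fin m))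
    {J : Set (Finset (Fin m) × Finset (Fin m))} (hJ : J ⊆ totalIndex (Fin m))
    (hc : ∀ c : ∀ k, BlockGen S (pairRank R hAX) k, (kindIndex fun k => (c k).2.1) ∈ J) (d : ℤ) :
    Nonempty ((totalComplex R (polyhedralJoin K X A) (joinIndex S)).homology d ≃ₗ[R]
      diagonalTensor R J (fun a i => (totalComplex R K {a}).homology i)
        (factorHomology R hAX S) d) :=
  have := finite_blockGen hAX hsplit
  (polyhedralJoin_equiv_pi hAX hS hsplit K d).1.map2 (fun e f => e.trans f.symm)
    (diagonalTensor_factor_equiv_pi (fun k s p j => pairHomology R (hAX k) s p j)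
      (fun a i => (totalComplex R K {a}).homology i) hJ hc
      (exists_pairHomology_basis hAX hsplit) d)

/-- The cohomology of a polyhedral join as a diagonal tensor product with
the groups `H^*_{a;σ,ω}(X, A)`. -/
theorem polyhedralJoin_cohomology_equiv_joint (hS : ∀ k, S k ⊆ totalIndex (Fin (n k)))
    (hsplit : ∀ k, ∀ p ∈ S k, ∀ d, IsSplitHom (linkMap R (hAX k) p d)) (K : SComplex (Fin m))
    {J : Set (Finset (Fin m) × Finset (Fin m))} (hJ : J ⊆ totalIndex (Fin m))
    (hc : ∀ c : ∀ k, BlockGen S (pairRank R hAX) k, (kindIndex fun k => (c k).2.1) ∈ J) (d : ℤ) :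
    Nonempty ((totalComplex R (polyhedralJoin K X A) (joinIndex S)).cohomology d ≃ₗ[R]
      diagonalTensor R J (fun a i => (totalComplex R K {a}).cohomology i)
        (jointCohomology R hAX S) d) :=
  have := finite_blockGen hAX hsplit
  (polyhedralJoin_equiv_pi hAX hS hsplit K d).2.map2 (fun e f => e.trans f.symm)
    (diagonalTensor_joint_equiv_pi (fun k s p j => pairCohomology R (hAX k) s p j)
      (fun a i => (totalComplex R K {a}).cohomology i) hJ hc
      (exists_pairCohomology_basis hAX hsplit) d)

/-- The cohomology of a polyhedral join as a diagonal tensor product with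
the tensor products `⊗_k H^*_{a_k;S_k}(X_k, A_k)`. -/
theorem polyhedralJoin_cohomology_equiv_factor (hS : ∀ k, S k ⊆ totalIndex (Fin (n k)))
    (hsplit : ∀ k, ∀ p ∈ S k, ∀ d, IsSplitHom (linkMap R (hAX k) p d)) (K : SComplex (Fin m))
    {J : Set (Finset (Fin m) × Finset (Fin m))} (hJ : J ⊆ totalIndex (Fin m))
    (hc : ∀ c : ∀ k, BlockGen S (pairRank R hAX) k, (kindIndex fun k => (c k).2.1) ∈ J) (d : ℤ) :
    Nonempty ((totalComplex R (polyhedralJoin K X A) (joinIndex S)).cohomology d ≃ₗ[R]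
      diagonalTensor R J (fun a i => (totalComplex R K {a}).cohomology i)
        (factorCohomology R hAX S) d) :=
  have := finite_blockGen hAX hsplit
  (polyhedralJoin_equiv_pi hAX hS hsplit K d).2.map2 (fun e f => e.trans f.symm)
    (diagonalTensor_factor_equiv_pi (fun k s p j => pairCohomology R (hAX k) s p j)
      (fun a i => (totalComplex R K {a}).cohomology i) hJ hc
      (exists_pairCohomology_basis hAX hsplit) d)

end Join

/-! ### The groups of `A k` as right sums -/

section RightSum

variable {R : Type u} [CommRing R]

/-- A direct sum over the two points of the right index set. -/
theorem directSum_rightPointIndex (M : PointIndex → Type*) [∀ s, AddCommGroup (M s)]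
    [∀ s, Module R (M s)] :
    Nonempty ((⨁ s : rightPointIndex, M s.1) ≃ₗ[R] M .neither × M .inOmega) := by
  classical
  have := Fintype.ofFinite rightPointIndex
  refine ⟨(DirectSum.linearEquivFunOnFintype R rightPointIndex fun s => M s.1).trans
    { toFun := fun f => (f ⟨.neither, Or.inl rfl⟩, f ⟨.inOmega, Or.inr rfl⟩)
      map_add' := fun _ _ => rfl
      map_smul' := fun _ _ => rfl
      invFun := fun x s => match s with
        | ⟨.neither, _⟩ => x.1
        | ⟨.inOmega, _⟩ => x.2
        | ⟨.inSigma, h⟩ => absurd h (by simp [rightPointIndex])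
      left_inv := fun f => by
        funext s
        match s with
        | ⟨.neither, _⟩ => rfl
        | ⟨.inOmega, _⟩ => rfl
        | ⟨.inSigma, h⟩ => exact absurd h (by simp [rightPointIndex])
      right_inv := fun _ => rfl }⟩

/-- Modules that are extensions of `N .inOmega` by `N .neither` assemble to the right sum. -/
theorem directSum_right_equiv_pi {ι : Type} [Finite ι] (N : PointIndex → ι → Type*)
    [∀ s p, AddCommGroup (N s p)] [∀ s p, Module R (N s p)] (U : ι → Type*)
    [∀ p, AddCommGroup (U p)] [∀ p, Module R (U p)]
    (e : ∀ p, Nonempty (U p ≃ₗ[R] N .neither p × N .inOmega p)) :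
    Nonempty ((⨁ s : rightPointIndex, ⨁ p : ι, N s.1 p) ≃ₗ[R] ∀ p, U p) := by
  classical
  have := Fintype.ofFinite ι
  obtain ⟨f⟩ := directSum_rightPointIndex (R := R) (fun s => ⨁ p : ι, N s p)
  let g := fun s => DirectSum.linearEquivFunOnFintype R ι (N s)
  let e' := fun p => Classical.choice (e p)
  let t : ((∀ p, N .neither p) × (∀ p, N .inOmega p)) ≃ₗ[R]
      ∀ p, N .neither p × N .inOmega p :=
    { toFun := fun x p => (x.1 p, x.2 p)
      map_add' := fun _ _ => rfl
      map_smul' := fun _ _ => rfl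
      invFun := fun y => (fun p => (y p).1, fun p => (y p).2)
      left_inv := fun _ => rfl
      right_inv := fun _ => rfl }
  exact ⟨f.trans (((g .neither).prodCongr (g .inOmega)).trans
    (t.trans (LinearEquiv.piCongrRight fun p => (e' p).symm)))⟩

variable {V : Type} [LinearOrder V] [Fintype V] {X A : SComplex V} {S : Set (Finset V × Finset V)}

/-- A module is the sum of the image and the kernel of a map with free image. -/
theorem IsSplitHom.equiv_charGroup {U W : Type u} [AddCommGroup U] [Module R U] [AddCommGroup W]
    [Module R W] {θ : U →ₗ[R] W} (hθ : IsSplitHom θ) :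
    Nonempty (U ≃ₗ[R] charGroup θ .neither × charGroup θ .inOmega) := by
  have := hθ.free_range
  obtain ⟨e⟩ := exists_equiv_ker_prod θ.rangeRestrict θ.surjective_rangeRestrict
  rw [LinearMap.ker_rangeRestrict] at e
  exact ⟨e.trans (LinearEquiv.prodComm R _ _)⟩

/-- A module is the sum of the image of a map to it and a free cokernel. -/
theorem equiv_cocharGroup {U W : Type u} [AddCommGroup U] [Module R U] [AddCommGroup W]
    [Module R W] (θ : W →ₗ[R] U) [hθ : Module.Free R (cocharGroup θ .inOmega)] :
    Nonempty (U ≃ₗ[R] cocharGroup θ .neither × cocharGroup θ .inOmega) := by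
  have : Module.Free R (U ⧸ LinearMap.range θ) := hθ
  obtain ⟨e⟩ := exists_equiv_ker_prod (LinearMap.range θ).mkQ (Submodule.mkQ_surjective _)
  rw [Submodule.ker_mkQ] at e
  exact ⟨e⟩

/-- The homology of each link of `A` is the sum of the image and the kernel of `ι`, and the total
complex is the sum of the suspended links. -/
theorem rightHomology_equiv (h : A ≤ X) (hS : S ⊆ totalIndex V)
    (hsplit : ∀ p ∈ S, ∀ d, IsSplitHom (linkMap R h p d)) (d : ℤ) :
    Nonempty ((⨁ s : rightPointIndex, ⨁ p : S, pairHomology R h s.1 p.1 d) ≃ₗ[R]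
      (totalComplex R A S).homology d) := by
  obtain ⟨e1⟩ := (linkWordsRetract (R := R) hS A).homology_equiv d
  obtain ⟨e2⟩ := GradedDiff.homology_piShift
    (fun p : S => (reducedComplex R (A.link p.1.1 p.1.2)).diff) (fun _ => 1) d
  obtain ⟨e3⟩ := directSum_right_equiv_pi (R := R)
    (fun s (p : S) => pairHomology R h s p.1 d)
    (fun p => (reducedComplex R (A.link p.1.1 p.1.2)).homology (d - 1)) fun p =>
      (hsplit p.1 p.2 (d - 1)).equiv_charGroup
  exact ⟨e3.trans (e2.symm.trans e1)⟩

variable [IsDomain R] [IsPrincipalIdealRing R]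

theorem rightCohomology_equiv (h : A ≤ X) (hS : S ⊆ totalIndex V)
    (hsplit : ∀ p ∈ S, ∀ d, IsSplitHom (linkMap R h p d)) (d : ℤ) :
    Nonempty ((⨁ s : rightPointIndex, ⨁ p : S, pairCohomology R h s.1 p.1 d) ≃ₗ[R]
      (totalComplex R A S).cohomology d) := by
  obtain ⟨e1⟩ := (linkWordsRetract (R := R) hS A).cohomology_equiv d
  obtain ⟨e2⟩ := GradedDiff.cohomology_piShift
    (fun p : S => (reducedComplex R (A.link p.1.1 p.1.2)).diff) (fun _ => 1) d
  obtain ⟨e3⟩ := directSum_right_equiv_pi (R := R)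
    (fun s (p : S) => pairCohomology R h s p.1 d)
    (fun p => (reducedComplex R (A.link p.1.1 p.1.2)).cohomology (d - 1)) fun p => by
      -- The cokernel of `ι°` is free because it is the dual of the free module `ker ι`; hence
      -- cohomology splits off the image of `ι°`.
      have := (hsplit p.1 p.2 (d - 1)).charGroup_free .inOmega
      obtain ⟨f⟩ := pairCohomology_equiv_dual h p.1 (hsplit p.1 p.2) .inOmega d
      have := Module.Free.of_equiv f.symm
      exact equiv_cocharGroup _
  exact ⟨e3.trans (e2.symm.trans e1)⟩

end RightSum
-- The theorem
theorem theorem3p11 {R : Type u} [CommRing R] [IsDomain R] [IsPrincipalIdealRing R]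
    {m : ℕ} {n : Fin m → ℕ} (K : SComplex (Fin m))
    (X A : (k : Fin m) → SComplex (Fin (n k))) (hAX : ∀ k, A k ≤ X k)
    (S : (k : Fin m) → Set (Finset (Fin (n k)) × Finset (Fin (n k))))
    (hS : ∀ k, S k ⊆ totalIndex (Fin (n k)))
    (hsplit : IsField R ∨ TotalHomologySplit R hAX) :
    (∀ d : ℤ,
      Nonempty ((totalComplex R (polyhedralJoin K X A) (joinIndex S)).homology d ≃ₗ[R]
        diagonalTensor R (totalIndex (Fin m)) (fun a i => (totalComplex R K {a}).homology i)
          (jointHomology R hAX S) d) ∧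
      Nonempty ((totalComplex R (polyhedralJoin K X A) (joinIndex S)).homology d ≃ₗ[R]
        diagonalTensor R (totalIndex (Fin m)) (fun a i => (totalComplex R K {a}).homology i)
          (factorHomology R hAX S) d) ∧
      Nonempty ((totalComplex R (polyhedralJoin K X A) (joinIndex S)).cohomology d ≃ₗ[R]
        diagonalTensor R (totalIndex (Fin m)) (fun a i => (totalComplex R K {a}).cohomology i)
          (jointCohomology R hAX S) d) ∧
      Nonempty ((totalComplex R (polyhedralJoin K X A) (joinIndex S)).cohomology d ≃ₗ[R]
        diagonalTensor R (totalIndex (Fin m)) (fun a i => (totalComplex R K {a}).cohomology i)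
          (factorCohomology R hAX S) d)) ∧
    ((∀ k, ∀ p ∈ S k, ∀ j : ℤ, Function.Surjective (linkMap R (hAX k) p j)) →
      ∀ d : ℤ,
        Nonempty ((totalComplex R (polyhedralJoin K X A) (joinIndex S)).homology d ≃ₗ[R]
          diagonalTensor R (rightIndex (Fin m)) (fun a i => (totalComplex R K {a}).homology i)
            (jointHomology R hAX S) d) ∧
        Nonempty ((totalComplex R (polyhedralJoin K X A) (joinIndex S)).homology d ≃ₗ[R]
          diagonalTensor R (rightIndex (Fin m)) (fun a i => (totalComplex R K {a}).homology i)
            (factorHomology R hAX S) d) ∧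
        Nonempty ((totalComplex R (polyhedralJoin K X A) (joinIndex S)).cohomology d ≃ₗ[R]
          diagonalTensor R (rightIndex (Fin m)) (fun a i => (totalComplex R K {a}).cohomology i)
            (jointCohomology R hAX S) d) ∧
        Nonempty ((totalComplex R (polyhedralJoin K X A) (joinIndex S)).cohomology d ≃ₗ[R]
          diagonalTensor R (rightIndex (Fin m)) (fun a i => (totalComplex R K {a}).cohomology i)
            (factorCohomology R hAX S) d) ∧
        ∀ k,
          Nonempty ((⨁ s : rightPointIndex, ⨁ p : S k, pairHomology R (hAX k) s.1 p.1 d) ≃ₗ[R]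
            (totalComplex R (A k) (S k)).homology d) ∧
          Nonempty ((⨁ s : rightPointIndex, ⨁ p : S k, pairCohomology R (hAX k) s.1 p.1 d) ≃ₗ[R]
            (totalComplex R (A k) (S k)).cohomology d)) := by
  -- Over a field every map between the finite homology groups is split, so both cases reduce to
  -- splitness at the indices in `S k`.
  have hsplit' : ∀ k, ∀ p ∈ S k, ∀ d, IsSplitHom (linkMap R (hAX k) p d) := fun k p hp d =>
    hsplit.elim (fun hR => isSplitHom_of_isField hR _) fun h => h k p (hS k hp) d
  have htotal : ∀ c : ∀ k, BlockGen S (pairRank R hAX) k,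
      (kindIndex fun k => (c k).2.1) ∈ totalIndex (Fin m) := fun c => kindIndex_mem_totalIndex _
  exact ⟨fun d => ⟨polyhedralJoin_homology_equiv_joint hAX hS hsplit' K subset_rfl htotal d,
    polyhedralJoin_homology_equiv_factor hAX hS hsplit' K subset_rfl htotal d,
    polyhedralJoin_cohomology_equiv_joint hAX hS hsplit' K subset_rfl htotal d,
    polyhedralJoin_cohomology_equiv_factor hAX hS hsplit' K subset_rfl htotal d⟩, fun hepi d =>
    have hright := kindIndex_mem_rightIndex hAX hepi
    have hJ := rightIndex_subset_totalIndex
    ⟨polyhedralJoin_homology_equiv_joint hAX hS hsplit' K hJ hright d,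
      polyhedralJoin_homology_equiv_factor hAX hS hsplit' K hJ hright d,
      polyhedralJoin_cohomology_equiv_joint hAX hS hsplit' K hJ hright d,
      polyhedralJoin_cohomology_equiv_factor hAX hS hsplit' K hJ hright d, fun k =>
      ⟨rightHomology_equiv (hAX k) (hS k) (hsplit' k) d,
        rightCohomology_equiv (hAX k) (hS k) (hsplit' k) d⟩⟩⟩
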